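/- Let $E_0,E_1$ be Banach spaces with $E_1$ continuously and densely embedded in $E_0$, let $\mu\in(0,1)$, and for $\theta\in(0,1)$ let $E_\theta:=(E_0,E_1)^0_{\theta,\infty}$ be the continuous interpolation space: the space of all $x\in E_0$ with $|x|_{E_\theta}:=\sup_{t>0}t^{-\theta}K(t,x)<\infty$ and $t^{-\theta}K(t,x)\to0$ as $t\to0^+$, where $K(t,x)=\inf_{b\in E_1}(|x-b|_{E_0}+t|b|_{E_1})$. For a Banach space $E$, $T>0$ and $J=[0,T]$, $\dot J=(0,T]$, let $BC_{1-\mu}(J,E)$ be the space of all $v\in C(\dot J,E)$ such that $t^{1-\mu}v(t)$ is bounded on $\dot J$ and $|t^{1-\mu}v(t)|_E\to0$ as $t\to0^+$, and let $BC^1_{1-\mu}(J,E)$ be the space of all $v\in C^1(\dot J,E)$ with $v,\dot v\in BC_{1-\mu}(J,E)$. Put $\mathbb E_{0,\mu}(J)=BC_{1-\mu}(J,E_0)$ and $\mathbb E_{1,\mu}(J)=BC^1_{1-\mu}(J,E_0)\cap BC_{1-\mu}(J,E_1)$, with norm $\|v\|_{\mathbb E_{1,\mu}(J)}=\sup_{t\in\dot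 J}t^{1-\mu}(|\dot v(t)|_{E_0}+|v(t)|_{E_1})$; for $v\in\mathbb E_{1,\mu}(J)$, $v(0)$ denotes $\lim_{t\to0^+}v(t)$ in $E_0$. Let $\mathcal M_\mu(E_1,E_0)$ be the set of all bounded linear $B:E_1\to E_0$ such that for some $T>0$ and $J=[0,T]$, for every $(f,x)\in\mathbb E_{0,\mu}(J)\times E_\mu$ there is a unique $u\in\mathbb E_{1,\mu}(J)$ with $\dot u+Bu=f$ on $\dot J$ and $u(0)=x$. Let $V_\mu\subset E_\mu$ be open, and assume: (H1) $(A,F_1):V_\mu\to\mathcal M_\mu(E_1,E_0)\times E_0$ is locally Lipschitz continuous (with respect to the norm of $\mathcal L(E_1,E_0)\times E_0$). (H2) There are $\beta\in(\mu,1)$, $m\in\mathbb N$, $\beta_j\in[\mu,\beta]$ and $\rho_j\ge0$ ($j=1,\dots,m$) with $\frac{\rho_j(\beta-\mu)+(\beta_j-\mu)}{1-\mu}\le1$ for all $j$, such that $F_2:V_\mu\cap E_\beta\to E_0$ and for each $x_0\in V_\mu$ and $R>0$ there is $C_R=C_R(x_0)>0$ with $$|F_2(x_1)-F_2(x_2)|_{E_0}\le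 C_R\sum_{j=1}^m\big(1+|x_1|_{E_\beta}^{\rho_j}+|x_2|_{E_\beta}^{\rho_j}\big)|x_1-x_2|_{E_{\beta_j}}$$ for all $x_1,x_2\in\bar B_{E_\mu}(x_0,R)\cap V_\mu\cap E_\beta$. A solution on $[0,T]$ with initial value $x\in V_\mu$ is a $V_\mu$-valued function $u\in\mathbb E_{1,\mu}([0,T])$ with $\dot u+A(u)u=F_1(u)+F_2(u)$ on $(0,T]$ and $u(0)=x$. Then every $x\in V_\mu$ has a unique maximal solution $u(\cdot,x)$, on an interval $[0,t^+(x))$ with $0<t^+(x)\le\infty$: its restriction to $[0,T]$ is a solution for every $0<T<t^+(x)$, and every solution on an interval $[0,T]$ with initial value $x$ satisfies $T<t^+(x)$ and coincides with $u(\cdot,x)$ on $[0,T]$. Moreover: 1. For every $x_0\in V_\mu$ there are positive constants $\tau,\varepsilon,\sigma,c$, depending on $x_0$, such that $\bar B_{E_\mu}(x_0,\varepsilon)\subset V_\mu$, and for all $x\in\bar B_{E_\mu}(x_0,\varepsilon)$ one has $\tau<t^+(x)$ and $u(\cdot,x)\in C([0,\tau],E_\mu)$, and for all $x_1,x_2\in\bar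 B_{E_\mu}(x_0,\varepsilon)$ $$\|u(\cdot,x_1)-u(\cdot,x_2)\|_{\mathbb E_{1,\mu}([0,\tau])}\le\sigma|x_1-x_2|_{E_\mu},\qquad \|u(\cdot,x_1)-u(\cdot,x_2)\|_{C([0,\tau],E_\mu)}\le c\,|x_1-x_2|_{E_\mu}.$$ 2. The map $(t,x)\mapsto u(t,x)$ is a locally Lipschitz continuous semiflow on $V_\mu$. That is, $\mathcal D:=\bigcup_{x\in V_\mu}[0,t^+(x))\times\{x\}$ is open in $\mathbb R_+\times V_\mu$; $u:\mathcal D\to V_\mu$ is continuous; $u(0,x)=x$; for $(s,x)\in\mathcal D$ and $t\ge0$ one has $t<t^+(u(s,x))$ if and only if $s+t<t^+(x)$, and then $u(s+t,x)=u(t,u(s,x))$; and every $(t_0,x_0)\in\mathcal D$ has a product neighbourhood $U\times W\subset\mathcal D$ in $\mathbb R_+\times V_\mu$ and a constant $c>0$ with $|u(t,x)-u(t,y)|_{E_\mu}\le c|x-y|_{E_\mu}$ for all $(t,x),(t,y)\in U\times W$. -/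

import Mathlib

open Set Filter Topology

noncomputable section

namespace QuasilinearSemiflow

section Interpolation

/-! `E₁` is embedded in `E₀` by a continuous linear map `j`. -/

variable {E₀ E₁ : Type*} [NormedAddCommGroup E₀] [NormedSpace ℝ E₀]
  [NormedAddCommGroup E₁] [NormedSpace ℝ E₁]

/-- Peetre's `K`-functional of the couple `(E₀, E₁)`:
`K(t, x) = inf { |a|_{E₀} + t |b|_{E₁} : x = a + j b }`. -/
def kFunctional (j : E₁ →L[ℝ] E₀) (t : ℝ) (x : E₀) : ℝ :=
  ⨅ b : E₁, (‖x - j b‖ + t * ‖b‖)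

/-- The function `t ↦ t ^ (-θ) * K(t, x)`. -/
def kWeighted (j : E₁ →L[ℝ] E₀) (θ : ℝ) (x : E₀) (t : ℝ) : ℝ :=
  t ^ (-θ) * kFunctional j t x

/-- The norm of the real interpolation space `(E₀, E₁)_{θ,∞}`:
`|x|_{E_θ} = sup_{t > 0} t ^ (-θ) * K(t, x)`. -/
def interpNorm (j : E₁ →L[ℝ] E₀) (θ : ℝ) (x : E₀) : ℝ :=
  ⨆ t : Ioi (0 : ℝ), kWeighted j θ x t

/-- Membership in the continuous interpolation space: the norm of `(E₀, E₁)_{θ,∞}` is finite, and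
`t ^ (-θ) * K(t, x)` tends to zero as `t → 0+`. -/
def InterpMem (j : E₁ →L[ℝ] E₀) (θ : ℝ) (x : E₀) : Prop :=
  BddAbove (range fun t : Ioi (0 : ℝ) => kWeighted j θ x t) ∧
    Tendsto (kWeighted j θ x) (𝓝[>] 0) (𝓝 0)

theorem kTerm_nonneg (j : E₁ →L[ℝ] E₀) {t : ℝ} (ht : 0 ≤ t) (x : E₀) (b : E₁) :
    0 ≤ ‖x - j b‖ + t * ‖b‖ := by positivity

theorem kTerm_bddBelow (j : E₁ →L[ℝ] E₀) {t : ℝ} (ht : 0 ≤ t) (x : E₀) :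
    BddBelow (range fun b : E₁ => ‖x - j b‖ + t * ‖b‖) :=
  ⟨0, by rintro _ ⟨b, rfl⟩; exact kTerm_nonneg j ht x b⟩

theorem kFunctional_nonneg (j : E₁ →L[ℝ] E₀) {t : ℝ} (ht : 0 ≤ t) (x : E₀) :
    0 ≤ kFunctional j t x :=
  Real.iInf_nonneg fun b => kTerm_nonneg j ht x b

theorem kFunctional_le (j : E₁ →L[ℝ] E₀) {t : ℝ} (ht : 0 ≤ t) (x : E₀) (b : E₁) :
    kFunctional j t x ≤ ‖x - j b‖ + t * ‖b‖ :=
  ciInf_le (kTerm_bddBelow j ht x) b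

theorem kFunctional_add_le (j : E₁ →L[ℝ] E₀) {t : ℝ} (ht : 0 ≤ t) (x y : E₀) :
    kFunctional j t (x + y) ≤ kFunctional j t x + kFunctional j t y := by
  refine le_ciInf_add_ciInf fun a b => ?_
  refine (kFunctional_le j ht (x + y) (a + b)).trans ?_
  have h1 : ‖x + y - j (a + b)‖ ≤ ‖x - j a‖ + ‖y - j b‖ := by
    rw [map_add, add_sub_add_comm]; exact norm_add_le _ _
  have h2 : t * ‖a + b‖ ≤ t * ‖a‖ + t * ‖b‖ := by
    rw [← mul_add]; exact mul_le_mul_of_nonneg_left (norm_add_le a b) ht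
  linarith

theorem kFunctional_smul_le (j : E₁ →L[ℝ] E₀) {t : ℝ} (ht : 0 ≤ t) (c : ℝ) (x : E₀) :
    kFunctional j t (c • x) ≤ |c| * kFunctional j t x := by
  unfold kFunctional
  rw [Real.mul_iInf_of_nonneg (abs_nonneg c)]
  refine le_ciInf fun b => (kFunctional_le j ht (c • x) (c • b)).trans (le_of_eq ?_)
  rw [map_smul, ← smul_sub, norm_smul, norm_smul, Real.norm_eq_abs]
  ring

theorem kFunctional_smul (j : E₁ →L[ℝ] E₀) {t : ℝ} (ht : 0 ≤ t) (c : ℝ) (x : E₀) :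
    kFunctional j t (c • x) = |c| * kFunctional j t x := by
  refine le_antisymm (kFunctional_smul_le j ht c x) ?_
  rcases eq_or_ne c 0 with rfl | hc
  · simpa using kFunctional_nonneg j ht (0 : E₀)
  · have h := kFunctional_smul_le j ht c⁻¹ (c • x)
    rw [smul_smul, inv_mul_cancel₀ hc, one_smul, abs_inv] at h
    have hc' : 0 < |c| := abs_pos.mpr hc
    calc |c| * kFunctional j t x ≤ |c| * (|c|⁻¹ * kFunctional j t (c • x)) :=
          mul_le_mul_of_nonneg_left h hc'.le
      _ = kFunctional j t (c • x) := by field_simp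

theorem norm_le_kFunctional_one (j : E₁ →L[ℝ] E₀) (x : E₀) :
    ‖x‖ ≤ (1 + ‖j‖) * kFunctional j 1 x := by
  unfold kFunctional
  rw [Real.mul_iInf_of_nonneg (by positivity)]
  refine le_ciInf fun b => ?_
  have h1 : ‖x‖ ≤ ‖x - j b‖ + ‖j b‖ := by simpa using norm_add_le (x - j b) (j b)
  have h2 := j.le_opNorm b
  nlinarith [norm_nonneg (x - j b), norm_nonneg b, norm_nonneg j,
    mul_nonneg (norm_nonneg j) (norm_nonneg (x - j b))]

theorem kWeighted_nonneg (j : E₁ →L[ℝ] E₀) (θ : ℝ) (x : E₀) {t : ℝ} (ht : 0 < t) :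
    0 ≤ kWeighted j θ x t :=
  mul_nonneg (Real.rpow_nonneg ht.le _) (kFunctional_nonneg j ht.le x)

theorem kWeighted_add_le (j : E₁ →L[ℝ] E₀) (θ : ℝ) (x y : E₀) {t : ℝ} (ht : 0 < t) :
    kWeighted j θ (x + y) t ≤ kWeighted j θ x t + kWeighted j θ y t := by
  unfold kWeighted
  rw [← mul_add]
  exact mul_le_mul_of_nonneg_left (kFunctional_add_le j ht.le x y) (Real.rpow_nonneg ht.le _)

theorem kWeighted_smul (j : E₁ →L[ℝ] E₀) (θ : ℝ) (c : ℝ) (x : E₀) {t : ℝ} (ht : 0 < t) :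
    kWeighted j θ (c • x) t = |c| * kWeighted j θ x t := by
  unfold kWeighted
  rw [kFunctional_smul j ht.le]
  ring

theorem interpMem_add {j : E₁ →L[ℝ] E₀} {θ : ℝ} {x y : E₀}
    (hx : InterpMem j θ x) (hy : InterpMem j θ y) : InterpMem j θ (x + y) := by
  obtain ⟨⟨a, ha⟩, hx'⟩ := hx
  obtain ⟨⟨b, hb⟩, hy'⟩ := hy
  refine ⟨⟨a + b, ?_⟩, ?_⟩
  · rintro _ ⟨t, rfl⟩
    exact (kWeighted_add_le j θ x y t.2).trans (add_le_add (ha ⟨t, rfl⟩) (hb ⟨t, rfl⟩))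
  · refine squeeze_zero' ?_ ?_ (by simpa using hx'.add hy')
    · filter_upwards [self_mem_nhdsWithin] with t ht using kWeighted_nonneg j θ _ ht
    · filter_upwards [self_mem_nhdsWithin] with t ht using kWeighted_add_le j θ x y ht

theorem interpMem_smul {j : E₁ →L[ℝ] E₀} {θ : ℝ} (c : ℝ) {x : E₀}
    (hx : InterpMem j θ x) : InterpMem j θ (c • x) := by
  obtain ⟨⟨a, ha⟩, hx'⟩ := hx
  refine ⟨⟨|c| * a, ?_⟩, ?_⟩
  · rintro _ ⟨t, rfl⟩
    change kWeighted j θ (c • x) t ≤ _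
    rw [kWeighted_smul j θ c x t.2]
    exact mul_le_mul_of_nonneg_left (ha ⟨t, rfl⟩) (abs_nonneg c)
  · have h : Tendsto (fun t => |c| * kWeighted j θ x t) (𝓝[>] 0) (𝓝 0) := by
      simpa using hx'.const_mul |c|
    refine h.congr' ?_
    filter_upwards [self_mem_nhdsWithin] with t ht using (kWeighted_smul j θ c x ht).symm

/-- The vector space underlying the continuous interpolation space
`E_θ = (E₀, E₁)_{θ,∞}^0`, as a subspace of `E₀`. -/
def interpSubmodule (j : E₁ →L[ℝ] E₀) (θ : ℝ) : Submodule ℝ E₀ where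
  carrier := {x | InterpMem j θ x}
  add_mem' := fun hx hy => interpMem_add hx hy
  zero_mem' := by
    have h : ∀ t : ℝ, 0 < t → kWeighted j θ (0 : E₀) t = 0 := fun t ht => by
      simpa using kWeighted_smul j θ 0 (0 : E₀) ht
    refine ⟨⟨0, ?_⟩, ?_⟩
    · rintro _ ⟨t, rfl⟩
      exact (h t t.2).le
    · refine tendsto_const_nhds.congr' ?_
      filter_upwards [self_mem_nhdsWithin] with t ht using (h t ht).symm
  smul_mem' := fun c _ hx => interpMem_smul c hx

/-- The continuous interpolation space `E_θ = (E₀, E₁)_{θ,∞}^0`; it carries its own norm, not the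
norm of `E₀`. -/
def InterpSpace (j : E₁ →L[ℝ] E₀) (θ : ℝ) : Type _ := interpSubmodule j θ

instance (j : E₁ →L[ℝ] E₀) (θ : ℝ) : AddCommGroup (InterpSpace j θ) :=
  inferInstanceAs (AddCommGroup (interpSubmodule j θ))

instance (j : E₁ →L[ℝ] E₀) (θ : ℝ) : Module ℝ (InterpSpace j θ) :=
  inferInstanceAs (Module ℝ (interpSubmodule j θ))

/-- The inclusion of `E_θ` in `E₀`. -/
def InterpSpace.incl {j : E₁ →L[ℝ] E₀} {θ : ℝ} : InterpSpace j θ →ₗ[ℝ] E₀ :=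
  (interpSubmodule j θ).subtype

instance (j : E₁ →L[ℝ] E₀) (θ : ℝ) : Norm (InterpSpace j θ) :=
  ⟨fun x => interpNorm j θ (InterpSpace.incl x)⟩

theorem kWeighted_le_interpNorm {j : E₁ →L[ℝ] E₀} {θ : ℝ} {x : E₀} (hx : InterpMem j θ x)
    {t : ℝ} (ht : 0 < t) : kWeighted j θ x t ≤ interpNorm j θ x :=
  le_ciSup hx.1 (⟨t, ht⟩ : Ioi (0 : ℝ))

theorem interpSpace_core (j : E₁ →L[ℝ] E₀) (θ : ℝ) : NormedSpace.Core ℝ (InterpSpace j θ) where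
  norm_nonneg x := Real.iSup_nonneg fun t => kWeighted_nonneg j θ _ t.2
  norm_smul c x := by
    change interpNorm j θ (InterpSpace.incl (c • x)) = ‖c‖ * interpNorm j θ (InterpSpace.incl x)
    unfold interpNorm
    rw [Real.mul_iSup_of_nonneg (norm_nonneg c), map_smul]
    exact iSup_congr fun t => kWeighted_smul j θ c _ t.2
  norm_triangle x y := by
    change interpNorm j θ (InterpSpace.incl (x + y)) ≤ _
    have : Nonempty (Ioi (0 : ℝ)) := ⟨⟨1, mem_Ioi.mpr one_pos⟩⟩
    refine ciSup_le fun t => ?_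
    rw [map_add]
    exact (kWeighted_add_le j θ _ _ t.2).trans
      (add_le_add (kWeighted_le_interpNorm x.2 t.2) (kWeighted_le_interpNorm y.2 t.2))
  norm_eq_zero_iff x := by
    constructor
    · intro h
      have h1 : kWeighted j θ (InterpSpace.incl x) 1 ≤ 0 :=
        (kWeighted_le_interpNorm x.2 one_pos).trans h.le
      have h2 : kFunctional j 1 (InterpSpace.incl x) ≤ 0 := by simpa [kWeighted] using h1
      have h3 := norm_le_kFunctional_one j (InterpSpace.incl x)
      have h4 : ‖InterpSpace.incl x‖ ≤ 0 :=
        h3.trans (mul_nonpos_of_nonneg_of_nonpos (by positivity) h2)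
      exact Subtype.ext (norm_le_zero_iff.mp h4)
    · rintro rfl
      change interpNorm j θ (InterpSpace.incl 0) = 0
      unfold interpNorm
      have h : ∀ t : Ioi (0 : ℝ), kWeighted j θ (InterpSpace.incl (0 : InterpSpace j θ)) t = 0 :=
        fun t => by simpa using kWeighted_smul j θ 0 (0 : E₀) t.2
      simp only [h]
      exact Real.iSup_const_zero

instance (j : E₁ →L[ℝ] E₀) (θ : ℝ) : NormedAddCommGroup (InterpSpace j θ) :=
  NormedAddCommGroup.ofCore (interpSpace_core j θ)

instance (j : E₁ →L[ℝ] E₀) (θ : ℝ) : NormedSpace ℝ (InterpSpace j θ) :=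
  NormedSpace.ofCore (interpSpace_core j θ)

/-- The element of `E₁` represented by a vector of `E₀` that lies in `E₁` (unique, since the
embedding `j` is injective); the value at a vector outside `E₁` is irrelevant. -/
def toE₁ (j : E₁ →L[ℝ] E₀) : E₀ → E₁ := Function.invFun j

end Interpolation

section WeightedSpaces

/-- `v ∈ BC_{1-μ}([0,T], E)`: `v` is continuous on `(0,T]`, `t ^ (1-μ) v(t)` is bounded there, and
`|t ^ (1-μ) v(t)| → 0` as `t → 0+`. Only the values of `v` on `(0,T]` matter. -/
structure MemBC {E : Type*} [NormedAddCommGroup E] [NormedSpace ℝ E] (μ T : ℝ) (v : ℝ → E) :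
    Prop where
  continuousOn : ContinuousOn v (Ioc 0 T)
  bounded : ∃ C : ℝ, ∀ t ∈ Ioc 0 T, ‖t ^ (1 - μ) • v t‖ ≤ C
  tendsto_zero : Tendsto (fun t => ‖t ^ (1 - μ) • v t‖) (𝓝[>] 0) (𝓝 0)

/-- `v ∈ BC¹_{1-μ}([0,T], E)`: `v` is of class `C¹` on `(0,T]` (one-sided derivative at `T`), and
`v` and its derivative belong to `BC_{1-μ}([0,T], E)`. -/
structure MemBC1 {E : Type*} [NormedAddCommGroup E] [NormedSpace ℝ E] (μ T : ℝ) (v : ℝ → E) :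
    Prop where
  differentiableOn : DifferentiableOn ℝ v (Ioc 0 T)
  memBC : MemBC μ T v
  memBC_deriv : MemBC μ T (derivWithin v (Ioc 0 T))

variable {E₀ E₁ : Type*} [NormedAddCommGroup E₀] [NormedSpace ℝ E₀]
  [NormedAddCommGroup E₁] [NormedSpace ℝ E₁]

/-- `u ∈ 𝔼_{1,μ}([0,T]) = BC¹_{1-μ}([0,T], E₀) ∩ BC_{1-μ}([0,T], E₁)`, where `u 0` is the trace
`lim_{t → 0+} u(t)` in `E₀`. -/
structure MemMaxReg (j : E₁ →L[ℝ] E₀) (μ T : ℝ) (u : ℝ → E₀) : Prop where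
  mem_range : ∀ t ∈ Ioc 0 T, u t ∈ range j
  memBC1 : MemBC1 μ T u
  memBC : MemBC μ T (fun t => toE₁ j (u t))
  trace : Tendsto u (𝓝[>] 0) (𝓝 (u 0))

/-- `B ∈ 𝓜_μ(E₁, E₀)`: for some `T > 0` and `J = [0,T]`, the problem
`u' + B u = f` on `(0,T]`, `u(0) = x`, has for every `(f, x) ∈ 𝔼_{0,μ}(J) × E_μ` exactly one
solution `u ∈ 𝔼_{1,μ}(J)`. -/
def IsMaxRegOperator (j : E₁ →L[ℝ] E₀) (μ : ℝ) (B : E₁ →L[ℝ] E₀) : Prop :=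
  ∃ T : ℝ, 0 < T ∧ ∀ f : ℝ → E₀, MemBC μ T f → ∀ x : InterpSpace j μ,
    (∃ u : ℝ → E₀, MemMaxReg j μ T u ∧ u 0 = InterpSpace.incl x ∧
      ∀ t ∈ Ioc 0 T, derivWithin u (Ioc 0 T) t + B (toE₁ j (u t)) = f t) ∧
    ∀ u₁ u₂ : ℝ → E₀,
      (MemMaxReg j μ T u₁ ∧ u₁ 0 = InterpSpace.incl x ∧
        ∀ t ∈ Ioc 0 T, derivWithin u₁ (Ioc 0 T) t + B (toE₁ j (u₁ t)) = f t) →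
      (MemMaxReg j μ T u₂ ∧ u₂ 0 = InterpSpace.incl x ∧
        ∀ t ∈ Ioc 0 T, derivWithin u₂ (Ioc 0 T) t + B (toE₁ j (u₂ t)) = f t) →
      EqOn u₁ u₂ (Icc 0 T)

/-- `(A, F₁) ∈ C^{1-}(V, 𝓜_μ(E₁, E₀) × E₀)`, where `C^{1-}` means locally Lipschitz. -/
structure LipschitzHypothesis (j : E₁ →L[ℝ] E₀) (μ : ℝ) (V : Set (InterpSpace j μ))
    (A : InterpSpace j μ → E₁ →L[ℝ] E₀) (F₁ : InterpSpace j μ → E₀) : Prop where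
  maxReg : ∀ x ∈ V, IsMaxRegOperator j μ (A x)
  lipschitz : LocallyLipschitzOn V fun x => (A x, F₁ x)

/-- The structural condition on `F₂ : V ∩ E_β → E₀`; only the values of `F₂` on `V ∩ E_β`
matter. -/
def StructuralHypothesis (j : E₁ →L[ℝ] E₀) (μ : ℝ) (V : Set (InterpSpace j μ))
    (F₂ : InterpSpace j μ → E₀) : Prop :=
  ∃ β ∈ Ioo μ 1, ∃ (m : ℕ) (b ρ : Fin m → ℝ),
    (∀ i, b i ∈ Icc μ β ∧ 0 ≤ ρ i ∧ (ρ i * (β - μ) + (b i - μ)) / (1 - μ) ≤ 1) ∧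
    ∀ x₀ ∈ V, ∀ R > 0, ∃ C > 0, ∀ x₁ x₂ : InterpSpace j μ,
      x₁ ∈ Metric.closedBall x₀ R → x₁ ∈ V → InterpSpace.incl x₁ ∈ interpSubmodule j β →
      x₂ ∈ Metric.closedBall x₀ R → x₂ ∈ V → InterpSpace.incl x₂ ∈ interpSubmodule j β →
      ‖F₂ x₁ - F₂ x₂‖ ≤ C * ∑ i,
        (1 + interpNorm j β (InterpSpace.incl x₁) ^ ρ i
          + interpNorm j β (InterpSpace.incl x₂) ^ ρ i) *
        interpNorm j (b i) (InterpSpace.incl x₁ - InterpSpace.incl x₂)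

/-- `u` is a solution of `u' + A(u) u = F₁(u) + F₂(u)`, `u(0) = x`, of class `𝔼_{1,μ}([0,T])` and
with values in `V`. -/
structure IsSolutionOn (j : E₁ →L[ℝ] E₀) (μ : ℝ) (V : Set (InterpSpace j μ))
    (A : InterpSpace j μ → E₁ →L[ℝ] E₀) (F₁ F₂ : InterpSpace j μ → E₀)
    (T : ℝ) (x : InterpSpace j μ) (u : ℝ → InterpSpace j μ) : Prop where
  init : u 0 = x
  mem : ∀ t ∈ Icc 0 T, u t ∈ V
  memMaxReg : MemMaxReg j μ T (fun t => InterpSpace.incl (u t))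
  eqn : ∀ t ∈ Ioc 0 T,
    derivWithin (fun s => InterpSpace.incl (u s)) (Ioc 0 T) t
      + A (u t) (toE₁ j (InterpSpace.incl (u t))) = F₁ (u t) + F₂ (u t)

/-- `[0, tp x)` is the maximal interval of existence of the solution with initial value `x ∈ V`,
and `u · x` is that maximal solution: it solves the problem on each `[0,T]` with `T < tp x`, and
each solution on an interval `[0,T]` has `T < tp x` and coincides with `u · x` on `[0,T]`. These
properties determine `tp` on `V` and `u` on the set of all `(t, x)` with `0 ≤ t < tp x`. -/
def IsMaximalSolutionMap (j : E₁ →L[ℝ] E₀) (μ : ℝ) (V : Set (InterpSpace j μ))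
    (A : InterpSpace j μ → E₁ →L[ℝ] E₀) (F₁ F₂ : InterpSpace j μ → E₀)
    (tp : InterpSpace j μ → EReal) (u : ℝ → InterpSpace j μ → InterpSpace j μ) : Prop :=
  ∀ x ∈ V, 0 < tp x ∧
    (∀ T : ℝ, 0 < T → (T : EReal) < tp x →
      IsSolutionOn j μ V A F₁ F₂ T x (fun t => u t x)) ∧
    ∀ T : ℝ, 0 < T → ∀ w : ℝ → InterpSpace j μ, IsSolutionOn j μ V A F₁ F₂ T x w →
      (T : EReal) < tp x ∧ EqOn w (fun t => u t x) (Icc 0 T)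

end WeightedSpaces

section Semiflows

variable {X : Type*} [NormedAddCommGroup X]

/-- The domain `𝓓 = ⋃_{x ∈ V} [0, tp x) × {x}` of a semiflow on `V`. -/
def flowDomain (V : Set X) (tp : X → EReal) : Set (ℝ × X) :=
  {p | p.2 ∈ V ∧ 0 ≤ p.1 ∧ (p.1 : EReal) < tp p.2}

/-- `φ` is a (local) semiflow on `V` with lifespans `tp`, and it is locally Lipschitz continuous:
`𝓓` is open in `ℝ₊ × V`, `φ` is continuous on `𝓓` with values in `V`, it satisfies the semiflow
identities, and each point of `𝓓` has a product neighbourhood in `ℝ₊ × V`, contained in `𝓓`, on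
which `φ(t, ·)` is Lipschitz with a constant that does not depend on `t`. -/
structure IsLocallyLipschitzSemiflow (V : Set X) (tp : X → EReal) (φ : ℝ → X → X) : Prop where
  lifespan_pos : ∀ x ∈ V, 0 < tp x
  isOpen_domain : ∃ O : Set (ℝ × X), IsOpen O ∧ flowDomain V tp = O ∩ Ici 0 ×ˢ V
  mapsTo : ∀ (t : ℝ) (x : X), (t, x) ∈ flowDomain V tp → φ t x ∈ V
  continuousOn : ContinuousOn (fun p : ℝ × X => φ p.1 p.2) (flowDomain V tp)
  map_zero : ∀ x ∈ V, φ 0 x = x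
  lifespan_shift : ∀ (s t : ℝ) (x : X), (s, x) ∈ flowDomain V tp → 0 ≤ t →
    ((t : EReal) < tp (φ s x) ↔ ((s + t : ℝ) : EReal) < tp x)
  map_add : ∀ (s t : ℝ) (x : X), (s, x) ∈ flowDomain V tp → (t, φ s x) ∈ flowDomain V tp →
    φ (s + t) x = φ t (φ s x)
  lipschitz : ∀ (t₀ : ℝ) (x₀ : X), (t₀, x₀) ∈ flowDomain V tp →
    ∃ U ∈ 𝓝[Ici 0] t₀, ∃ W ∈ 𝓝[V] x₀, U ×ˢ W ⊆ flowDomain V tp ∧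
      ∃ c > 0, ∀ t ∈ U, ∀ x ∈ W, ∀ y ∈ W, ‖φ t x - φ t y‖ ≤ c * ‖x - y‖

end Semiflows

end QuasilinearSemiflow

end

open QuasilinearSemiflow

open scoped Interval

noncomputable section

namespace QuasilinearSemiflow

/-! ### K-functional estimates and completeness of the interpolation spaces. -/

section InterpolationFacts

variable {E₀ E₁ : Type*} [NormedAddCommGroup E₀] [NormedSpace ℝ E₀]
  [NormedAddCommGroup E₁] [NormedSpace ℝ E₁] {j : E₁ →L[ℝ] E₀} {θ μ : ℝ}

/-! Near x₀ the equation is a perturbation of the linear problem with the frozen operator A(x₀): it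
reads v' + A(x₀)v = G(v), where G(a) = A(x₀)a + F₁(a) + F₂(a) − A(a)a. Two estimates make this a
contraction.

First, maximal regularity together with the open mapping theorem bounds the linear solution by its
data with a constant M that does not grow on shorter intervals (`IsMaxRegOperator.exists_estimate`).
The bound covers the weighted norms of v in E₁ and of v' in E₀. A trace argument with the
K-functional adds the norm of v(t) in E_μ (`norm_emb_sub_le`), and the vanishing of the weighted
functions at 0 gives convergence to the initial value in E_μ (`tendsto_emb`).

Second, G has an arbitrarily small weighted Lipschitz constant on the set of a with a close to x₀ in
E_μ, t^(1-μ)|a|_{E₁} ≤ r and t ≤ r (`eventually_vectorField_sub_le`). The quasilinear part is small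
since A is Lipschitz on E_μ and the weighted E₁-norm is at most r. For F₂, interpolation shows that
t^(β-μ)|a|_{E_β} is small on this set (`eventually_rpow_mul_interpNorm_le`). The condition on ρ_j
and β_j says that the negative powers of t produced by the growth of F₂ are compensated by the
weight t^(1-μ). In the critical case of equality no positive power of t remains in the growth terms;
their smallness then comes entirely from r, that is, from the vanishing of t^(1-μ)v(t) at 0.

Banach's fixed point theorem then gives solutions on a common interval for all initial values near
x₀, Lipschitz in the initial value (`exists_local_solution`), and the same two estimates give local
uniqueness (`IsMildSolution.exists_eqOn`).

The global part works with E₁-valued representatives in integrated form (`IsMildSolution`), which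
can be shifted, restricted and glued. Uniqueness propagates by continuous induction. Every solution
extends past its endpoint, so the supremum of existence times is never attained
(`IsAdmissible.lt_lifespan_iff`). Local Lipschitz dependence is carried along compact time intervals
by a supremum argument (`IsAdmissible.exists_nhds_lipschitz`), from which openness of the domain,
joint continuity and the Lipschitz property follow. -/

theorem kFunctional_apply_le (j : E₁ →L[ℝ] E₀) {t : ℝ} (ht : 0 ≤ t) (b : E₁) :
    kFunctional j t (j b) ≤ t * ‖b‖ := by
  simpa using kFunctional_le j ht (j b) b

theorem kFunctional_le_norm (j : E₁ →L[ℝ] E₀) {t : ℝ} (ht : 0 ≤ t) (x : E₀) :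
    kFunctional j t x ≤ ‖x‖ := by
  simpa using kFunctional_le j ht x 0

theorem InterpSpace.norm_def (x : InterpSpace j θ) :
    ‖x‖ = interpNorm j θ (InterpSpace.incl x) := rfl

theorem InterpSpace.incl_injective :
    Function.Injective (InterpSpace.incl : InterpSpace j θ →ₗ[ℝ] E₀) :=
  Subtype.val_injective

theorem kFunctional_le_rpow_mul_norm (x : InterpSpace j θ) {t : ℝ} (ht : 0 < t) :
    kFunctional j t (InterpSpace.incl x) ≤ t ^ θ * ‖x‖ := by
  have h := kWeighted_le_interpNorm x.2 ht
  have h2 : kFunctional j t (InterpSpace.incl x)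
      = t ^ θ * kWeighted j θ (InterpSpace.incl x) t := by
    rw [kWeighted, ← mul_assoc, ← Real.rpow_add ht]; simp
  rw [h2]
  exact mul_le_mul_of_nonneg_left h (Real.rpow_nonneg ht.le _)

theorem interpNorm_le {x : E₀} {C : ℝ}
    (h : ∀ s, 0 < s → kFunctional j s x ≤ s ^ θ * C) : interpNorm j θ x ≤ C := by
  have : Nonempty (Ioi (0 : ℝ)) := ⟨⟨1, mem_Ioi.mpr one_pos⟩⟩
  refine ciSup_le fun ⟨s, hs⟩ => ?_
  have hs' : 0 < s := hs
  calc s ^ (-θ) * kFunctional j s x ≤ s ^ (-θ) * (s ^ θ * C) :=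
        mul_le_mul_of_nonneg_left (h s hs) (Real.rpow_nonneg hs'.le _)
    _ = C := by rw [← mul_assoc, ← Real.rpow_add hs']; simp

theorem InterpSpace.norm_incl_le (x : InterpSpace j θ) :
    ‖InterpSpace.incl x‖ ≤ (1 + ‖j‖) * ‖x‖ := by
  have h := kFunctional_le_rpow_mul_norm x one_pos
  rw [Real.one_rpow, one_mul] at h
  exact (norm_le_kFunctional_one j _).trans (mul_le_mul_of_nonneg_left h (by positivity))

/-- The inclusion of `E_θ` in `E₀` as a continuous linear map. -/
def InterpSpace.inclL (j : E₁ →L[ℝ] E₀) (θ : ℝ) : InterpSpace j θ →L[ℝ] E₀ :=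
  LinearMap.mkContinuous InterpSpace.incl (1 + ‖j‖) InterpSpace.norm_incl_le

theorem kFunctional_apply_le_rpow (hθ : θ ∈ Ioo (0 : ℝ) 1) {s : ℝ} (hs : 0 < s) (b : E₁) :
    kFunctional j s (j b) ≤ s ^ θ * ((1 + ‖j‖) * ‖b‖) := by
  rcases le_total s 1 with h1 | h1
  · have h2 : s ≤ s ^ θ := by
      simpa using Real.rpow_le_rpow_of_exponent_ge hs h1 hθ.2.le
    calc kFunctional j s (j b) ≤ s * ‖b‖ := kFunctional_apply_le j hs.le b
      _ ≤ s ^ θ * ((1 + ‖j‖) * ‖b‖) := by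
        refine mul_le_mul h2 ?_ (norm_nonneg _) (by positivity)
        nlinarith [norm_nonneg j, norm_nonneg b, mul_nonneg (norm_nonneg j) (norm_nonneg b)]
  · have h2 : 1 ≤ s ^ θ := Real.one_le_rpow h1 hθ.1.le
    calc kFunctional j s (j b) ≤ ‖j b‖ := kFunctional_le_norm j hs.le _
      _ ≤ ‖j‖ * ‖b‖ := j.le_opNorm b
      _ ≤ 1 * ((1 + ‖j‖) * ‖b‖) := by
        nlinarith [norm_nonneg j, norm_nonneg b, mul_nonneg (norm_nonneg j) (norm_nonneg b)]
      _ ≤ s ^ θ * ((1 + ‖j‖) * ‖b‖) := by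
        refine mul_le_mul_of_nonneg_right h2 (by positivity)

theorem interpMem_apply (hθ : θ ∈ Ioo (0 : ℝ) 1) (b : E₁) : InterpMem j θ (j b) := by
  constructor
  · refine ⟨(1 + ‖j‖) * ‖b‖, ?_⟩
    rintro _ ⟨⟨s, hs⟩, rfl⟩
    have hs' : 0 < s := hs
    calc s ^ (-θ) * kFunctional j s (j b) ≤ s ^ (-θ) * (s ^ θ * ((1 + ‖j‖) * ‖b‖)) :=
          mul_le_mul_of_nonneg_left (kFunctional_apply_le_rpow hθ hs' b)
            (Real.rpow_nonneg hs'.le _)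
      _ = _ := by rw [← mul_assoc, ← Real.rpow_add hs']; simp
  · have h : Tendsto (fun s : ℝ => s ^ (1 - θ) * ‖b‖) (𝓝[>] 0) (𝓝 0) := by
      have h1 : Tendsto (fun s : ℝ => s ^ (1 - θ)) (𝓝[>] 0) (𝓝 0) := by
        have := (Real.continuousAt_rpow_const 0 (1 - θ) (Or.inr (by linarith [hθ.2]))).tendsto
        rw [Real.zero_rpow (by linarith [hθ.2])] at this
        exact this.mono_left nhdsWithin_le_nhds
      simpa using h1.mul_const ‖b‖
    refine squeeze_zero' ?_ ?_ h
    · filter_upwards [self_mem_nhdsWithin] with t ht using kWeighted_nonneg j θ _ ht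
    · filter_upwards [self_mem_nhdsWithin] with s hs
      have hs' : (0 : ℝ) < s := hs
      calc s ^ (-θ) * kFunctional j s (j b) ≤ s ^ (-θ) * (s * ‖b‖) :=
            mul_le_mul_of_nonneg_left (kFunctional_apply_le j hs'.le b) (Real.rpow_nonneg hs'.le _)
        _ = s ^ (1 - θ) * ‖b‖ := by
          rw [sub_eq_add_neg, Real.rpow_add hs', Real.rpow_one]; ring

/-- The embedding of `E₁` in `E_θ`. -/
def emb (j : E₁ →L[ℝ] E₀) (hθ : θ ∈ Ioo (0 : ℝ) 1) : E₁ →L[ℝ] InterpSpace j θ :=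
  LinearMap.mkContinuous
    { toFun := fun b => (⟨j b, interpMem_apply hθ b⟩ : interpSubmodule j θ)
      map_add' := fun a b => Subtype.ext (map_add j a b)
      map_smul' := fun c b => Subtype.ext (map_smul j c b) } (1 + ‖j‖)
    fun b => interpNorm_le fun _ hs => kFunctional_apply_le_rpow hθ hs b

@[simp] theorem incl_emb (hθ : θ ∈ Ioo (0 : ℝ) 1) (b : E₁) :
    InterpSpace.incl (emb j hθ b) = j b := rfl

/-- The K-functional at s is controlled by the E₁-norm for s ≤ t and by the E_μ-norm for s ≥ t.
Keeping the splitting point t free gives a form of the interpolation inequality adapted to the time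
weight. -/
theorem interpNorm_apply_le (hμ : μ ∈ Ioo (0 : ℝ) 1) (hθ : θ ∈ Ico μ 1) (a : E₁) {t : ℝ}
    (ht : 0 < t) :
    interpNorm j θ (j a) ≤ t ^ (μ - θ) * (t ^ (1 - μ) * ‖a‖ + ‖emb j hμ a‖) := by
  refine interpNorm_le fun s hs => ?_
  rcases le_total s t with hst | hst
  · have h1 : s ^ (1 - θ) ≤ t ^ (1 - θ) :=
      Real.rpow_le_rpow hs.le hst (by linarith [hθ.2])
    calc kFunctional j s (j a) ≤ s * ‖a‖ := kFunctional_apply_le j hs.le a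
      _ = s ^ θ * (s ^ (1 - θ) * ‖a‖) := by
        rw [← mul_assoc, ← Real.rpow_add hs]; simp
      _ ≤ s ^ θ * (t ^ (1 - θ) * ‖a‖) := by gcongr
      _ = s ^ θ * (t ^ (μ - θ) * (t ^ (1 - μ) * ‖a‖)) := by
        rw [← mul_assoc (t ^ (μ - θ)), ← Real.rpow_add ht]; ring_nf
      _ ≤ s ^ θ * (t ^ (μ - θ) * (t ^ (1 - μ) * ‖a‖ + ‖emb j hμ a‖)) := by
        gcongr; simp
  · have h1 : s ^ (μ - θ) ≤ t ^ (μ - θ) :=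
      Real.rpow_le_rpow_of_nonpos ht hst (by linarith [hθ.1])
    calc kFunctional j s (j a) ≤ s ^ μ * ‖emb j hμ a‖ :=
          kFunctional_le_rpow_mul_norm (emb j hμ a) hs
      _ = s ^ θ * (s ^ (μ - θ) * ‖emb j hμ a‖) := by
        rw [← mul_assoc, ← Real.rpow_add hs]; ring_nf
      _ ≤ s ^ θ * (t ^ (μ - θ) * ‖emb j hμ a‖) := by gcongr
      _ ≤ s ^ θ * (t ^ (μ - θ) * (t ^ (1 - μ) * ‖a‖ + ‖emb j hμ a‖)) := by
        gcongr; simp; positivity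

/-- The E_μ-norm is merely bounded, so the splitting point is taken at Λt: a large Λ makes the
E_μ-contribution small through the negative power of Λ, and then r is chosen small enough to absorb
Λ^(1-μ) in front of the E₁-norm. -/
theorem eventually_rpow_mul_interpNorm_le (hμ : μ ∈ Ioo (0 : ℝ) 1) {β : ℝ} (hβ : β ∈ Ioo μ 1)
    (R : ℝ) {κ : ℝ} (hκ : 0 < κ) :
    ∀ᶠ r in 𝓝[>] (0 : ℝ), ∀ t, 0 < t → ∀ a : E₁, ‖emb j hμ a‖ ≤ R → t ^ (1 - μ) * ‖a‖ ≤ r →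
      t ^ (β - μ) * interpNorm j β (j a) ≤ κ := by
  have hpos : 0 < β - μ := by linarith [hβ.1]
  have hlim : Tendsto (fun Λ : ℝ => Λ ^ (-(β - μ)) * (1 + R)) atTop (𝓝 (0 * (1 + R))) :=
    (tendsto_rpow_neg_atTop hpos).mul_const _
  rw [zero_mul] at hlim
  obtain ⟨Λ, hΛ, hΛ0⟩ := ((hlim.eventually (gt_mem_nhds hκ)).and (eventually_gt_atTop 0)).exists
  have hr : ∀ᶠ r in 𝓝[>] (0 : ℝ), Λ ^ (1 - μ) * r ≤ 1 := by
    have : Tendsto (fun r : ℝ => Λ ^ (1 - μ) * r) (𝓝[>] 0) (𝓝 (Λ ^ (1 - μ) * 0)) :=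
      ((continuous_const.mul continuous_id).tendsto 0).mono_left nhdsWithin_le_nhds
    rw [mul_zero] at this
    exact this.eventually (Iic_mem_nhds one_pos)
  filter_upwards [hr] with r hr t ht a haR har
  have h := interpNorm_apply_le (j := j) hμ ⟨hβ.1.le, hβ.2⟩ a (mul_pos hΛ0 ht)
  rw [Real.mul_rpow hΛ0.le ht.le, Real.mul_rpow hΛ0.le ht.le] at h
  have e : t ^ (β - μ) * (Λ ^ (μ - β) * t ^ (μ - β)) = Λ ^ (-(β - μ)) := by
    rw [mul_left_comm, ← Real.rpow_add ht]; simp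
  calc t ^ (β - μ) * interpNorm j β (j a)
      ≤ t ^ (β - μ) * (Λ ^ (μ - β) * t ^ (μ - β)
          * (Λ ^ (1 - μ) * t ^ (1 - μ) * ‖a‖ + ‖emb j hμ a‖)) := by gcongr
    _ = Λ ^ (-(β - μ)) * (Λ ^ (1 - μ) * (t ^ (1 - μ) * ‖a‖) + ‖emb j hμ a‖) := by
      rw [← mul_assoc, e]; ring
    _ ≤ Λ ^ (-(β - μ)) * (1 + R) := by
      gcongr
      exact (mul_le_mul_of_nonneg_left har (by positivity)).trans hr
    _ ≤ κ := hΛ.le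

theorem kFunctional_tendsto {ι : Type*} {l : Filter ι} {t : ℝ} (ht : 0 ≤ t) {x : ι → E₀} {y : E₀}
    (h : Tendsto x l (𝓝 y)) :
    Tendsto (fun n => kFunctional j t (x n)) l (𝓝 (kFunctional j t y)) := by
  rw [tendsto_iff_norm_sub_tendsto_zero] at h ⊢
  refine squeeze_zero (fun _ => norm_nonneg _) (fun n => ?_) h
  have h1 := kFunctional_add_le j ht (x n - y) y
  have h2 := kFunctional_add_le j ht (y - x n) (x n)
  have h3 := kFunctional_le_norm j ht (x n - y)
  have h4 := kFunctional_le_norm j ht (y - x n)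
  rw [sub_add_cancel] at h1 h2
  rw [norm_sub_rev] at h4
  rw [Real.norm_eq_abs, abs_le]
  constructor <;> linarith

/-- For fixed s the K-functional is continuous on E₀, so Cauchy bounds uniform in s pass to the
E₀-limit; the vanishing of the weighted K-functional at 0 survives uniform limits. Completeness of
E_μ is needed for the open mapping theorem. -/
instance [CompleteSpace E₀] : CompleteSpace (InterpSpace j θ) := by
  refine Metric.complete_of_cauchySeq_tendsto fun x hx => ?_
  have hx' : CauchySeq fun n => InterpSpace.incl (x n) :=
    (InterpSpace.inclL j θ).uniformContinuous.comp_cauchySeq hx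
  obtain ⟨y, hy⟩ := cauchySeq_tendsto_of_complete hx'
  have key : ∀ ε > 0, ∃ N, ∀ n ≥ N, ∀ s, 0 < s →
      kFunctional j s (InterpSpace.incl (x n) - y) ≤ s ^ θ * ε := by
    intro ε hε
    obtain ⟨N, hN⟩ := Metric.cauchySeq_iff.mp hx ε hε
    refine ⟨N, fun n hn s hs => ?_⟩
    refine le_of_tendsto (kFunctional_tendsto hs.le (tendsto_const_nhds.sub hy)) ?_
    filter_upwards [eventually_ge_atTop N] with m hm
    rw [← map_sub]
    refine (kFunctional_le_rpow_mul_norm _ hs).trans ?_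
    gcongr
    rw [← dist_eq_norm]
    exact (hN n hn m hm).le
  have kw : ∀ {z : E₀} {s ε : ℝ}, 0 < s → kFunctional j s z ≤ s ^ θ * ε →
      kWeighted j θ z s ≤ ε := by
    intro z s ε hs h
    calc s ^ (-θ) * kFunctional j s z ≤ s ^ (-θ) * (s ^ θ * ε) :=
          mul_le_mul_of_nonneg_left h (Real.rpow_nonneg hs.le _)
      _ = ε := by rw [← mul_assoc, ← Real.rpow_add hs]; simp
  have hle : ∀ n s ε, 0 < s → kFunctional j s (InterpSpace.incl (x n) - y) ≤ s ^ θ * ε →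
      kWeighted j θ y s ≤ kWeighted j θ (InterpSpace.incl (x n)) s + ε := by
    intro n s ε hs h
    have h1 := kWeighted_add_le j θ (InterpSpace.incl (x n))
      (-1 • (InterpSpace.incl (x n) - y)) hs
    rw [show InterpSpace.incl (x n) + (-1 : ℤ) • (InterpSpace.incl (x n) - y) = y by simp] at h1
    have h2 := kWeighted_smul j θ (-1) (InterpSpace.incl (x n) - y) hs
    simp only [neg_smul, one_smul, abs_neg, abs_one, one_mul] at h1 h2
    rw [h2] at h1
    linarith [kw hs h]
  have hmem : InterpMem j θ y := by
    constructor
    · obtain ⟨N, hN⟩ := key 1 one_pos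
      refine ⟨‖x N‖ + 1, ?_⟩
      rintro _ ⟨⟨s, hs⟩, rfl⟩
      exact (hle N s 1 hs (hN N le_rfl s hs)).trans
        (add_le_add_left (kWeighted_le_interpNorm (x N).2 hs) 1)
    · rw [Metric.tendsto_nhds]
      intro ε hε
      obtain ⟨N, hN⟩ := key (ε / 2) (half_pos hε)
      have h1 : ∀ᶠ s in 𝓝[>] (0 : ℝ), kWeighted j θ (InterpSpace.incl (x N)) s < ε / 2 :=
        (x N).2.2.eventually (gt_mem_nhds (half_pos hε))
      filter_upwards [h1, self_mem_nhdsWithin] with s h1 hs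
      rw [Real.dist_eq, sub_zero, abs_of_nonneg (kWeighted_nonneg j θ _ hs)]
      linarith [hle N s (ε / 2) hs (hN N le_rfl s hs)]
  obtain ⟨z, rfl⟩ : ∃ z : InterpSpace j θ, InterpSpace.incl z = y :=
    ⟨(⟨y, hmem⟩ : interpSubmodule j θ), rfl⟩
  refine ⟨z, Metric.tendsto_atTop.mpr fun ε hε => ?_⟩
  obtain ⟨N, hN⟩ := key (ε / 2) (half_pos hε)
  refine ⟨N, fun n hn => ?_⟩
  rw [dist_eq_norm, InterpSpace.norm_def, map_sub]
  exact (interpNorm_le (hN n hn)).trans_lt (half_lt_self hε)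

theorem toE₁_apply (hj : Function.Injective j) (b : E₁) : toE₁ j (j b) = b :=
  Function.leftInverse_invFun hj b

theorem apply_toE₁ {x : E₀} (hx : x ∈ range j) : j (toE₁ j x) = x :=
  Function.invFun_eq hx

end InterpolationFacts

/-! ### Time-weighted function spaces and their primitives. -/

section WeightedFacts

open MeasureTheory

variable {E F : Type*} [NormedAddCommGroup E] [NormedSpace ℝ E]
  [NormedAddCommGroup F] [NormedSpace ℝ F] {μ T : ℝ}

theorem rpow_weight_mul_inv {t : ℝ} (ht : 0 < t) : t ^ (1 - μ) * t ^ (μ - 1) = 1 := by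
  rw [← Real.rpow_add ht]; simp

theorem continuous_weight (hμ : μ < 1) : Continuous fun t : ℝ => t ^ (1 - μ) :=
  continuous_id.rpow_const fun _ => Or.inr (by linarith)

theorem tendsto_weight (hμ : μ < 1) : Tendsto (fun t : ℝ => t ^ (1 - μ)) (𝓝[>] 0) (𝓝 0) := by
  have h := (continuous_weight hμ).tendsto 0
  rw [Real.zero_rpow (by linarith)] at h
  exact h.mono_left nhdsWithin_le_nhds

theorem norm_weight_smul {t : ℝ} (ht : 0 ≤ t) (x : E) :
    ‖t ^ (1 - μ) • x‖ = t ^ (1 - μ) * ‖x‖ := by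
  rw [norm_smul, Real.norm_of_nonneg (Real.rpow_nonneg ht _)]

theorem continuousOn_weight_smul (hμ : μ < 1) {f : ℝ → E} (hf : ContinuousOn f (Ioc 0 T))
    (hf0 : Tendsto (fun t => t ^ (1 - μ) • f t) (𝓝[>] 0) (𝓝 0)) :
    ContinuousOn (fun t => t ^ (1 - μ) • f t) (Icc 0 T) := by
  have h0 : ((0 : ℝ) ^ (1 - μ)) = 0 := Real.zero_rpow (by linarith)
  intro t ht
  rcases ht.1.eq_or_lt with rfl | ht0
  · have h2 : ContinuousWithinAt (fun t => t ^ (1 - μ) • f t) (Ioi 0) 0 := by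
      simpa [ContinuousWithinAt, h0] using hf0
    exact h2.insert.mono fun s hs => by
      rcases hs.1.eq_or_lt with h | h
      · exact Or.inl h.symm
      · exact Or.inr h
  · have h1 : ContinuousWithinAt (fun t => t ^ (1 - μ) • f t) (Ioc 0 T) t :=
      (continuous_weight hμ).continuousWithinAt.smul (hf t ⟨ht0, ht.2⟩)
    refine h1.mono_of_mem_nhdsWithin ?_
    filter_upwards [self_mem_nhdsWithin, mem_nhdsWithin_of_mem_nhds (Ioi_mem_nhds ht0)]
      with s hs hs' using ⟨hs', hs.2⟩

/-- `f ∈ BC_{1-μ}([0,T], E)` if and only if `t ^ (1-μ) f(t)`, extended by zero, is continuous on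
`[0,T]`. -/
theorem memBC_iff (hμ : μ < 1) (hT : 0 < T) {f : ℝ → E} :
    MemBC μ T f ↔ ContinuousOn (fun t => t ^ (1 - μ) • f t) (Icc 0 T) := by
  have h0 : ((0 : ℝ) ^ (1 - μ)) = 0 := Real.zero_rpow (by linarith)
  constructor
  · intro h
    exact continuousOn_weight_smul hμ h.continuousOn
      (tendsto_zero_iff_norm_tendsto_zero.mpr h.tendsto_zero)
  · intro h
    have hne : ∀ t ∈ Ioc 0 T, t ^ (μ - 1) • t ^ (1 - μ) • f t = f t := fun t ht => by
      rw [smul_smul, mul_comm, rpow_weight_mul_inv ht.1, one_smul]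
    refine ⟨?_, ?_, ?_⟩
    · have h1 : ContinuousOn (fun t : ℝ => t ^ (μ - 1) • t ^ (1 - μ) • f t) (Ioc 0 T) :=
        (continuousOn_id.rpow_const fun t ht => Or.inl ht.1.ne').smul (h.mono Ioc_subset_Icc_self)
      exact h1.congr fun t ht => (hne t ht).symm
    · obtain ⟨C, hC⟩ := isCompact_Icc.exists_bound_of_continuousOn h
      exact ⟨C, fun t ht => hC t (Ioc_subset_Icc_self ht)⟩
    · have h1 : Tendsto (fun t => t ^ (1 - μ) • f t) (𝓝[Icc 0 T] 0) (𝓝 0) := by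
        have := h 0 (left_mem_Icc.mpr hT.le)
        simpa [ContinuousWithinAt, h0] using this
      refine tendsto_zero_iff_norm_tendsto_zero.mp (h1.mono_left ?_)
      rw [← nhdsWithin_Ioc_eq_nhdsGT hT]
      exact nhdsWithin_mono _ Ioc_subset_Icc_self

theorem MemBC.add {f g : ℝ → E} (hμ : μ < 1) (hT : 0 < T) (hf : MemBC μ T f) (hg : MemBC μ T g) :
    MemBC μ T fun t => f t + g t := by
  rw [memBC_iff hμ hT] at *
  simpa only [smul_add] using hf.fun_add hg

theorem MemBC.sub {f g : ℝ → E} (hμ : μ < 1) (hT : 0 < T) (hf : MemBC μ T f) (hg : MemBC μ T g) :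
    MemBC μ T fun t => f t - g t := by
  rw [memBC_iff hμ hT] at *
  simpa only [smul_sub] using hf.fun_sub hg

theorem MemBC.clm {f : ℝ → E} (hμ : μ < 1) (hT : 0 < T) (B : E →L[ℝ] F) (hf : MemBC μ T f) :
    MemBC μ T fun t => B (f t) := by
  rw [memBC_iff hμ hT] at *
  exact (B.continuous.comp_continuousOn hf).congr fun t _ => (map_smul B _ _).symm

theorem MemBC.mono {f : ℝ → E} {S : ℝ} (hST : S ≤ T) (hf : MemBC μ T f) : MemBC μ S f :=
  ⟨hf.continuousOn.mono (Ioc_subset_Ioc_right hST),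
    hf.bounded.imp fun _ h t ht => h t (Ioc_subset_Ioc_right hST ht), hf.tendsto_zero⟩

theorem MemBC.congr {f g : ℝ → E} (hμ : μ < 1) (hT : 0 < T) (hf : MemBC μ T f)
    (h : EqOn g f (Ioc 0 T)) : MemBC μ T g := by
  rw [memBC_iff hμ hT] at *
  refine hf.congr fun t ht => ?_
  rcases ht.1.eq_or_lt with rfl | h0
  · simp [Real.zero_rpow (show 1 - μ ≠ 0 by linarith)]
  · simp only [h ⟨h0, ht.2⟩]

theorem memBC_of_continuousOn {f : ℝ → E} (hμ : μ < 1) (hT : 0 < T)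
    (hf : ContinuousOn f (Icc 0 T)) : MemBC μ T f :=
  (memBC_iff hμ hT).mpr ((continuous_weight hμ).continuousOn.smul hf)

theorem MemBC.exists_bound {f : ℝ → E} (hf : MemBC μ T f) :
    ∃ C, 0 ≤ C ∧ ∀ t ∈ Ioc 0 T, t ^ (1 - μ) * ‖f t‖ ≤ C := by
  obtain ⟨C, hC⟩ := hf.bounded
  refine ⟨max C 0, le_max_right _ _, fun t ht => ?_⟩
  rw [← norm_weight_smul ht.1.le]
  exact (hC t ht).trans (le_max_left _ _)

theorem norm_le_of_weighted {E : Type*} [NormedAddCommGroup E] {t C : ℝ} (ht : 0 < t)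
    {x : E} (h : t ^ (1 - μ) * ‖x‖ ≤ C) : ‖x‖ ≤ C * t ^ (μ - 1) := by
  calc ‖x‖ = (t ^ (1 - μ) * ‖x‖) * t ^ (μ - 1) := by
        rw [mul_right_comm, rpow_weight_mul_inv ht, one_mul]
    _ ≤ C * t ^ (μ - 1) := by gcongr

theorem MemBC.intervalIntegrable {f : ℝ → E} (hμ : 0 < μ) (hf : MemBC μ T f) {a b : ℝ}
    (ha : a ∈ Icc 0 T) (hb : b ∈ Icc 0 T) : IntervalIntegrable f volume a b := by
  obtain ⟨C, -, hC⟩ := hf.exists_bound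
  have hsub : Ι a b ⊆ Ioc 0 T := by
    rw [uIoc]
    exact Ioc_subset_Ioc (le_min ha.1 hb.1) (max_le ha.2 hb.2)
  have h1 : IntervalIntegrable (fun t : ℝ => C * t ^ (μ - 1)) volume a b :=
    (intervalIntegral.intervalIntegrable_rpow' (by linarith)).const_mul C
  refine h1.mono_fun' ((hf.continuousOn.mono hsub).aestronglyMeasurable measurableSet_uIoc) ?_
  filter_upwards [ae_restrict_mem measurableSet_uIoc] with t ht
  exact norm_le_of_weighted (hsub ht).1 (hC t (hsub ht))

theorem norm_integral_le_of_weighted {f : ℝ → E} (hμ : 0 < μ) {t C : ℝ} (ht : 0 ≤ t)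
    (hC : ∀ s ∈ Ioc 0 t, s ^ (1 - μ) * ‖f s‖ ≤ C) : ‖∫ s in (0 : ℝ)..t, f s‖ ≤ t ^ μ * (C / μ) := by
  have h1 : IntervalIntegrable (fun t : ℝ => C * t ^ (μ - 1)) volume 0 t :=
    (intervalIntegral.intervalIntegrable_rpow' (by linarith)).const_mul C
  refine (intervalIntegral.norm_integral_le_of_norm_le ht
    (Eventually.of_forall fun s hs => norm_le_of_weighted hs.1 (hC s hs)) h1).trans (le_of_eq ?_)
  rw [intervalIntegral.integral_const_mul, integral_rpow (Or.inl (by linarith))]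
  rw [sub_add_cancel, Real.zero_rpow hμ.ne', sub_zero]
  ring

theorem integral_congr_Ioc {f g : ℝ → E} {a b : ℝ} (hab : a ≤ b) (h : EqOn f g (Ioc a b)) :
    ∫ s in a..b, f s = ∫ s in a..b, g s := by
  rw [intervalIntegral.integral_of_le hab, intervalIntegral.integral_of_le hab]
  exact setIntegral_congr_fun measurableSet_Ioc h

theorem hasDerivWithinAt_integral [CompleteSpace E] {f : ℝ → E} (hμ : 0 < μ) (hf : MemBC μ T f)
    {t : ℝ} (ht : t ∈ Ioc 0 T) :
    HasDerivWithinAt (fun t => ∫ s in (0 : ℝ)..t, f s) (f t) (Ioc 0 T) t := by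
  have hT : 0 < T := ht.1.trans_le ht.2
  -- Extending f past T by the constant f(T) turns the endpoint T into an interior point, so the
  -- two-sided fundamental theorem applies there too.
  set g : ℝ → E := fun s => f (min s T)
  have hgc : ContinuousOn g (Ioi 0) := by
    refine hf.continuousOn.comp (continuous_id.min continuous_const).continuousOn fun s hs => ?_
    exact ⟨lt_min hs hT, min_le_right _ _⟩
  have hfg : ∀ r ∈ Ioc 0 T, EqOn f g (Ioc 0 r) := fun r hr s hs => by
    simp only [g, min_eq_left (hs.2.trans hr.2)]
  have hint : IntervalIntegrable g volume 0 t :=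
    (hf.intervalIntegrable hμ ⟨le_rfl, hT.le⟩ ⟨ht.1.le, ht.2⟩).congr
      (by rw [uIoc_of_le ht.1.le]; exact hfg t ht)
  have h := intervalIntegral.integral_hasDerivAt_right hint
    (hgc.stronglyMeasurableAtFilter isOpen_Ioi t ht.1) (hgc.continuousAt (Ioi_mem_nhds ht.1))
  have hgt : g t = f t := by simp only [g, min_eq_left ht.2]
  rw [hgt] at h
  refine h.hasDerivWithinAt.congr (fun r hr => ?_) ?_
  · exact integral_congr_Ioc hr.1.le (hfg r hr)
  · exact integral_congr_Ioc ht.1.le (hfg t ht)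

theorem tendsto_integral_zero {f : ℝ → E} (hμ : 0 < μ) (hT : 0 < T) (hf : MemBC μ T f) :
    Tendsto (fun t => ∫ s in (0 : ℝ)..t, f s) (𝓝[>] 0) (𝓝 0) := by
  obtain ⟨C, -, hC⟩ := hf.exists_bound
  have h1 : Tendsto (fun t : ℝ => t ^ μ * (C / μ)) (𝓝[>] 0) (𝓝 0) := by
    have := (tendsto_weight (μ := 1 - μ) (by linarith)).mul_const (C / μ)
    simpa using this
  refine squeeze_zero_norm' ?_ h1
  filter_upwards [Ioc_mem_nhdsGT hT] with t ht
  exact norm_integral_le_of_weighted hμ ht.1.le fun s hs => hC s ⟨hs.1, hs.2.trans ht.2⟩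

theorem eq_add_integral_of_hasDerivWithinAt [CompleteSpace E] {u g : ℝ → E} {c : E} (hμ : 0 < μ)
    (hg : MemBC μ T g) (hu : ∀ t ∈ Ioc 0 T, HasDerivWithinAt u (g t) (Ioc 0 T) t)
    (h0 : Tendsto u (𝓝[>] 0) (𝓝 c)) {t : ℝ} (ht : t ∈ Ioc 0 T) :
    u t = c + ∫ s in (0 : ℝ)..t, g s := by
  have h1 : Tendsto u (𝓝[<] t) (𝓝 (u t)) := by
    have h2 := (hu t ht).continuousWithinAt
    have h3 : ContinuousWithinAt u (Ioo 0 t) t :=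
      h2.mono fun s hs => ⟨hs.1, hs.2.le.trans ht.2⟩
    rwa [ContinuousWithinAt, nhdsWithin_Ioo_eq_nhdsLT ht.1] at h3
  have hT : 0 ≤ T := ht.1.le.trans ht.2
  rw [intervalIntegral.integral_eq_sub_of_hasDerivAt_of_tendsto ht.1 (fun s hs => ?_)
    (hg.intervalIntegrable hμ ⟨le_rfl, hT⟩ ⟨ht.1.le, ht.2⟩) h0 h1]
  · abel
  · exact (hu s ⟨hs.1, hs.2.le.trans ht.2⟩).hasDerivAt
      (Filter.mem_of_superset (Ioo_mem_nhds hs.1 hs.2) fun r hr => ⟨hr.1, hr.2.le.trans ht.2⟩)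

/-- The function `t ↦ t ^ (μ-1) φ(t)` on `[0,T]`, extended to the right of `T` by
`t ^ (μ-1) φ(T)`. -/
def unweight (μ : ℝ) {T : ℝ} (hT : 0 ≤ T) (φ : Icc 0 T → E) (t : ℝ) : E :=
  t ^ (μ - 1) • φ (projIcc 0 T hT t)

theorem weight_unweight {hT : 0 ≤ T} (φ : Icc 0 T → E) {t : ℝ} (ht : 0 < t) :
    t ^ (1 - μ) • unweight μ hT φ t = φ (projIcc 0 T hT t) := by
  rw [unweight, smul_smul, rpow_weight_mul_inv ht, one_smul]

theorem memBC_unweight (hμ : μ < 1) (hT : 0 < T) {S : ℝ} (hS : 0 < S) {φ : Icc 0 T → E}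
    (hφ : Continuous φ) (h0 : φ ⟨0, left_mem_Icc.mpr hT.le⟩ = 0) :
    MemBC μ S (unweight μ hT.le φ) := by
  rw [memBC_iff hμ hS]
  have h1 : Continuous fun t => φ (projIcc 0 T hT.le t) := hφ.comp continuous_projIcc
  refine h1.continuousOn.congr fun t ht => ?_
  rcases ht.1.eq_or_lt with rfl | h
  · simp only [projIcc_left, Real.zero_rpow (show 1 - μ ≠ 0 by linarith), zero_smul, h0]
  · exact weight_unweight φ h

theorem MemBC.exists_unweight (hμ : μ < 1) (hT : 0 < T) {f : ℝ → E} (hf : MemBC μ T f) :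
    ∃ φ : C(Icc 0 T, E), φ ⟨0, left_mem_Icc.mpr hT.le⟩ = 0 ∧
      (∀ t : Icc 0 T, φ t = (t : ℝ) ^ (1 - μ) • f t) ∧
      EqOn f (unweight μ hT.le φ) (Ioc 0 T) := by
  have hc : Continuous fun t : Icc 0 T => (t : ℝ) ^ (1 - μ) • f t :=
    ((memBC_iff hμ hT).mp hf).comp_continuous continuous_subtype_val fun t => t.2
  refine ⟨⟨_, hc⟩, ?_, fun _ => rfl, fun t ht => ?_⟩
  · change (0 : ℝ) ^ (1 - μ) • f 0 = 0
    rw [Real.zero_rpow (show 1 - μ ≠ 0 by linarith), zero_smul]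
  · rw [unweight, projIcc_of_mem hT.le ⟨ht.1.le, ht.2⟩]
    change f t = t ^ (μ - 1) • t ^ (1 - μ) • f t
    rw [smul_smul, mul_comm, rpow_weight_mul_inv ht.1, one_smul]

theorem weight_norm_unweight_le (hT : 0 ≤ T) (φ : C(Icc 0 T, E)) {t : ℝ} (ht : 0 < t) :
    t ^ (1 - μ) * ‖unweight μ hT φ t‖ ≤ ‖φ‖ := by
  rw [← norm_weight_smul ht.le, weight_unweight _ ht]
  exact φ.norm_coe_le_norm _

end WeightedFacts

/-! ### Trace estimate in E_μ. -/

section Trace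

variable {E₀ E₁ : Type*} [NormedAddCommGroup E₀] [NormedSpace ℝ E₀]
  [NormedAddCommGroup E₁] [NormedSpace ℝ E₁] {j : E₁ →L[ℝ] E₀} {μ : ℝ}

/-- To bound the K-functional of v(t) − x at s, use the competitor v(t) − v(s) when s ≤ t: the
remainder v(s) − x is an integral of size s^μ in E₀, and s times the E₁-norm is also of size s^μ.
For s ≥ t the competitor 0 suffices. -/
theorem norm_emb_sub_le (hμ : μ ∈ Ioo (0 : ℝ) 1) {v : ℝ → E₁} {g : ℝ → E₀} {x : InterpSpace j μ}
    {t d₁ d₂ : ℝ} (ht : 0 < t)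
    (heq : ∀ s ∈ Ioc 0 t, j (v s) = InterpSpace.incl x + ∫ r in (0 : ℝ)..s, g r)
    (hv : ∀ s ∈ Ioc 0 t, s ^ (1 - μ) * ‖v s‖ ≤ d₁)
    (hg : ∀ s ∈ Ioc 0 t, s ^ (1 - μ) * ‖g s‖ ≤ d₂) :
    ‖emb j hμ (v t) - x‖ ≤ 2 * d₁ + d₂ / μ := by
  have hd₁ : 0 ≤ d₁ := le_trans (by positivity) (hv t ⟨ht, le_rfl⟩)
  have hd₂ : 0 ≤ d₂ := le_trans (by positivity) (hg t ⟨ht, le_rfl⟩)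
  have hμ0 := hμ.1
  have hx : ∀ s ∈ Ioc 0 t, ‖j (v s) - InterpSpace.incl x‖ ≤ s ^ μ * (d₂ / μ) := fun s hs => by
    rw [heq s hs, add_sub_cancel_left]
    exact norm_integral_le_of_weighted hμ.1 hs.1.le fun r hr => hg r ⟨hr.1, hr.2.trans hs.2⟩
  rw [InterpSpace.norm_def, map_sub, incl_emb]
  refine interpNorm_le fun s hs => ?_
  rcases le_total s t with hst | hst
  · have hs' : s ∈ Ioc 0 t := ⟨hs, hst⟩
    have hmul : s ^ μ = s * s ^ (μ - 1) := by
      rw [← Real.rpow_one_add' hs.le (by linarith)]; ring_nf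
    have h1 := kFunctional_le j hs.le (j (v t) - InterpSpace.incl x) (v t - v s)
    rw [map_sub, sub_sub_sub_cancel_left] at h1
    have h2 : ‖v t - v s‖ ≤ 2 * (d₁ * s ^ (μ - 1)) := by
      have h3 := norm_le_of_weighted ht (hv t ⟨ht, le_rfl⟩)
      have h4 := norm_le_of_weighted hs (hv s hs')
      have h5 : t ^ (μ - 1) ≤ s ^ (μ - 1) :=
        Real.rpow_le_rpow_of_nonpos hs hst (by linarith [hμ.2])
      have h6 := mul_le_mul_of_nonneg_left h5 hd₁
      linarith [norm_sub_le (v t) (v s)]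
    calc _ ≤ _ := h1
      _ ≤ s ^ μ * (d₂ / μ) + s * (2 * (d₁ * s ^ (μ - 1))) := by
        gcongr
        exact hx s hs'
      _ = s ^ μ * (2 * d₁ + d₂ / μ) := by rw [hmul]; ring
  · calc _ ≤ ‖j (v t) - InterpSpace.incl x‖ := kFunctional_le_norm j hs.le _
      _ ≤ t ^ μ * (d₂ / μ) := hx t ⟨ht, le_rfl⟩
      _ ≤ s ^ μ * (2 * d₁ + d₂ / μ) := by
        gcongr
        linarith

/-- The weighted norms of v and g tend to 0 at 0, so `norm_emb_sub_le` applies on short intervals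
with both constants as small as desired. Boundedness of the weighted functions alone would not give
this continuity. -/
theorem tendsto_emb (hμ : μ ∈ Ioo (0 : ℝ) 1) {v : ℝ → E₁} {g : ℝ → E₀} {x : InterpSpace j μ}
    {T : ℝ} (hT : 0 < T) (hv : MemBC μ T v) (hg : MemBC μ T g)
    (heq : ∀ s ∈ Ioc 0 T, j (v s) = InterpSpace.incl x + ∫ r in (0 : ℝ)..s, g r) :
    Tendsto (fun t => emb j hμ (v t)) (𝓝[>] 0) (𝓝 x) := by
  have hμ0 := hμ.1
  rw [Metric.tendsto_nhds]
  intro ε hε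
  have hδ : 0 < ε / (2 * (2 + 1 / μ)) := by positivity
  obtain ⟨δ, hδ0, hδ1⟩ : ∃ δ > 0, ∀ s ∈ Ioo 0 δ,
      ‖s ^ (1 - μ) • v s‖ < ε / (2 * (2 + 1 / μ)) ∧
        ‖s ^ (1 - μ) • g s‖ < ε / (2 * (2 + 1 / μ)) := by
    have := (hv.tendsto_zero.eventually (gt_mem_nhds hδ)).and
      (hg.tendsto_zero.eventually (gt_mem_nhds hδ))
    obtain ⟨δ, h, h'⟩ := mem_nhdsGT_iff_exists_Ioo_subset.mp this
    exact ⟨δ, h, h'⟩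
  filter_upwards [Ioo_mem_nhdsGT (lt_min hδ0 hT)] with t ht
  have h := norm_emb_sub_le hμ ht.1 (v := v) (g := g) (x := x) (d₁ := ε / (2 * (2 + 1 / μ)))
    (d₂ := ε / (2 * (2 + 1 / μ)))
    (fun s hs => heq s ⟨hs.1, (hs.2.trans ht.2.le).trans (min_le_right _ _)⟩)
    (fun s hs => by
      rw [← norm_weight_smul hs.1.le]
      exact (hδ1 s ⟨hs.1, (hs.2.trans_lt ht.2).trans_le (min_le_left _ _)⟩).1.le)
    (fun s hs => by
      rw [← norm_weight_smul hs.1.le]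
      exact (hδ1 s ⟨hs.1, (hs.2.trans_lt ht.2).trans_le (min_le_left _ _)⟩).2.le)
  rw [dist_eq_norm]
  refine h.trans_lt ?_
  have : 2 * (ε / (2 * (2 + 1 / μ))) + ε / (2 * (2 + 1 / μ)) / μ = ε / 2 := by
    field_simp
  linarith

end Trace

/-! ### The linear problem: a priori estimate uniform in the interval length. -/

section LinearProblem

open MeasureTheory

variable {E₀ E₁ : Type*} [NormedAddCommGroup E₀] [NormedSpace ℝ E₀]
  [NormedAddCommGroup E₁] [NormedSpace ℝ E₁] {j : E₁ →L[ℝ] E₀} {μ T : ℝ}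
  {B : E₁ →L[ℝ] E₀}

theorem MemMaxReg.hasDerivWithinAt {u : ℝ → E₀} (hu : MemMaxReg j μ T u) {t : ℝ}
    (ht : t ∈ Ioc 0 T) :
    HasDerivWithinAt u (derivWithin u (Ioc 0 T) t) (Ioc 0 T) t :=
  (hu.memBC1.differentiableOn t ht).hasDerivWithinAt

theorem MemMaxReg.eq_add_integral [CompleteSpace E₀] (hμ : 0 < μ) {u : ℝ → E₀}
    (hu : MemMaxReg j μ T u) {t : ℝ}
    (ht : t ∈ Ioc 0 T) :
    u t = u 0 + ∫ s in (0 : ℝ)..t, derivWithin u (Ioc 0 T) s :=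
  eq_add_integral_of_hasDerivWithinAt hμ hu.memBC1.memBC_deriv
    (fun _ hs => hu.hasDerivWithinAt hs) hu.trace ht

theorem hasDerivWithinAt_of_eq_add_integral [CompleteSpace E₀] (hμ : 0 < μ) {u g : ℝ → E₀} {c : E₀}
    (hg : MemBC μ T g) (hu : ∀ t ∈ Ioc 0 T, u t = c + ∫ s in (0 : ℝ)..t, g s) {t : ℝ}
    (ht : t ∈ Ioc 0 T) : HasDerivWithinAt u (g t) (Ioc 0 T) t :=
  ((hasDerivWithinAt_integral hμ hg ht).const_add c).congr hu (hu t ht)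

/-- The integral equation alone carries both the derivative and the trace, since g is continuous off
0 and its primitive tends to 0 there. This is the way back from integrated to differential form. -/
theorem memMaxReg_of_eq_add_integral [CompleteSpace E₀] (hj : Function.Injective j) (hμ : μ ∈ Ioo (0 : ℝ) 1)
    (hT : 0 < T) {u g : ℝ → E₀} {v : ℝ → E₁} (hv : MemBC μ T v) (hg : MemBC μ T g)
    (huv : ∀ t ∈ Ioc 0 T, j (v t) = u t)
    (hu : ∀ t ∈ Ioc 0 T, u t = u 0 + ∫ s in (0 : ℝ)..t, g s) :
    MemMaxReg j μ T u ∧ ∀ t ∈ Ioc 0 T,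
      derivWithin u (Ioc 0 T) t = g t ∧ toE₁ j (u t) = v t := by
  have hd : ∀ t ∈ Ioc 0 T, HasDerivWithinAt u (g t) (Ioc 0 T) t := fun t ht =>
    hasDerivWithinAt_of_eq_add_integral hμ.1 hg hu ht
  have hd' : ∀ t ∈ Ioc 0 T, derivWithin u (Ioc 0 T) t = g t := fun t ht =>
    (hd t ht).derivWithin (uniqueDiffOn_Ioc 0 T t ht)
  have hv' : ∀ t ∈ Ioc 0 T, toE₁ j (u t) = v t := fun t ht => by
    rw [← huv t ht, toE₁_apply hj]
  refine ⟨⟨fun t ht => ⟨v t, huv t ht⟩, ⟨fun t ht => (hd t ht).differentiableWithinAt, ?_, ?_⟩,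
    hv.congr hμ.2 hT hv', ?_⟩, fun t ht => ⟨hd' t ht, hv' t ht⟩⟩
  · exact (hv.clm hμ.2 hT j).congr hμ.2 hT fun t ht => (huv t ht).symm
  · exact hg.congr hμ.2 hT hd'
  · have h := (tendsto_integral_zero hμ.1 hT hg).const_add (u 0)
    rw [add_zero] at h
    refine h.congr' ?_
    filter_upwards [Ioc_mem_nhdsGT hT] with t ht using (hu t ht).symm

/-- `v ∈ BC_{1-μ}([0,T], E₁)` solves the integrated problem
`v(t) = x + ∫₀ᵗ (f(s) - B v(s)) ds` on `(0,T]`. -/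
structure IsLinearSolution (j : E₁ →L[ℝ] E₀) (μ : ℝ) (B : E₁ →L[ℝ] E₀) (T : ℝ) (f : ℝ → E₀)
    (x : InterpSpace j μ) (v : ℝ → E₁) : Prop where
  memBC : MemBC μ T v
  eqn : ∀ t ∈ Ioc 0 T, j (v t) = InterpSpace.incl x + ∫ s in (0 : ℝ)..t, (f s - B (v s))

theorem IsLinearSolution.mono {f : ℝ → E₀} {x : InterpSpace j μ} {v : ℝ → E₁} {S : ℝ}
    (h : IsLinearSolution j μ B T f x v) (hS : S ≤ T) : IsLinearSolution j μ B S f x v :=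
  ⟨h.memBC.mono hS, fun t ht => h.eqn t (Ioc_subset_Ioc_right hS ht)⟩

theorem IsLinearSolution.congr {f g : ℝ → E₀} {x : InterpSpace j μ} {v : ℝ → E₁}
    (h : IsLinearSolution j μ B T f x v) (hfg : EqOn f g (Ioc 0 T)) :
    IsLinearSolution j μ B T g x v := by
  refine ⟨h.memBC, fun t ht => ?_⟩
  rw [h.eqn t ht, integral_congr_Ioc ht.1.le fun s hs => ?_]
  simp only [hfg ⟨hs.1, hs.2.trans ht.2⟩]

theorem IsLinearSolution.sub (hμ : μ ∈ Ioo (0 : ℝ) 1) (hT : 0 < T) {f g : ℝ → E₀}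
    {x y : InterpSpace j μ} {v w : ℝ → E₁} (hf : MemBC μ T f) (hg : MemBC μ T g)
    (hv : IsLinearSolution j μ B T f x v) (hw : IsLinearSolution j μ B T g y w) :
    IsLinearSolution j μ B T (fun t => f t - g t) (x - y) (fun t => v t - w t) := by
  refine ⟨hv.memBC.sub hμ.2 hT hw.memBC, fun t ht => ?_⟩
  have h1 := (hf.sub hμ.2 hT (hv.memBC.clm hμ.2 hT B)).intervalIntegrable hμ.1
    (left_mem_Icc.mpr hT.le) (Ioc_subset_Icc_self ht)
  have h2 := (hg.sub hμ.2 hT (hw.memBC.clm hμ.2 hT B)).intervalIntegrable hμ.1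
    (left_mem_Icc.mpr hT.le) (Ioc_subset_Icc_self ht)
  rw [map_sub, hv.eqn t ht, hw.eqn t ht, map_sub, add_sub_add_comm,
    ← intervalIntegral.integral_sub h1 h2]
  congr 1
  refine intervalIntegral.integral_congr fun s _ => ?_
  simp only [map_sub]
  abel

theorem isLinearSolution_of_memMaxReg [CompleteSpace E₀] (hμ : μ ∈ Ioo (0 : ℝ) 1) {f u : ℝ → E₀}
    {x : InterpSpace j μ} (hu : MemMaxReg j μ T u) (h0 : u 0 = InterpSpace.incl x)
    (heq : ∀ t ∈ Ioc 0 T, derivWithin u (Ioc 0 T) t + B (toE₁ j (u t)) = f t) :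
    IsLinearSolution j μ B T f x fun t => toE₁ j (u t) := by
  refine ⟨hu.memBC, fun t ht => ?_⟩
  rw [apply_toE₁ (hu.mem_range t ht), hu.eq_add_integral hμ.1 ht, h0,
    integral_congr_Ioc ht.1.le fun s hs => ?_]
  simp only [← heq s ⟨hs.1, hs.2.trans ht.2⟩, add_sub_cancel_right]

theorem IsLinearSolution.memMaxReg [CompleteSpace E₀] (hj : Function.Injective j) (hμ : μ ∈ Ioo (0 : ℝ) 1)
    (hT : 0 < T) {f : ℝ → E₀} {x : InterpSpace j μ} {v : ℝ → E₁} (hf : MemBC μ T f)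
    (hv : IsLinearSolution j μ B T f x v) :
    ∃ u : ℝ → E₀, (MemMaxReg j μ T u ∧ u 0 = InterpSpace.incl x ∧
      ∀ t ∈ Ioc 0 T, derivWithin u (Ioc 0 T) t + B (toE₁ j (u t)) = f t) ∧
      ∀ t ∈ Ioc 0 T, j (v t) = u t := by
  set u : ℝ → E₀ := fun t => if t ≤ 0 then InterpSpace.incl x else j (v t)
  have hu : ∀ t ∈ Ioc 0 T, j (v t) = u t := fun t ht => by
    simp only [u, if_neg ht.1.not_ge]
  have hu0 : u 0 = InterpSpace.incl x := if_pos le_rfl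
  obtain ⟨h1, h2⟩ := memMaxReg_of_eq_add_integral hj hμ hT hv.memBC
    (hf.sub hμ.2 hT (hv.memBC.clm hμ.2 hT B)) hu
    fun t ht => by rw [hu0, ← hu t ht, hv.eqn t ht]
  refine ⟨u, ⟨h1, hu0, fun t ht => ?_⟩, hu⟩
  rw [(h2 t ht).1, (h2 t ht).2, sub_add_cancel]

theorem memBC_zero : MemBC μ T fun _ : ℝ => (0 : E₀) :=
  ⟨continuousOn_const, ⟨0, by simp⟩, by simp⟩

/-- If the homogeneous problem has only the trivial solution on `[0,T]` and is solvable there for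
all initial values, then it has only the trivial solution on each shorter interval. -/
theorem IsLinearSolution.eq_zero [CompleteSpace E₀] [CompleteSpace E₁] (hj : Function.Injective j) (hμ : μ ∈ Ioo (0 : ℝ) 1)
    (hex : ∀ x : InterpSpace j μ, ∃ v, IsLinearSolution j μ B T (fun _ => 0) x v)
    (huniq : ∀ v, IsLinearSolution j μ B T (fun _ => 0) 0 v → ∀ t ∈ Ioc 0 T, v t = 0)
    {τ : ℝ} (hτ : τ ∈ Ioc 0 T) {z : ℝ → E₁}
    (hz : IsLinearSolution j μ B τ (fun _ => 0) 0 z) : ∀ t ∈ Ioc 0 τ, z t = 0 := by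
  have hT : 0 < T := hτ.1.trans_le hτ.2
  obtain ⟨v, hv⟩ := hex (emb j hμ (z τ))
  -- Continue z beyond τ by the solution with initial value z(τ). That piece may be unbounded in E₁
  -- near τ, so y need not lie in the weighted space. Its primitive Y is continuous into E₁,
  -- satisfies j y = −B Y, and hence solves the homogeneous problem on all of [0,T].
  set y : ℝ → E₁ := fun t => if t ≤ τ then z t else v (t - τ) with hy
  have hyz : ∀ t ≤ τ, y t = z t := fun t ht => if_pos ht
  have hyv : ∀ t > τ, y t = v (t - τ) := fun t ht => if_neg ht.not_ge
  have hint1 : ∀ t ∈ Icc 0 τ, IntervalIntegrable y volume 0 t := fun t ht =>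
    (hz.memBC.intervalIntegrable hμ.1 (left_mem_Icc.mpr hτ.1.le) ht).congr fun s hs => by
      rw [uIoc_of_le ht.1] at hs
      exact (hyz s (hs.2.trans ht.2)).symm
  have hint2 : ∀ t ∈ Icc τ T, IntervalIntegrable y volume τ t := fun t ht => by
    have h1 : IntervalIntegrable v volume 0 (t - τ) :=
      hv.memBC.intervalIntegrable hμ.1 (left_mem_Icc.mpr hT.le)
        ⟨by linarith [ht.1], by linarith [ht.2, hτ.1]⟩
    have h2 := h1.comp_sub_right τ
    rw [zero_add, sub_add_cancel] at h2
    refine h2.congr fun s hs => ?_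
    rw [uIoc_of_le ht.1] at hs
    exact (hyv s hs.1).symm
  have hint : ∀ t ∈ Icc 0 T, IntervalIntegrable y volume 0 t := fun t ht => by
    rcases le_total t τ with h | h
    · exact hint1 t ⟨ht.1, h⟩
    · exact (hint1 τ ⟨hτ.1.le, le_rfl⟩).trans (hint2 t ⟨h, ht.2⟩)
  set Y : ℝ → E₁ := fun t => ∫ s in (0 : ℝ)..t, y s with hY
  have hYc : ContinuousOn Y (Icc 0 T) := by
    have := intervalIntegral.continuousOn_primitive_interval'
      (hint T (right_mem_Icc.mpr hT.le)) (a := 0) left_mem_uIcc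
    rwa [uIcc_of_le hT.le] at this
  have hYz : ∀ t ∈ Ioc 0 τ, Y t = ∫ s in (0 : ℝ)..t, z s := fun t ht =>
    integral_congr_Ioc ht.1.le fun s hs => hyz s (hs.2.trans ht.2)
  have hzint : ∀ t ∈ Ioc 0 τ, j (z t) = - B (∫ s in (0 : ℝ)..t, z s) := fun t ht => by
    rw [hz.eqn t ht, ← B.intervalIntegral_comp_comm
      (hz.memBC.intervalIntegrable hμ.1 (left_mem_Icc.mpr hτ.1.le) (Ioc_subset_Icc_self ht))]
    simp
  have hvint : ∀ t ∈ Ioc 0 T, j (v t) = j (z τ) - B (∫ s in (0 : ℝ)..t, v s) := fun t ht => by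
    rw [hv.eqn t ht, ← B.intervalIntegral_comp_comm
      (hv.memBC.intervalIntegrable hμ.1 (left_mem_Icc.mpr hT.le) (Ioc_subset_Icc_self ht))]
    simp [sub_eq_add_neg]
  have key : ∀ t ∈ Ioc 0 T, j (y t) = - B (Y t) := fun t ht => by
    rcases le_or_gt t τ with h | h
    · rw [hyz t h, hzint t ⟨ht.1, h⟩, hYz t ⟨ht.1, h⟩]
    · have h1 : Y t = Y τ + ∫ s in (0 : ℝ)..(t - τ), v s := by
        have h2 : ∫ s in (0 : ℝ)..(t - τ), v s = ∫ s in τ..t, v (s - τ) := by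
          rw [intervalIntegral.integral_comp_sub_right, sub_self]
        rw [h2, ← integral_congr_Ioc h.le (f := y) fun s hs => hyv s hs.1]
        exact (intervalIntegral.integral_add_adjacent_intervals (hint1 τ ⟨hτ.1.le, le_rfl⟩)
          (hint2 t ⟨h.le, ht.2⟩)).symm
      rw [hyv t h, hvint (t - τ) ⟨by linarith, by linarith [ht.2, hτ.1]⟩,
        hzint τ ⟨hτ.1, le_rfl⟩, ← hYz τ ⟨hτ.1, le_rfl⟩, h1, map_add]
      abel
  have hYsol : IsLinearSolution j μ B T (fun _ => 0) 0 Y := by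
    refine ⟨memBC_of_continuousOn hμ.2 hT hYc, fun t ht => ?_⟩
    rw [hY, ← j.intervalIntegral_comp_comm (hint t (Ioc_subset_Icc_self ht)), map_zero, zero_add]
    refine integral_congr_Ioc ht.1.le fun s hs => ?_
    simp only [key s ⟨hs.1, hs.2.trans ht.2⟩, zero_sub, hY]
  intro t ht
  apply hj
  rw [map_zero, ← hyz t ht.2, key t ⟨ht.1, ht.2.trans hτ.2⟩,
    huniq Y hYsol t ⟨ht.1, ht.2.trans hτ.2⟩, map_zero, neg_zero]

theorem intervalIntegrable_unweight (hμ : 0 < μ) (hT : 0 ≤ T) (φ : C(Icc 0 T, E₀)) (a b : ℝ) :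
    IntervalIntegrable (unweight μ hT φ) volume a b := by
  have h1 : IntervalIntegrable (fun t : ℝ => t ^ (μ - 1)) volume a b :=
    intervalIntegral.intervalIntegrable_rpow' (by linarith)
  exact h1.smul_continuousOn (φ.continuous.comp continuous_projIcc).continuousOn

/-- The map `φ ↦ ∫₀ᵗ s ^ (μ-1) φ(s) ds`. -/
def integralUnweight [CompleteSpace E₀] (hμ : 0 < μ) (hT : 0 ≤ T) {t : ℝ} (ht : 0 ≤ t) : C(Icc 0 T, E₀) →L[ℝ] E₀ :=
  LinearMap.mkContinuous
    { toFun := fun φ => ∫ s in (0 : ℝ)..t, unweight μ hT φ s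
      map_add' := fun φ ψ => by
        rw [← intervalIntegral.integral_add (intervalIntegrable_unweight hμ hT φ 0 t)
          (intervalIntegrable_unweight hμ hT ψ 0 t)]
        simp [unweight]
      map_smul' := fun c φ => by
        rw [RingHom.id_apply, ← intervalIntegral.integral_smul]
        refine intervalIntegral.integral_congr fun s _ => ?_
        exact smul_comm _ c _ } (t ^ μ / μ) fun φ => by
    refine (norm_integral_le_of_weighted hμ ht fun s hs =>
      weight_norm_unweight_le hT φ hs.1).trans (le_of_eq ?_)
    ring

/-- The residual of the integrated linear problem at time `t`, for the right-hand side
`t ^ (μ-1) (φ(t) - φ(0))`, the initial value `x` and the function `t ^ (μ-1) ψ(t)`. -/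
def linearResidual [CompleteSpace E₀] (j : E₁ →L[ℝ] E₀) (B : E₁ →L[ℝ] E₀) (hμ : 0 < μ)
    (hT : 0 ≤ T) (t : Ioc 0 T) :
    (C(Icc 0 T, E₀) × InterpSpace j μ × C(Icc 0 T, E₁)) →L[ℝ] E₀ :=
  let pφ := ContinuousLinearMap.fst ℝ C(Icc 0 T, E₀) (InterpSpace j μ × C(Icc 0 T, E₁))
  let p := ContinuousLinearMap.snd ℝ C(Icc 0 T, E₀) (InterpSpace j μ × C(Icc 0 T, E₁))
  let px := (ContinuousLinearMap.fst ℝ (InterpSpace j μ) C(Icc 0 T, E₁)).comp p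
  let pψ := (ContinuousLinearMap.snd ℝ (InterpSpace j μ) C(Icc 0 T, E₁)).comp p
  ((t : ℝ) ^ (μ - 1)) • j.comp
      ((ContinuousMap.evalCLM ℝ (⟨t, Ioc_subset_Icc_self t.2⟩ : Icc 0 T)).comp pψ)
    - (InterpSpace.inclL j μ).comp px
    - (integralUnweight hμ hT t.2.1.le).comp
        (pφ - (ContinuousLinearMap.const ℝ (Icc 0 T)).comp
              ((ContinuousMap.evalCLM ℝ (⟨0, left_mem_Icc.mpr hT⟩ : Icc 0 T)).comp pφ)
          - (B.compLeftContinuous ℝ (Icc 0 T)).comp pψ)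

/-- The closed subspace of all `(φ, x, ψ)` such that `t ^ (μ-1) ψ(t)` solves the integrated linear
problem with right-hand side `t ^ (μ-1) (φ(t) - φ(0))` and initial value `x`. -/
def solutionGraph [CompleteSpace E₀] (j : E₁ →L[ℝ] E₀) (B : E₁ →L[ℝ] E₀) (hμ : 0 < μ)
    (hT : 0 ≤ T) : Submodule ℝ (C(Icc 0 T, E₀) × InterpSpace j μ × C(Icc 0 T, E₁)) :=
  ((ContinuousLinearMap.pi (linearResidual j B hμ hT)).prod
    ((ContinuousMap.evalCLM ℝ (⟨0, left_mem_Icc.mpr hT⟩ : Icc 0 T)).comp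
      ((ContinuousLinearMap.snd ℝ (InterpSpace j μ) C(Icc 0 T, E₁)).comp
        (ContinuousLinearMap.snd ℝ C(Icc 0 T, E₀) _)))).ker

instance [CompleteSpace E₀] [CompleteSpace E₁] (hμ : 0 < μ) (hT : 0 ≤ T) :
    CompleteSpace (solutionGraph j B hμ hT) := by
  unfold solutionGraph
  infer_instance

theorem mem_solutionGraph_iff [CompleteSpace E₀] (hμ : 0 < μ) (hT : 0 ≤ T) {φ : C(Icc 0 T, E₀)}
    {x : InterpSpace j μ} {ψ : C(Icc 0 T, E₁)} :
    (φ, x, ψ) ∈ solutionGraph j B hμ hT ↔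
      ψ ⟨0, left_mem_Icc.mpr hT⟩ = 0 ∧ ∀ t ∈ Ioc 0 T,
        j (unweight μ hT ψ t) = InterpSpace.incl x + ∫ s in (0 : ℝ)..t,
          (unweight μ hT (fun r => φ r - φ ⟨0, left_mem_Icc.mpr hT⟩) s
            - B (unweight μ hT ψ s)) := by
  have h2 : ∀ t : ℝ, ∫ s in (0 : ℝ)..t, (unweight μ hT
      (fun r => φ r - φ ⟨0, left_mem_Icc.mpr hT⟩) s - B (unweight μ hT ψ s))
      = ∫ s in (0 : ℝ)..t, unweight μ hT (φ - ContinuousMap.const _ (φ ⟨0, left_mem_Icc.mpr hT⟩)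
          - B.compLeftContinuous ℝ (Icc 0 T) ψ : C(Icc 0 T, E₀)) s := fun t => by
    refine intervalIntegral.integral_congr fun s _ => ?_
    simp only [unweight, map_smul, ← smul_sub]
    rfl
  simp only [h2]
  rw [solutionGraph, LinearMap.mem_ker]
  constructor
  · intro h
    have ha := congrArg Prod.fst h
    have hb := congrArg Prod.snd h
    refine ⟨hb, fun t ht => ?_⟩
    have hc := congrFun ha ⟨t, ht⟩
    rw [unweight, projIcc_of_mem hT (Ioc_subset_Icc_self ht), map_smul]
    have hd : t ^ (μ - 1) • j (ψ ⟨t, Ioc_subset_Icc_self ht⟩) - InterpSpace.incl x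
      - ∫ s in (0 : ℝ)..t, unweight μ hT (φ - ContinuousMap.const _ (φ ⟨0, left_mem_Icc.mpr hT⟩)
          - B.compLeftContinuous ℝ (Icc 0 T) ψ : C(Icc 0 T, E₀)) s = 0 := hc
    rw [sub_sub, sub_eq_zero] at hd
    exact hd
  · rintro ⟨hb, ha⟩
    refine Prod.ext (funext fun ⟨t, ht⟩ => ?_) hb
    have hd := ha t ht
    rw [unweight, projIcc_of_mem hT (Ioc_subset_Icc_self ht), map_smul, ← sub_eq_zero,
      ← sub_sub] at hd
    exact hd

/-- A linear relation with closed graph whose projection is onto admits values of controlled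
norm. -/
theorem exists_mem_norm_le {X Y Z : Type*} [NormedAddCommGroup X] [NormedSpace ℝ X]
    [CompleteSpace X] [NormedAddCommGroup Y] [NormedSpace ℝ Y] [CompleteSpace Y]
    [NormedAddCommGroup Z] [NormedSpace ℝ Z] (Γ : Submodule ℝ (X × Y × Z)) [CompleteSpace Γ]
    (h : ∀ x y, ∃ z, (x, y, z) ∈ Γ) :
    ∃ C > 0, ∀ x y, ∃ z, (x, y, z) ∈ Γ ∧ ‖z‖ ≤ C * (‖x‖ + ‖y‖) := by
  set π : Γ →L[ℝ] X × Y :=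
    ((ContinuousLinearMap.fst ℝ X (Y × Z)).prod
      ((ContinuousLinearMap.fst ℝ Y Z).comp (ContinuousLinearMap.snd ℝ X (Y × Z)))).comp Γ.subtypeL
  have hsurj : Function.Surjective π := fun ⟨x, y⟩ =>
    let ⟨z, hz⟩ := h x y
    ⟨⟨(x, y, z), hz⟩, rfl⟩
  obtain ⟨C, hC, h⟩ := π.exists_preimage_norm_le hsurj
  refine ⟨C, hC, fun x y => ?_⟩
  obtain ⟨⟨⟨x', y', z⟩, hmem⟩, hp, hn⟩ := h (x, y)
  obtain ⟨rfl, rfl⟩ : x' = x ∧ y' = y := Prod.ext_iff.mp hp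
  refine ⟨z, hmem, ?_⟩
  calc ‖z‖ ≤ ‖((x', y', z) : X × Y × Z)‖ := (norm_snd_le (y', z)).trans (norm_snd_le (x', y', z))
    _ ≤ C * ‖(x', y')‖ := hn
    _ ≤ C * (‖x'‖ + ‖y'‖) := by
      gcongr
      exact norm_prod_le_iff.mpr ⟨le_add_of_nonneg_right (norm_nonneg _),
        le_add_of_nonneg_left (norm_nonneg _)⟩

/-- The open mapping theorem applied to the projection of the closed solution graph onto the data.
Only solvability enters, so the bound is for some solution; uniqueness identifies it with a given
one in `IsMaxRegOperator.exists_estimate`. -/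
theorem exists_solution_le [CompleteSpace E₀] [CompleteSpace E₁]
    (hμ : μ ∈ Ioo (0 : ℝ) 1) (hT : 0 < T)
    (hex : ∀ f : ℝ → E₀, MemBC μ T f → ∀ x : InterpSpace j μ,
      ∃ v, IsLinearSolution j μ B T f x v) :
    ∃ C > 0, ∀ f : ℝ → E₀, MemBC μ T f → ∀ (x : InterpSpace j μ) (F : ℝ), 0 ≤ F →
      (∀ t ∈ Ioc 0 T, t ^ (1 - μ) * ‖f t‖ ≤ F) → ∃ v, IsLinearSolution j μ B T f x v ∧
        ∀ t ∈ Ioc 0 T, t ^ (1 - μ) * ‖v t‖ ≤ C * (F + ‖x‖) := by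
  -- Subtracting φ(0) makes every continuous φ an admissible right-hand side, so the data range over
  -- a full Banach space rather than the subspace of functions vanishing at 0.
  have hsub : ∀ φ : C(Icc 0 T, E₀), MemBC μ T
      (unweight μ hT.le fun r => φ r - φ ⟨0, left_mem_Icc.mpr hT.le⟩) := fun φ =>
    memBC_unweight hμ.2 hT hT (φ.continuous.sub continuous_const) (sub_self _)
  obtain ⟨C, hC, h⟩ := exists_mem_norm_le (solutionGraph j B (T := T) hμ.1 hT.le) fun φ x => by
    obtain ⟨v, hv⟩ := hex _ (hsub φ) x
    obtain ⟨ψ, hψ0, -, hψ⟩ := hv.memBC.exists_unweight hμ.2 hT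
    refine ⟨ψ, (mem_solutionGraph_iff hμ.1 hT.le).mpr ⟨hψ0, fun t ht => ?_⟩⟩
    rw [← hψ ht, hv.eqn t ht]
    congr 1
    refine integral_congr_Ioc ht.1.le fun s hs => ?_
    simp only [hψ ⟨hs.1, hs.2.trans ht.2⟩]
  refine ⟨C, hC, fun f hf x F hF hfF => ?_⟩
  obtain ⟨φ, hφ0, hφ, hφf⟩ := hf.exists_unweight hμ.2 hT
  obtain ⟨ψ, hmem, hn⟩ := h φ x
  obtain ⟨hψ0, hψ⟩ := (mem_solutionGraph_iff hμ.1 hT.le).mp hmem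
  have hφF : ‖φ‖ ≤ F := by
    refine (ContinuousMap.norm_le _ hF).mpr fun ⟨t, ht⟩ => ?_
    rcases ht.1.eq_or_lt with rfl | h0
    · rwa [hφ0, norm_zero]
    · rw [hφ, norm_weight_smul ht.1]
      exact hfF t ⟨h0, ht.2⟩
  refine ⟨unweight μ hT.le ψ, ⟨memBC_unweight hμ.2 hT hT ψ.continuous hψ0, fun t ht => ?_⟩,
    fun t ht => ?_⟩
  · rw [hψ t ht]
    congr 1
    refine integral_congr_Ioc ht.1.le fun s hs => ?_
    simp only [hφf ⟨hs.1, hs.2.trans ht.2⟩, hφ0, sub_zero]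
  · calc t ^ (1 - μ) * ‖unweight μ hT.le ψ t‖ ≤ ‖ψ‖ := weight_norm_unweight_le hT.le ψ ht.1
      _ ≤ C * (‖φ‖ + ‖x‖) := hn
      _ ≤ C * (F + ‖x‖) := by gcongr

/-- Solvability and a priori estimate for the linear problem; the constants are uniform with
respect to the length of the interval. -/
theorem IsMaxRegOperator.exists_estimate [CompleteSpace E₀] [CompleteSpace E₁]
    (hj : Function.Injective j) (hμ : μ ∈ Ioo (0 : ℝ) 1) (hB : IsMaxRegOperator j μ B) :
    ∃ T > 0, ∃ M ≥ 1,
      (∀ f : ℝ → E₀, MemBC μ T f → ∀ x : InterpSpace j μ,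
        ∃ v, IsLinearSolution j μ B T f x v) ∧
      ∀ τ ∈ Ioc 0 T, ∀ (f : ℝ → E₀) (x : InterpSpace j μ) (v : ℝ → E₁) (F : ℝ), MemBC μ τ f →
        IsLinearSolution j μ B τ f x v → (∀ t ∈ Ioc 0 τ, t ^ (1 - μ) * ‖f t‖ ≤ F) →
        ∀ t ∈ Ioc 0 τ,
          t ^ (1 - μ) * ‖v t‖ + t ^ (1 - μ) * ‖f t - B (v t)‖ + ‖emb j hμ (v t)‖
            ≤ M * (F + ‖x‖) := by
  obtain ⟨T, hT, h⟩ := hB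
  have hex : ∀ f : ℝ → E₀, MemBC μ T f → ∀ x : InterpSpace j μ,
      ∃ v, IsLinearSolution j μ B T f x v := fun f hf x => by
    obtain ⟨u, hu, h0, heq⟩ := (h f hf x).1
    exact ⟨_, isLinearSolution_of_memMaxReg hμ hu h0 heq⟩
  have huniq : ∀ v, IsLinearSolution j μ B T (fun _ => 0) 0 v → ∀ t ∈ Ioc 0 T, v t = 0 := by
    intro v hv t ht
    have hz : IsLinearSolution j μ B T (fun _ => 0) 0 (fun _ => 0) := ⟨memBC_zero, by simp⟩
    obtain ⟨u₁, h₁, hu₁⟩ := hv.memMaxReg hj hμ hT memBC_zero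
    obtain ⟨u₂, h₂, hu₂⟩ := hz.memMaxReg hj hμ hT memBC_zero
    apply hj
    rw [hu₁ t ht, (h _ memBC_zero 0).2 u₁ u₂ h₁ h₂ (Ioc_subset_Icc_self ht), ← hu₂ t ht]
  obtain ⟨C, hC, hest⟩ := exists_solution_le hμ hT hex
  -- The right-hand side on [0,τ] is extended to [0,T] with constant weighted value beyond τ. Its
  -- weighted bound F is unchanged, so the constant C of the long interval serves for the short one;
  -- `IsLinearSolution.eq_zero` identifies the two solutions on [0,τ].
  have hv_est : ∀ τ ∈ Ioc 0 T, ∀ (f : ℝ → E₀) (x : InterpSpace j μ) (v : ℝ → E₁) (F : ℝ),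
      MemBC μ τ f → IsLinearSolution j μ B τ f x v →
      (∀ t ∈ Ioc 0 τ, t ^ (1 - μ) * ‖f t‖ ≤ F) →
      ∀ t ∈ Ioc 0 τ, t ^ (1 - μ) * ‖v t‖ ≤ C * (F + ‖x‖) := by
    intro τ hτ f x v F hf hv hF t ht
    have hF0 : 0 ≤ F := le_trans (by have := ht.1; positivity) (hF t ht)
    obtain ⟨φ, hφ0, hφ, hφf⟩ := hf.exists_unweight hμ.2 hτ.1
    have hφF : ∀ s, ‖φ s‖ ≤ F := fun ⟨s, hs⟩ => by
      rcases hs.1.eq_or_lt with rfl | h0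
      · rwa [hφ0, norm_zero]
      · rw [hφ, norm_weight_smul hs.1]
        exact hF s ⟨h0, hs.2⟩
    have hg : ∀ {S : ℝ}, 0 < S → MemBC μ S (unweight μ hτ.1.le φ) := fun hS =>
      memBC_unweight hμ.2 hτ.1 hS φ.continuous hφ0
    obtain ⟨w, hw, hwF⟩ := hest _ (hg hT) x F hF0 fun s hs => by
      rw [← norm_weight_smul hs.1.le, weight_unweight _ hs.1]
      exact hφF _
    have hd := (hw.mono hτ.2).sub hμ hτ.1 (hg hτ.1) hf hv
    rw [sub_self] at hd
    have hd' := IsLinearSolution.eq_zero hj hμ (hex _ memBC_zero) huniq hτ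
      (hd.congr (g := fun _ => 0) fun s hs => by simp only [hφf hs, sub_self]) t ht
    rw [← sub_eq_zero.mp hd']
    exact hwF t ⟨ht.1, ht.2.trans hτ.2⟩
  -- The bracket collects the bounds for v, for f − Bv, and for the trace from `norm_emb_sub_le`.
  -- One of the extra units pays for ‖x‖ in passing from emb v − x to emb v; the other is slack.
  refine ⟨T, hT, 1 + (C + (1 + ‖B‖ * C) + (2 * C + (1 + ‖B‖ * C) / μ)) + 1, ?_, hex, ?_⟩
  · have := hμ.1
    have : 0 ≤ (C + (1 + ‖B‖ * C) + (2 * C + (1 + ‖B‖ * C) / μ)) := by positivity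
    linarith
  intro τ hτ f x v F hf hv hF t ht
  have hF0 : 0 ≤ F := le_trans (by have := ht.1; positivity) (hF t ht)
  have hμ0 := hμ.1
  have h1 := hv_est τ hτ f x v F hf hv hF
  have h2 : ∀ s ∈ Ioc 0 τ, s ^ (1 - μ) * ‖f s - B (v s)‖ ≤ (1 + ‖B‖ * C) * (F + ‖x‖) := by
    intro s hs
    have hs0 : 0 ≤ s ^ (1 - μ) := Real.rpow_nonneg hs.1.le _
    calc s ^ (1 - μ) * ‖f s - B (v s)‖ ≤ s ^ (1 - μ) * (‖f s‖ + ‖B‖ * ‖v s‖) := by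
          gcongr
          exact (norm_sub_le _ _).trans (add_le_add_right (B.le_opNorm _) _)
      _ = s ^ (1 - μ) * ‖f s‖ + ‖B‖ * (s ^ (1 - μ) * ‖v s‖) := by ring
      _ ≤ F + ‖B‖ * (C * (F + ‖x‖)) := by
        exact add_le_add (hF s hs) (mul_le_mul_of_nonneg_left (h1 s hs) (norm_nonneg B))
      _ ≤ (1 + ‖B‖ * C) * (F + ‖x‖) := by linarith [norm_nonneg x]
  have h3 := norm_emb_sub_le hμ ht.1 (fun s hs => hv.eqn s ⟨hs.1, hs.2.trans ht.2⟩)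
    (fun s hs => h1 s ⟨hs.1, hs.2.trans ht.2⟩) (fun s hs => h2 s ⟨hs.1, hs.2.trans ht.2⟩)
  have h4 : ‖emb j hμ (v t)‖ ≤ ‖x‖ + ‖emb j hμ (v t) - x‖ := by
    simpa using norm_add_le x (emb j hμ (v t) - x)
  have h5 : (1 + ‖B‖ * C) * (F + ‖x‖) / μ = (1 + ‖B‖ * C) / μ * (F + ‖x‖) := by ring
  have := h1 t ht
  have := h2 t ht
  nlinarith [norm_nonneg x]

end LinearProblem

/-! ### Weighted smallness of the nonlinear terms. -/

section Nonlinearity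

variable {E₀ E₁ : Type*} [NormedAddCommGroup E₀] [NormedSpace ℝ E₀]
  [NormedAddCommGroup E₁] [NormedSpace ℝ E₁] {j : E₁ →L[ℝ] E₀} {μ T : ℝ}
  {V : Set (InterpSpace j μ)} {A : InterpSpace j μ → E₁ →L[ℝ] E₀}
  {F₁ F₂ : InterpSpace j μ → E₀}

theorem interpNorm_nonneg (j : E₁ →L[ℝ] E₀) (θ : ℝ) (x : E₀) : 0 ≤ interpNorm j θ x :=
  Real.iSup_nonneg fun t => kWeighted_nonneg j θ x t.2

/-- The critical weight bound: the growth of the nonlinearity in `E_β` is absorbed by the time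
weight. -/
theorem eventually_weight_mul_growth_le (hμ : μ ∈ Ioo (0 : ℝ) 1) {β : ℝ} (hβ : β ∈ Ioo μ 1)
    {b ρ : ℝ} (hb : b ∈ Icc μ β) (hρ : 0 ≤ ρ)
    (hcrit : (ρ * (β - μ) + (b - μ)) / (1 - μ) ≤ 1) (R : ℝ) {η : ℝ} (hη : 0 < η) :
    ∀ᶠ r in 𝓝[>] (0 : ℝ), ∀ t ∈ Ioc 0 r, ∀ a₁ a₂ : E₁, ‖emb j hμ a₁‖ ≤ R → ‖emb j hμ a₂‖ ≤ R →
      t ^ (1 - μ) * ‖a₁‖ ≤ r → t ^ (1 - μ) * ‖a₂‖ ≤ r →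
      t ^ (1 - μ) * ((1 + interpNorm j β (j a₁) ^ ρ + interpNorm j β (j a₂) ^ ρ) * t ^ (μ - b))
        ≤ η := by
  have hb1 : 0 < 1 - b := by linarith [hb.2, hβ.2]
  have hsmall : ∀ δ > 0, ∀ᶠ r in 𝓝[>] (0 : ℝ), ∀ t ∈ Ioc 0 r, t ^ (1 - b) ≤ δ := fun δ hδ => by
    filter_upwards [(tendsto_weight (μ := b) (by linarith)).eventually (Iic_mem_nhds hδ)]
      with r hr t ht
    exact (Real.rpow_le_rpow ht.1.le ht.2 hb1.le).trans hr
  have e1 : ∀ t : ℝ, 0 < t → t ^ (1 - μ) * t ^ (μ - b) = t ^ (1 - b) := fun t ht => by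
    rw [← Real.rpow_add ht]; ring_nf
  rcases hρ.eq_or_lt with rfl | hρ
  -- For ρ = 0 the bracket is the constant 3, and the smallness comes from the positive power
  -- t^(1-b).
  · filter_upwards [hsmall (η / 3) (by positivity)] with r hr t ht a₁ a₂ _ _ _ _
    simp only [Real.rpow_zero]
    calc t ^ (1 - μ) * ((1 + 1 + 1) * t ^ (μ - b)) = 3 * (t ^ (1 - μ) * t ^ (μ - b)) := by ring
      _ ≤ 3 * (η / 3) := by rw [e1 t ht.1]; gcongr; exact hr t ht
      _ = η := by ring
  -- This κ has ρ-th power η/4. In the critical case the powers of t cancel exactly, so η/4 is the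
  -- only source of smallness for the two growth terms.
  · have hκ : 0 < (η / 4) ^ (1 / ρ) := by positivity
    filter_upwards [hsmall (η / 2) (by positivity),
      eventually_rpow_mul_interpNorm_le (j := j) hμ hβ R hκ, Ioc_mem_nhdsGT one_pos]
      with r hr hr' hr1 t ht a₁ a₂ h1 h2 h3 h4
    have ht0 := ht.1
    have hpow : ∀ a : E₁, ‖emb j hμ a‖ ≤ R → t ^ (1 - μ) * ‖a‖ ≤ r →
        interpNorm j β (j a) ^ ρ ≤ η / 4 * t ^ (-(ρ * (β - μ))) := fun a ha ha' => by
      have h5 := hr' t ht0 a ha ha'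
      have h6 : (t ^ (β - μ) * interpNorm j β (j a)) ^ ρ ≤ η / 4 := by
        calc _ ≤ ((η / 4) ^ (1 / ρ)) ^ ρ := by
              refine Real.rpow_le_rpow ?_ h5 hρ.le
              exact mul_nonneg (by positivity) (interpNorm_nonneg j β _)
          _ = η / 4 := by
            rw [← Real.rpow_mul (by positivity), one_div, inv_mul_cancel₀ hρ.ne', Real.rpow_one]
      rw [Real.mul_rpow (by positivity) (interpNorm_nonneg j β _), ← Real.rpow_mul ht0.le] at h6
      calc interpNorm j β (j a) ^ ρ
          = (t ^ ((β - μ) * ρ) * interpNorm j β (j a) ^ ρ) * t ^ (-(ρ * (β - μ))) := by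
            rw [mul_right_comm, ← Real.rpow_add ht0]; ring_nf; simp
        _ ≤ η / 4 * t ^ (-(ρ * (β - μ))) := by gcongr
    have hnum : ρ * (β - μ) + (b - μ) ≤ 1 - μ := by
      rwa [div_le_one (by linarith [hμ.2])] at hcrit
    have e2 : t ^ (1 - μ) * (t ^ (-(ρ * (β - μ))) * t ^ (μ - b)) ≤ 1 := by
      rw [← Real.rpow_add ht0, ← Real.rpow_add ht0]
      exact Real.rpow_le_one ht0.le (ht.2.trans hr1.2) (by linarith)
    calc t ^ (1 - μ) * ((1 + interpNorm j β (j a₁) ^ ρ + interpNorm j β (j a₂) ^ ρ) * t ^ (μ - b))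
        ≤ t ^ (1 - μ) * ((1 + η / 4 * t ^ (-(ρ * (β - μ))) + η / 4 * t ^ (-(ρ * (β - μ))))
            * t ^ (μ - b)) := by
          gcongr
          · exact hpow a₁ h1 h3
          · exact hpow a₂ h2 h4
      _ = t ^ (1 - μ) * t ^ (μ - b)
          + η / 2 * (t ^ (1 - μ) * (t ^ (-(ρ * (β - μ))) * t ^ (μ - b))) := by ring
      _ ≤ η / 2 + η / 2 * 1 := by
        gcongr
        rw [e1 t ht0]
        exact hr t ht
      _ = η := by ring

theorem eventually_closedBall_subset {X : Type*} [PseudoMetricSpace X] {x : X} {s : Set X}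
    (hs : s ∈ 𝓝 x) : ∀ᶠ r in 𝓝[>] (0 : ℝ), Metric.closedBall x r ⊆ s := by
  obtain ⟨ε, hε, h⟩ := Metric.nhds_basis_closedBall.mem_iff.mp hs
  filter_upwards [Ioc_mem_nhdsGT hε] with r hr
  exact (Metric.closedBall_subset_closedBall hr.2).trans h

/-- The E_{b i}-norm of the difference costs a factor t^(μ - b i) by `interpNorm_apply_le`. Together
with the growth factor and the weight, that cost is made small by `eventually_weight_mul_growth_le`.
-/
theorem StructuralHypothesis.eventually_le (hμ : μ ∈ Ioo (0 : ℝ) 1) (hV : IsOpen V)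
    (h₂ : StructuralHypothesis j μ V F₂) {x₀ : InterpSpace j μ} (hx₀ : x₀ ∈ V) {η : ℝ}
    (hη : 0 < η) :
    ∀ᶠ r in 𝓝[>] (0 : ℝ), ∀ t ∈ Ioc 0 r, ∀ a₁ a₂ : E₁,
      emb j hμ a₁ ∈ Metric.closedBall x₀ r → emb j hμ a₂ ∈ Metric.closedBall x₀ r →
      t ^ (1 - μ) * ‖a₁‖ ≤ r → t ^ (1 - μ) * ‖a₂‖ ≤ r →
      t ^ (1 - μ) * ‖F₂ (emb j hμ a₁) - F₂ (emb j hμ a₂)‖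
        ≤ η * (t ^ (1 - μ) * ‖a₁ - a₂‖ + ‖emb j hμ (a₁ - a₂)‖) := by
  obtain ⟨β, hβ, m, b, ρ, hbρ, h⟩ := h₂
  obtain ⟨C, hC, hF⟩ := h x₀ hx₀ 1 one_pos
  have hβ' : β ∈ Ioo (0 : ℝ) 1 := ⟨hμ.1.trans hβ.1, hβ.2⟩
  -- The m summands each get this share; m + 1 keeps the quotient meaningful when m = 0.
  have hη' : 0 < η / (C * (m + 1)) := by positivity
  have hev : ∀ᶠ r in 𝓝[>] (0 : ℝ), ∀ i, ∀ t ∈ Ioc 0 r, ∀ a₁ a₂ : E₁,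
      ‖emb j hμ a₁‖ ≤ ‖x₀‖ + 1 → ‖emb j hμ a₂‖ ≤ ‖x₀‖ + 1 →
      t ^ (1 - μ) * ‖a₁‖ ≤ r → t ^ (1 - μ) * ‖a₂‖ ≤ r →
      t ^ (1 - μ) * ((1 + interpNorm j β (j a₁) ^ ρ i + interpNorm j β (j a₂) ^ ρ i)
        * t ^ (μ - b i)) ≤ η / (C * (m + 1)) :=
    eventually_all.mpr fun i => eventually_weight_mul_growth_le hμ hβ (hbρ i).1 (hbρ i).2.1
      (hbρ i).2.2 _ hη'
  filter_upwards [hev, Ioc_mem_nhdsGT one_pos, eventually_closedBall_subset (hV.mem_nhds hx₀)]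
    with r hr hr1 hball t ht a₁ a₂ h1 h2 h3 h4
  have hn : ∀ a : E₁, emb j hμ a ∈ Metric.closedBall x₀ r → ‖emb j hμ a‖ ≤ ‖x₀‖ + 1 :=
    fun a ha => by
      have h5 := norm_le_norm_add_norm_sub' (emb j hμ a) x₀
      rw [mem_closedBall_iff_norm] at ha
      linarith [hr1.2]
  have h5 := hF (emb j hμ a₁) (emb j hμ a₂) (Metric.closedBall_subset_closedBall hr1.2 h1)
    (hball h1) (interpMem_apply hβ' a₁) (Metric.closedBall_subset_closedBall hr1.2 h2) (hball h2)
    (interpMem_apply hβ' a₂)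
  simp only [incl_emb, ← map_sub] at h5
  set D := t ^ (1 - μ) * ‖a₁ - a₂‖ + ‖emb j hμ (a₁ - a₂)‖ with hD
  have ht0 := ht.1
  have hD0 : 0 ≤ D := by positivity
  calc t ^ (1 - μ) * ‖F₂ (emb j hμ a₁) - F₂ (emb j hμ a₂)‖
      ≤ t ^ (1 - μ) * (C * ∑ i, (1 + interpNorm j β (j a₁) ^ ρ i + interpNorm j β (j a₂) ^ ρ i)
          * interpNorm j (b i) (j (a₁ - a₂))) := by gcongr
    _ = C * ∑ i, t ^ (1 - μ) * ((1 + interpNorm j β (j a₁) ^ ρ i + interpNorm j β (j a₂) ^ ρ i)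
          * interpNorm j (b i) (j (a₁ - a₂))) := by rw [mul_left_comm, Finset.mul_sum]
    _ ≤ C * ∑ _i : Fin m, η / (C * (m + 1)) * D := by
      refine mul_le_mul_of_nonneg_left (Finset.sum_le_sum fun i _ => ?_) hC.le
      have h6 := interpNorm_apply_le (j := j) hμ
        ⟨(hbρ i).1.1, (hbρ i).1.2.trans_lt hβ.2⟩ (a₁ - a₂) ht0
      have h7 : 0 ≤ 1 + interpNorm j β (j a₁) ^ ρ i + interpNorm j β (j a₂) ^ ρ i := by
        have := Real.rpow_nonneg (interpNorm_nonneg j β (j a₁)) (ρ i)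
        have := Real.rpow_nonneg (interpNorm_nonneg j β (j a₂)) (ρ i)
        linarith
      calc t ^ (1 - μ) * ((1 + interpNorm j β (j a₁) ^ ρ i + interpNorm j β (j a₂) ^ ρ i)
            * interpNorm j (b i) (j (a₁ - a₂)))
          ≤ t ^ (1 - μ) * ((1 + interpNorm j β (j a₁) ^ ρ i + interpNorm j β (j a₂) ^ ρ i)
            * (t ^ (μ - b i) * D)) := by gcongr
        _ = t ^ (1 - μ) * ((1 + interpNorm j β (j a₁) ^ ρ i + interpNorm j β (j a₂) ^ ρ i)
            * t ^ (μ - b i)) * D := by ring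
        _ ≤ η / (C * (m + 1)) * D := by
          gcongr
          exact hr i t ht a₁ a₂ (hn a₁ h1) (hn a₂ h2) h3 h4
    _ = η * D * (m / (m + 1)) := by
      rw [Finset.sum_const, Finset.card_univ, Fintype.card_fin, nsmul_eq_mul]
      field_simp
    _ ≤ η * D * 1 := by
      gcongr
      rw [div_le_one (by positivity)]
      linarith
    _ = η * D := mul_one _

/-- The vector field `a ↦ F₁(a) + F₂(a) - A(a) a` of the quasilinear problem on `E₁`. -/
def vectorField (hμ : μ ∈ Ioo (0 : ℝ) 1) (A : InterpSpace j μ → E₁ →L[ℝ] E₀)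
    (F₁ F₂ : InterpSpace j μ → E₀) (a : E₁) : E₀ :=
  F₁ (emb j hμ a) + F₂ (emb j hμ a) - A (emb j hμ a) a

/-- The vector field, corrected by the linearized operator `A(x₀)`, is a contraction near `x₀` with
respect to the weighted norms. -/
theorem eventually_vectorField_sub_le (hμ : μ ∈ Ioo (0 : ℝ) 1) (hV : IsOpen V)
    (h₁ : LipschitzHypothesis j μ V A F₁) (h₂ : StructuralHypothesis j μ V F₂)
    {x₀ : InterpSpace j μ} (hx₀ : x₀ ∈ V) {η : ℝ} (hη : 0 < η) :
    ∀ᶠ r in 𝓝[>] (0 : ℝ), ∀ t ∈ Ioc 0 r, ∀ a₁ a₂ : E₁,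
      emb j hμ a₁ ∈ Metric.closedBall x₀ r → emb j hμ a₂ ∈ Metric.closedBall x₀ r →
      t ^ (1 - μ) * ‖a₁‖ ≤ r → t ^ (1 - μ) * ‖a₂‖ ≤ r →
      t ^ (1 - μ) * ‖(A x₀ a₁ + vectorField hμ A F₁ F₂ a₁)
          - (A x₀ a₂ + vectorField hμ A F₁ F₂ a₂)‖
        ≤ η * (t ^ (1 - μ) * ‖a₁ - a₂‖ + ‖emb j hμ (a₁ - a₂)‖) := by
  obtain ⟨K, s, hs, hK⟩ := h₁.lipschitz hx₀
  rw [hV.nhdsWithin_eq hx₀] at hs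
  have hsmall : ∀ᶠ r in 𝓝[>] (0 : ℝ), K * r + K * r ^ (1 - μ) ≤ η / 2 := by
    have h1 : Tendsto (fun r : ℝ => K * r + K * r ^ (1 - μ)) (𝓝[>] 0) (𝓝 (K * 0 + K * 0)) :=
      ((tendsto_id.mono_left nhdsWithin_le_nhds).const_mul _).add
        ((tendsto_weight hμ.2).const_mul _)
    rw [mul_zero, add_zero] at h1
    exact h1.eventually (Iic_mem_nhds (by positivity))
  filter_upwards [hsmall, eventually_closedBall_subset hs, h₂.eventually_le hμ hV hx₀ (half_pos hη),
    self_mem_nhdsWithin] with r hr hball hF2 hr0 t ht a₁ a₂ h1 h2 h3 h4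
  have hr0' : 0 < r := hr0
  have ht0 := ht.1
  have hx₀s : x₀ ∈ s := hball (Metric.mem_closedBall_self hr0'.le)
  have hlip : ∀ y ∈ s, ∀ z ∈ s, ‖A y - A z‖ ≤ K * ‖y - z‖ ∧ ‖F₁ y - F₁ z‖ ≤ K * ‖y - z‖ :=
    fun y hy z hz => by
      have h := hK.dist_le_mul y hy z hz
      rw [Prod.dist_eq, max_le_iff, dist_eq_norm, dist_eq_norm, dist_eq_norm] at h
      exact h
  set D := t ^ (1 - μ) * ‖a₁ - a₂‖ + ‖emb j hμ (a₁ - a₂)‖ with hD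
  have hw : 0 ≤ t ^ (1 - μ) := by positivity
  have hK0 : (0 : ℝ) ≤ K := K.2
  have hA1 : t ^ (1 - μ) * ‖(A x₀ - A (emb j hμ a₁)) (a₁ - a₂)‖
      ≤ K * r * (t ^ (1 - μ) * ‖a₁ - a₂‖) := by
    have h5 := (hlip x₀ hx₀s _ (hball h1)).1
    rw [mem_closedBall_iff_norm, norm_sub_rev] at h1
    calc _ ≤ t ^ (1 - μ) * (K * r * ‖a₁ - a₂‖) := by
          gcongr
          refine ((A x₀ - A (emb j hμ a₁)).le_opNorm _).trans ?_
          gcongr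
          exact h5.trans (by gcongr)
      _ = _ := by ring
  have hA2 : t ^ (1 - μ) * ‖(A (emb j hμ a₂) - A (emb j hμ a₁)) a₂‖
      ≤ K * r * ‖emb j hμ (a₁ - a₂)‖ := by
    have h5 := (hlip _ (hball h2) _ (hball h1)).1
    rw [norm_sub_rev (emb j hμ a₂), ← map_sub] at h5
    calc _ ≤ t ^ (1 - μ) * (K * ‖emb j hμ (a₁ - a₂)‖ * ‖a₂‖) := by
          gcongr
          refine ((A (emb j hμ a₂) - A (emb j hμ a₁)).le_opNorm _).trans ?_
          gcongr
      _ = K * ‖emb j hμ (a₁ - a₂)‖ * (t ^ (1 - μ) * ‖a₂‖) := by ring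
      _ ≤ K * ‖emb j hμ (a₁ - a₂)‖ * r := by gcongr
      _ = _ := by ring
  have hF1 : t ^ (1 - μ) * ‖F₁ (emb j hμ a₁) - F₁ (emb j hμ a₂)‖
      ≤ K * r ^ (1 - μ) * ‖emb j hμ (a₁ - a₂)‖ := by
    have h5 := (hlip _ (hball h1) _ (hball h2)).2
    rw [← map_sub] at h5
    have h6 : t ^ (1 - μ) ≤ r ^ (1 - μ) :=
      Real.rpow_le_rpow ht0.le ht.2 (by linarith [hμ.2])
    calc _ ≤ r ^ (1 - μ) * (K * ‖emb j hμ (a₁ - a₂)‖) := by gcongr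
      _ = _ := by ring
  have hF2' := hF2 t ht a₁ a₂ h1 h2 h3 h4
  -- The splitting pairs a small operator difference with a₁ − a₂, and an operator difference
  -- controlled by a₁ − a₂ in E_μ with the single vector a₂, whose weighted norm is at most r. Both
  -- products gain a factor r.
  have hsplit : (A x₀ a₁ + vectorField hμ A F₁ F₂ a₁) - (A x₀ a₂ + vectorField hμ A F₁ F₂ a₂)
      = (A x₀ - A (emb j hμ a₁)) (a₁ - a₂) + (A (emb j hμ a₂) - A (emb j hμ a₁)) a₂
        + (F₁ (emb j hμ a₁) - F₁ (emb j hμ a₂)) + (F₂ (emb j hμ a₁) - F₂ (emb j hμ a₂)) := by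
    simp only [vectorField, sub_apply, map_sub]
    abel
  rw [hsplit]
  have h5 : t ^ (1 - μ) * ‖(A x₀ - A (emb j hμ a₁)) (a₁ - a₂)
        + (A (emb j hμ a₂) - A (emb j hμ a₁)) a₂
        + (F₁ (emb j hμ a₁) - F₁ (emb j hμ a₂)) + (F₂ (emb j hμ a₁) - F₂ (emb j hμ a₂))‖
      ≤ t ^ (1 - μ) * (‖(A x₀ - A (emb j hμ a₁)) (a₁ - a₂)‖
        + ‖(A (emb j hμ a₂) - A (emb j hμ a₁)) a₂‖
        + ‖F₁ (emb j hμ a₁) - F₁ (emb j hμ a₂)‖ + ‖F₂ (emb j hμ a₁) - F₂ (emb j hμ a₂)‖) := by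
    gcongr
    exact norm_add₄_le
  have h6 : 0 ≤ K * r ^ (1 - μ) * (t ^ (1 - μ) * ‖a₁ - a₂‖) := by positivity
  have h7 : (K * r + K * r ^ (1 - μ)) * D ≤ η / 2 * D := by gcongr
  rw [mul_add, mul_add, mul_add] at h5
  have h8 : (K * r + K * r ^ (1 - μ)) * D
      = K * r * (t ^ (1 - μ) * ‖a₁ - a₂‖) + K * r * ‖emb j hμ (a₁ - a₂)‖
        + K * r ^ (1 - μ) * ‖emb j hμ (a₁ - a₂)‖
        + K * r ^ (1 - μ) * (t ^ (1 - μ) * ‖a₁ - a₂‖) := by rw [hD]; ring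
  linarith

/-- Apply the contraction estimate centred at a₀ itself, with one fixed t so small that the weighted
ball contains the unit ball of E₁ around a₀. For fixed t the weight is a harmless positive constant.
-/
theorem continuousAt_vectorField (hμ : μ ∈ Ioo (0 : ℝ) 1) (hV : IsOpen V)
    (h₁ : LipschitzHypothesis j μ V A F₁) (h₂ : StructuralHypothesis j μ V F₂) {a₀ : E₁}
    (ha₀ : emb j hμ a₀ ∈ V) : ContinuousAt (vectorField hμ A F₁ F₂) a₀ := by
  obtain ⟨r, hr, hr0⟩ := ((eventually_vectorField_sub_le hμ hV h₁ h₂ ha₀ one_pos).and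
    self_mem_nhdsWithin).exists
  have hr0' : 0 < r := hr0
  obtain ⟨t, ht1, ht⟩ : ∃ t : ℝ, t ^ (1 - μ) * (‖a₀‖ + 1) ≤ r ∧ t ∈ Ioc 0 r := by
    have h1 : Tendsto (fun t : ℝ => t ^ (1 - μ) * (‖a₀‖ + 1)) (𝓝[>] 0) (𝓝 (0 * (‖a₀‖ + 1))) :=
      (tendsto_weight hμ.2).mul_const _
    rw [zero_mul] at h1
    exact ((h1.eventually (Iic_mem_nhds hr0')).and (Ioc_mem_nhdsGT hr0')).exists
  have ht0 := ht.1
  have hG : ContinuousAt (fun a => A (emb j hμ a₀) a + vectorField hμ A F₁ F₂ a) a₀ := by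
    rw [ContinuousAt, tendsto_iff_norm_sub_tendsto_zero]
    have hlim : Tendsto (fun a => t ^ (μ - 1) * (1 * (t ^ (1 - μ) * ‖a - a₀‖
        + ‖emb j hμ (a - a₀)‖))) (𝓝 a₀) (𝓝 0) := by
      have hc : Continuous fun a => t ^ (μ - 1) * (1 * (t ^ (1 - μ) * ‖a - a₀‖
        + ‖emb j hμ (a - a₀)‖)) := by fun_prop
      simpa using hc.tendsto a₀
    refine squeeze_zero' (Eventually.of_forall fun _ => norm_nonneg _) ?_ hlim
    have hb1 : ∀ᶠ a in 𝓝 a₀, emb j hμ a ∈ Metric.closedBall (emb j hμ a₀) r :=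
      (emb j hμ).continuous.continuousAt.eventually (Metric.closedBall_mem_nhds _ hr0')
    filter_upwards [hb1, Metric.closedBall_mem_nhds a₀ one_pos] with a ha ha'
    have hw : 0 < t ^ (1 - μ) := by positivity
    rw [mem_closedBall_iff_norm] at ha'
    have hn : ‖a‖ ≤ ‖a₀‖ + 1 := by linarith [norm_le_norm_add_norm_sub' a a₀]
    have h3 := hr t ht a a₀ ha (Metric.mem_closedBall_self hr0'.le)
      (le_trans (by gcongr) ht1) (le_trans (by gcongr; linarith) ht1)
    have h4 := norm_le_of_weighted ht0 h3
    rw [mul_comm] at h4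
    exact h4
  have h := hG.sub ((A (emb j hμ a₀)).continuous.continuousAt (x := a₀))
  exact h.congr (Eventually.of_forall fun a => add_sub_cancel_left _ _)

theorem memBC_of_tendsto {E : Type*} [NormedAddCommGroup E] [NormedSpace ℝ E] {f : ℝ → E}
    (hμ : μ < 1) (hT : 0 < T) (hf : ContinuousOn f (Ioc 0 T))
    (h0 : Tendsto (fun t => t ^ (1 - μ) * ‖f t‖) (𝓝[>] 0) (𝓝 0)) : MemBC μ T f := by
  have h0' : Tendsto (fun t => t ^ (1 - μ) • f t) (𝓝[>] 0) (𝓝 0) := by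
    rw [tendsto_zero_iff_norm_tendsto_zero]
    refine h0.congr' ?_
    filter_upwards [self_mem_nhdsWithin] with t ht using (norm_weight_smul (le_of_lt ht) _).symm
  exact (memBC_iff hμ hT).mpr (continuousOn_weight_smul hμ hf h0')

theorem MemBC.tendsto_weight_mul_norm {E : Type*} [NormedAddCommGroup E] [NormedSpace ℝ E]
    {f : ℝ → E} (hf : MemBC μ T f) :
    Tendsto (fun t => t ^ (1 - μ) * ‖f t‖) (𝓝[>] 0) (𝓝 0) := by
  refine hf.tendsto_zero.congr' ?_
  filter_upwards [self_mem_nhdsWithin] with t ht using norm_weight_smul (le_of_lt ht) _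

/-- Only the decay of the weighted vector field at 0 needs an argument: its corrected form G is
compared with its value at a fixed vector of E₁, whose weighted norm decays because t^(1-μ) does. -/
theorem memBC_vectorField (hμ : μ ∈ Ioo (0 : ℝ) 1) (hV : IsOpen V)
    (h₁ : LipschitzHypothesis j μ V A F₁) (h₂ : StructuralHypothesis j μ V F₂) (hT : 0 < T)
    {x : InterpSpace j μ} (hx : x ∈ V) {v : ℝ → E₁} (hv : MemBC μ T v)
    (hvV : ∀ t ∈ Ioc 0 T, emb j hμ (v t) ∈ V)
    (hvx : Tendsto (fun t => emb j hμ (v t)) (𝓝[>] 0) (𝓝 x)) :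
    MemBC μ T fun t => vectorField hμ A F₁ F₂ (v t) := by
  set G : E₁ → E₀ := fun a => A x a + vectorField hμ A F₁ F₂ a with hGdef
  have hGc : ContinuousOn (fun t => G (v t)) (Ioc 0 T) := fun t ht => by
    have h3 : ContinuousAt G (v t) := ((A x).continuous.continuousAt).add
      (continuousAt_vectorField hμ hV h₁ h₂ (hvV t ht))
    exact h3.comp_continuousWithinAt (hv.continuousOn t ht)
  have hG : MemBC μ T fun t => G (v t) := by
    refine memBC_of_tendsto hμ.2 hT hGc ?_
    rw [Metric.tendsto_nhds]
    intro ε hε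
    obtain ⟨r, hr, hr0, hr1⟩ := ((eventually_vectorField_sub_le hμ hV h₁ h₂ hx
      (show 0 < ε / 8 by positivity)).and (Ioc_mem_nhdsGT one_pos)).exists
    have hev : ∀ᶠ t in 𝓝[>] (0 : ℝ), emb j hμ (v t) ∈ Metric.closedBall x r ∧
        t ^ (1 - μ) * ‖v t‖ ≤ r ∧ t ∈ Ioc 0 r :=
      (hvx.eventually (Metric.closedBall_mem_nhds x hr0)).and
        ((hv.tendsto_weight_mul_norm.eventually (Iic_mem_nhds hr0)).and (Ioc_mem_nhdsGT hr0))
    -- The comparison vector is v(b), since x need not lie in E₁. For t ≤ b the bound on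
    -- b^(1-μ)|v(b)| also bounds t^(1-μ)|v(b)|.
    obtain ⟨b, hb1, hb2, hb⟩ := hev.exists
    have hGb : ∀ᶠ t in 𝓝[>] (0 : ℝ), t ^ (1 - μ) * ‖G (v b)‖ < ε / 2 := by
      have h3 := (tendsto_weight hμ.2).mul_const ‖G (v b)‖
      rw [zero_mul] at h3
      exact h3.eventually (gt_mem_nhds (half_pos hε))
    filter_upwards [hev, hGb, Ioc_mem_nhdsGT hb.1] with t ⟨ht1, ht2, ht3⟩ ht4 ht5
    have ht0 := ht5.1
    have hw : 0 < t ^ (1 - μ) := by positivity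
    have hwb : t ^ (1 - μ) * ‖v b‖ ≤ r :=
      (mul_le_mul_of_nonneg_right (Real.rpow_le_rpow ht0.le ht5.2 (by linarith [hμ.2]))
        (norm_nonneg _)).trans hb2
    have h3 := hr t ht3 (v t) (v b) ht1 hb1 ht2 hwb
    have h4 : ‖emb j hμ (v t - v b)‖ ≤ r + r := by
      rw [map_sub, ← sub_sub_sub_cancel_right _ _ x]
      rw [mem_closedBall_iff_norm] at ht1 hb1
      exact (norm_sub_le _ _).trans (add_le_add ht1 hb1)
    have h5 : t ^ (1 - μ) * ‖v t - v b‖ ≤ r + r :=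
      calc _ ≤ t ^ (1 - μ) * (‖v t‖ + ‖v b‖) := by gcongr; exact norm_sub_le _ _
        _ ≤ r + r := by rw [mul_add]; exact add_le_add ht2 hwb
    have h6 : t ^ (1 - μ) * ‖G (v t)‖ ≤ t ^ (1 - μ) * ‖G (v b)‖
        + t ^ (1 - μ) * ‖G (v t) - G (v b)‖ := by
      rw [← mul_add]
      gcongr
      exact norm_le_norm_add_norm_sub' _ _
    have h7 : ε / 8 * (t ^ (1 - μ) * ‖v t - v b‖ + ‖emb j hμ (v t - v b)‖) ≤ ε / 8 * 4 := by
      gcongr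
      linarith
    rw [Real.dist_eq, sub_zero, abs_of_nonneg (by positivity)]
    have h8 : t ^ (1 - μ) * ‖G (v t) - G (v b)‖
      ≤ ε / 8 * (t ^ (1 - μ) * ‖v t - v b‖ + ‖emb j hμ (v t - v b)‖) := h3
    linarith
  refine (hG.sub hμ.2 hT (hv.clm hμ.2 hT (A x))).congr hμ.2 hT fun t _ => ?_
  simp only [hGdef, add_sub_cancel_left]

end Nonlinearity

/-! ### Integrated solutions: shifting, gluing and local uniqueness. -/

section LocalTheory

open MeasureTheory

variable {E₀ E₁ : Type*} [NormedAddCommGroup E₀] [NormedSpace ℝ E₀]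
  [NormedAddCommGroup E₁] [NormedSpace ℝ E₁] {j : E₁ →L[ℝ] E₀} {μ T : ℝ}
  {V : Set (InterpSpace j μ)} {A : InterpSpace j μ → E₁ →L[ℝ] E₀}
  {F₁ F₂ : InterpSpace j μ → E₀}

/-- `v` is the `E₁`-valued representative of a solution of the quasilinear problem on `[0,T]` with
initial value `x`, in integrated form. -/
structure IsMildSolution (hμ : μ ∈ Ioo (0 : ℝ) 1) (V : Set (InterpSpace j μ))
    (A : InterpSpace j μ → E₁ →L[ℝ] E₀) (F₁ F₂ : InterpSpace j μ → E₀) (T : ℝ)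
    (x : InterpSpace j μ) (v : ℝ → E₁) : Prop where
  memBC : MemBC μ T v
  memBC_vectorField : MemBC μ T fun t => vectorField hμ A F₁ F₂ (v t)
  mem : ∀ t ∈ Ioc 0 T, emb j hμ (v t) ∈ V
  eqn : ∀ t ∈ Ioc 0 T,
    j (v t) = InterpSpace.incl x + ∫ s in (0 : ℝ)..t, vectorField hμ A F₁ F₂ (v s)

variable {hμ : μ ∈ Ioo (0 : ℝ) 1} {x : InterpSpace j μ} {v w : ℝ → E₁}

theorem IsMildSolution.mono {S : ℝ} (h : IsMildSolution hμ V A F₁ F₂ T x v) (hS : S ≤ T) :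
    IsMildSolution hμ V A F₁ F₂ S x v :=
  ⟨h.memBC.mono hS, h.memBC_vectorField.mono hS,
    fun t ht => h.mem t (Ioc_subset_Ioc_right hS ht),
    fun t ht => h.eqn t (Ioc_subset_Ioc_right hS ht)⟩

theorem IsMildSolution.tendsto_emb (hT : 0 < T) (h : IsMildSolution hμ V A F₁ F₂ T x v) :
    Tendsto (fun t => emb j hμ (v t)) (𝓝[>] 0) (𝓝 x) :=
  QuasilinearSemiflow.tendsto_emb hμ hT h.memBC h.memBC_vectorField h.eqn

theorem IsMildSolution.isLinearSolution (B : E₁ →L[ℝ] E₀)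
    (h : IsMildSolution hμ V A F₁ F₂ T x v) :
    IsLinearSolution j μ B T (fun t => B (v t) + vectorField hμ A F₁ F₂ (v t)) x v := by
  refine ⟨h.memBC, fun t ht => ?_⟩
  simpa only [add_sub_cancel_left] using h.eqn t ht

theorem MemBC.shift {E : Type*} [NormedAddCommGroup E] [NormedSpace ℝ E] {f : ℝ → E} (hμ : μ < 1)
    {a : ℝ} (ha : a ∈ Ioo 0 T) (hf : MemBC μ T f) : MemBC μ (T - a) fun t => f (a + t) :=
  memBC_of_continuousOn hμ (sub_pos.mpr ha.2) <|
    hf.continuousOn.comp (continuous_const.add continuous_id).continuousOn fun t ht =>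
      ⟨by linarith [ht.1, ha.1], by linarith [ht.2]⟩

theorem IsMildSolution.shift {a : ℝ} (ha : a ∈ Ioo 0 T)
    (h : IsMildSolution hμ V A F₁ F₂ T x v) :
    IsMildSolution hμ V A F₁ F₂ (T - a) (emb j hμ (v a)) fun t => v (a + t) := by
  have hT : 0 < T := ha.1.trans ha.2
  have hmem : ∀ t ∈ Ioc 0 (T - a), a + t ∈ Ioc 0 T := fun t ht =>
    ⟨by linarith [ht.1, ha.1], by linarith [ht.2]⟩
  refine ⟨h.memBC.shift hμ.2 ha, h.memBC_vectorField.shift hμ.2 ha, fun t ht => h.mem _ (hmem t ht),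
    fun t ht => ?_⟩
  have hint : ∀ s ∈ Icc 0 T, ∀ r ∈ Icc 0 T, IntervalIntegrable
      (fun s => vectorField hμ A F₁ F₂ (v s)) volume s r := fun s hs r hr =>
    h.memBC_vectorField.intervalIntegrable hμ.1 hs hr
  rw [h.eqn _ (hmem t ht), incl_emb, h.eqn a ⟨ha.1, ha.2.le⟩, add_assoc,
    intervalIntegral.integral_comp_add_left (fun s => vectorField hμ A F₁ F₂ (v s)), add_zero,
    intervalIntegral.integral_add_adjacent_intervals]
  · exact hint 0 (left_mem_Icc.mpr hT.le) a ⟨ha.1.le, ha.2.le⟩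
  · exact hint a ⟨ha.1.le, ha.2.le⟩ _ (Ioc_subset_Icc_self (hmem t ht))

theorem MemBC.glue {E : Type*} [NormedAddCommGroup E] [NormedSpace ℝ E] (hμ : μ < 1) {b : ℝ}
    {f g : ℝ → E} (hb : b ∈ Ioc 0 T) (hf : MemBC μ b f) (hg : ContinuousOn g (Icc b T))
    (hfg : f b = g b) : MemBC μ T fun t => if t ≤ b then f t else g t := by
  have hT := hb.1.trans_le hb.2
  rw [memBC_iff hμ hT, ← Icc_union_Icc_eq_Icc hb.1.le hb.2]
  refine ContinuousOn.union_of_isClosed ?_ ?_ isClosed_Icc isClosed_Icc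
  · refine ((memBC_iff hμ hb.1).mp hf).congr fun t ht => ?_
    simp only [if_pos ht.2]
  · refine ((continuous_weight hμ).continuousOn.fun_smul hg).congr fun t ht => ?_
    rcases ht.1.eq_or_lt with rfl | h
    · simp only [le_refl, if_true, hfg]
    · simp only [if_neg h.not_ge]

/-- The second solution starts at a, but the switch is made at b > a. Near its starting time a
solution is controlled in E₁ only with a weight, so a direct concatenation at a would leave
E₁-continuity unproved; on the overlap both pieces agree and are continuous at b. -/
theorem IsMildSolution.glue {a b d : ℝ} (ha : 0 < a) (hab : a < b) (hbd : b ≤ a + d)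
    (hv : IsMildSolution hμ V A F₁ F₂ b x v)
    (hw : IsMildSolution hμ V A F₁ F₂ d (emb j hμ (v a)) w)
    (hvw : ∀ t ∈ Ioc 0 (b - a), w t = v (a + t)) :
    IsMildSolution hμ V A F₁ F₂ (a + d) x fun t => if t ≤ b then v t else w (t - a) := by
  set y : ℝ → E₁ := fun t => if t ≤ b then v t else w (t - a) with hy
  have hb : b ∈ Ioc 0 (a + d) := ⟨ha.trans hab, hbd⟩
  have hyv : ∀ t ≤ b, y t = v t := fun t ht => if_pos ht
  have hyw : ∀ t > a, y t = w (t - a) := fun t ht => by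
    rcases le_or_gt t b with h | h
    · rw [hyv t h, hvw (t - a) ⟨by linarith, by linarith⟩, add_sub_cancel]
    · exact if_neg h.not_ge
  have hsub : ∀ t ∈ Ioc a (a + d), t - a ∈ Ioc 0 d := fun t ht =>
    ⟨by linarith [ht.1], by linarith [ht.2]⟩
  have hcont : ContinuousOn (fun t => t - a) (Icc b (a + d)) :=
    (continuous_id.sub continuous_const).continuousOn
  have hmaps : MapsTo (fun t => t - a) (Icc b (a + d)) (Ioc 0 d) := fun t ht =>
    hsub t ⟨hab.trans_le ht.1, ht.2⟩
  have hvb : v b = w (b - a) := by rw [← hyv b le_rfl, hyw b hab]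
  have hN : MemBC μ (a + d) fun t => vectorField hμ A F₁ F₂ (y t) := by
    refine (MemBC.glue hμ.2 hb hv.memBC_vectorField
      (hw.memBC_vectorField.continuousOn.comp hcont hmaps)
      (congrArg (vectorField hμ A F₁ F₂) hvb)).congr hμ.2 (hb.1.trans_le hb.2) fun t _ => ?_
    simp only [hy]
    split_ifs <;> rfl
  refine ⟨MemBC.glue hμ.2 hb hv.memBC (hw.memBC.continuousOn.comp hcont hmaps) hvb, hN, fun t ht => ?_,
    fun t ht => ?_⟩
  · rcases le_or_gt t a with h | h
    · rw [hyv t (h.trans hab.le)]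
      exact hv.mem t ⟨ht.1, h.trans hab.le⟩
    · rw [hyw t h]
      exact hw.mem _ (hsub t ⟨h, ht.2⟩)
  · have hle : ∀ r ∈ Ioc 0 b, ∫ s in (0 : ℝ)..r, vectorField hμ A F₁ F₂ (y s)
        = ∫ s in (0 : ℝ)..r, vectorField hμ A F₁ F₂ (v s) := fun r hr =>
      integral_congr_Ioc hr.1.le fun s hs => by simp only [hyv s (hs.2.trans hr.2)]
    rcases le_or_gt t a with h | h
    · have htb : t ∈ Ioc 0 b := ⟨ht.1, h.trans hab.le⟩
      rw [hyv t htb.2, hv.eqn t htb, hle t htb]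
    · have hta := hsub t ⟨h, ht.2⟩
      have ha0 : a ∈ Icc 0 (a + d) := ⟨ha.le, h.le.trans ht.2⟩
      rw [← intervalIntegral.integral_add_adjacent_intervals
        (hN.intervalIntegrable hμ.1 (left_mem_Icc.mpr (hb.1.trans_le hb.2).le) ha0)
        (hN.intervalIntegrable hμ.1 ha0 (Ioc_subset_Icc_self ht)), hle a ⟨ha, hab.le⟩,
        ← add_assoc, ← hv.eqn a ⟨ha, hab.le⟩, hyw t h, hw.eqn _ hta, incl_emb]
      congr 1
      rw [integral_congr_Ioc h.le (g := fun s => vectorField hμ A F₁ F₂ (w (s - a)))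
        fun s hs => by simp only [hyw s hs.1],
        intervalIntegral.integral_comp_sub_right (fun s => vectorField hμ A F₁ F₂ (w s)), sub_self]

variable [CompleteSpace E₀] [CompleteSpace E₁]

/-- The difference of two solutions solves the linear problem with operator A(x), zero initial value
and right-hand side f = G(v) − G(w). If F is the maximum of the weighted norm of f, the linear
estimate bounds v − w by M F, and the contraction constant 1/(2M) returns F ≤ F/2. -/
theorem IsMildSolution.exists_eqOn (hj : Function.Injective j) (hV : IsOpen V)
    (h₁ : LipschitzHypothesis j μ V A F₁) (h₂ : StructuralHypothesis j μ V F₂) (hx : x ∈ V)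
    (hT : 0 < T) (hv : IsMildSolution hμ V A F₁ F₂ T x v)
    (hw : IsMildSolution hμ V A F₁ F₂ T x w) : ∃ δ ∈ Ioc 0 T, EqOn v w (Ioc 0 δ) := by
  obtain ⟨T₀, hT₀, M, hM, -, hest⟩ := (h₁.maxReg x hx).exists_estimate hj hμ
  have hη : 0 < 1 / (2 * M) := by positivity
  obtain ⟨r, hr, hr0⟩ := ((eventually_vectorField_sub_le hμ hV h₁ h₂ hx hη).and
    self_mem_nhdsWithin).exists
  have hr0' : 0 < r := hr0
  have hev : ∀ᶠ t in 𝓝[>] (0 : ℝ), emb j hμ (v t) ∈ Metric.closedBall x r ∧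
      emb j hμ (w t) ∈ Metric.closedBall x r ∧ t ^ (1 - μ) * ‖v t‖ ≤ r ∧
      t ^ (1 - μ) * ‖w t‖ ≤ r ∧ t ∈ Ioc 0 r ∧ t ∈ Ioc 0 T₀ ∧ t ∈ Ioc 0 T :=
    ((hv.tendsto_emb hT).eventually (Metric.closedBall_mem_nhds x hr0')).and <|
    ((hw.tendsto_emb hT).eventually (Metric.closedBall_mem_nhds x hr0')).and <|
    (hv.memBC.tendsto_weight_mul_norm.eventually (Iic_mem_nhds hr0')).and <|
    (hw.memBC.tendsto_weight_mul_norm.eventually (Iic_mem_nhds hr0')).and <|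
    inter_mem (Ioc_mem_nhdsGT hr0') <| inter_mem (Ioc_mem_nhdsGT hT₀) (Ioc_mem_nhdsGT hT)
  obtain ⟨δ, hδ0, hδ⟩ := mem_nhdsGT_iff_exists_Ioc_subset.mp hev
  have hδ0' : 0 < δ := hδ0
  obtain ⟨-, -, -, -, -, hδT₀, hδT⟩ := hδ (right_mem_Ioc.mpr hδ0')
  set B := A x
  have hmf : ∀ {y : ℝ → E₁}, IsMildSolution hμ V A F₁ F₂ δ x y →
      MemBC μ δ fun t => B (y t) + vectorField hμ A F₁ F₂ (y t) := fun h =>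
    (h.memBC.clm hμ.2 hδ0' B).add hμ.2 hδ0' h.memBC_vectorField
  have hvδ := hv.mono hδT.2
  have hwδ := hw.mono hδT.2
  have hlin := (hvδ.isLinearSolution B).sub hμ hδ0' (hmf hvδ) (hmf hwδ) (hwδ.isLinearSolution B)
  have hf := (hmf hvδ).sub hμ.2 hδ0' (hmf hwδ)
  rw [sub_self] at hlin
  set f : ℝ → E₀ := fun t => (B (v t) + vectorField hμ A F₁ F₂ (v t))
    - (B (w t) + vectorField hμ A F₁ F₂ (w t)) with hfdef
  obtain ⟨t₀, ht₀, hmax⟩ := isCompact_Icc.exists_isMaxOn (nonempty_Icc.mpr hδ0'.le)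
    ((memBC_iff hμ.2 hδ0').mp hf).norm
  set F := ‖t₀ ^ (1 - μ) • f t₀‖ with hF
  have hfF : ∀ t ∈ Ioc 0 δ, t ^ (1 - μ) * ‖f t‖ ≤ F := fun t ht => by
    rw [← norm_weight_smul ht.1.le]
    exact hmax (Ioc_subset_Icc_self ht)
  have hD := hest δ hδT₀ f 0 (fun t => v t - w t) F hf hlin hfF
  rw [norm_zero, add_zero] at hD
  have hF0 : F ≤ 0 := by
    rcases ht₀.1.eq_or_lt with h0 | h0
    · rw [hF, ← h0, Real.zero_rpow (by linarith [hμ.2]), zero_smul, norm_zero]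
    · have ht₀' : t₀ ∈ Ioc 0 δ := ⟨h0, ht₀.2⟩
      obtain ⟨h3, h4, h5, h6, h7, -, -⟩ := hδ ht₀'
      have h8 := hr t₀ h7 (v t₀) (w t₀) h3 h4 h5 h6
      have h9 := hD t₀ ht₀'
      have h10 : 0 ≤ t₀ ^ (1 - μ) * ‖f t₀ - B (v t₀ - w t₀)‖ := by positivity
      have h11 : F ≤ 1 / (2 * M) * (M * F) := by
        rw [hF, norm_weight_smul h0.le, ← norm_weight_smul (E := E₀) h0.le, ← hF]
        refine (le_of_eq (norm_weight_smul h0.le _)).trans (h8.trans ?_)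
        gcongr
        linarith
      have h12 : 1 / (2 * M) * (M * F) = F / 2 := by
        have : M ≠ 0 := by positivity
        field_simp
      linarith
  refine ⟨δ, hδT, fun t ht => ?_⟩
  have h3 := hD t ht
  have ht0 := ht.1
  have h4 : M * F ≤ 0 := mul_nonpos_of_nonneg_of_nonpos (by linarith) hF0
  have h5 : 0 ≤ t ^ (1 - μ) * ‖f t - B (v t - w t)‖ := by positivity
  have h6 := norm_nonneg (emb j hμ (v t - w t))
  have h7 : 0 < t ^ (1 - μ) := by positivity
  have h8 : ‖v t - w t‖ ≤ 0 := by
    by_contra hcon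
    have := mul_pos h7 (not_le.mp hcon)
    linarith
  exact sub_eq_zero.mp (norm_le_zero_iff.mp h8)

end LocalTheory

/-! ### Local existence by contraction. -/

section LocalExistence

open MeasureTheory

variable {E₀ E₁ : Type*} [NormedAddCommGroup E₀] [NormedSpace ℝ E₀] [CompleteSpace E₀]
  [NormedAddCommGroup E₁] [NormedSpace ℝ E₁] [CompleteSpace E₁] {j : E₁ →L[ℝ] E₀} {μ : ℝ}
  {V : Set (InterpSpace j μ)} {A : InterpSpace j μ → E₁ →L[ℝ] E₀}
  {F₁ F₂ : InterpSpace j μ → E₀} {hμ : μ ∈ Ioo (0 : ℝ) 1}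

/-- Given a family of maps of the ball of radius `ρ` in the space of continuous functions on
`[0,T]` vanishing at `0`, each map a contraction and the family Lipschitz in the parameter, there
are fixed points that depend on the parameter in a Lipschitz way. -/
theorem exists_fixedPoint_lipschitz {X E : Type*} [NormedAddCommGroup X]
    [NormedAddCommGroup E] [CompleteSpace E] {T ρ : ℝ} (hT : 0 ≤ T) (hρ : 0 ≤ ρ) {s : Set X}
    (Φ : X → C(Icc 0 T, E) → C(Icc 0 T, E))
    (hmaps : ∀ x ∈ s, ∀ φ : C(Icc 0 T, E), φ ⟨0, left_mem_Icc.mpr hT⟩ = 0 → ‖φ‖ ≤ ρ →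
      Φ x φ ⟨0, left_mem_Icc.mpr hT⟩ = 0 ∧ ‖Φ x φ‖ ≤ ρ)
    (hlip : ∀ x ∈ s, ∀ y ∈ s, ∀ φ ψ : C(Icc 0 T, E), φ ⟨0, left_mem_Icc.mpr hT⟩ = 0 →
      ψ ⟨0, left_mem_Icc.mpr hT⟩ = 0 → ‖φ‖ ≤ ρ → ‖ψ‖ ≤ ρ →
      ‖Φ x φ - Φ y ψ‖ ≤ 1 / 2 * (‖φ - ψ‖ + ‖x - y‖)) :
    ∃ Ψ : X → C(Icc 0 T, E),
      (∀ x ∈ s, Ψ x ⟨0, left_mem_Icc.mpr hT⟩ = 0 ∧ ‖Ψ x‖ ≤ ρ ∧ Φ x (Ψ x) = Ψ x) ∧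
      ∀ x ∈ s, ∀ y ∈ s, ‖Ψ x - Ψ y‖ ≤ ‖x - y‖ := by
  set S : Set C(Icc 0 T, E) := {φ | φ ⟨0, left_mem_Icc.mpr hT⟩ = 0 ∧ ‖φ‖ ≤ ρ} with hS
  have hSc : IsComplete S := by
    refine IsClosed.isComplete (IsClosed.and ?_ ?_)
    · exact isClosed_singleton.preimage (continuous_eval_const _)
    · exact isClosed_le continuous_norm continuous_const
  have hfix : ∀ x ∈ s, ∃ φ ∈ S, Φ x φ = φ := by
    intro x hx
    have hm : MapsTo (Φ x) S S := fun φ hφ => hmaps x hx φ hφ.1 hφ.2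
    have hc : ContractingWith (1 / 2) (hm.restrict (Φ x) S S) := by
      refine ⟨by rw [← NNReal.coe_lt_coe]; norm_num, LipschitzWith.of_dist_le_mul ?_⟩
      rintro ⟨φ, hφ⟩ ⟨ψ, hψ⟩
      have := hlip x hx x hx φ ψ hφ.1 hψ.1 hφ.2 hψ.2
      rw [sub_self, norm_zero, add_zero] at this
      rw [Subtype.dist_eq, Subtype.dist_eq, dist_eq_norm, dist_eq_norm]
      simpa using this
    obtain ⟨φ, hφ, hfix, -⟩ := hc.exists_fixedPoint' hSc hm (x := 0)
      ⟨rfl, by rwa [norm_zero]⟩ (edist_ne_top _ _)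
    exact ⟨φ, hφ, hfix⟩
  choose! Ψ hΨS hΨ using hfix
  refine ⟨Ψ, fun x hx => ⟨(hΨS x hx).1, (hΨS x hx).2, hΨ x hx⟩, fun x hx y hy => ?_⟩
  have h := hlip x hx y hy (Ψ x) (Ψ y) (hΨS x hx).1 (hΨS y hy).1 (hΨS x hx).2 (hΨS y hy).2
  rw [hΨ x hx, hΨ y hy] at h
  linarith

/-- Local existence, with a uniform interval of existence and Lipschitz dependence on the initial
value. -/
theorem exists_local_solution (hj : Function.Injective j) (hV : IsOpen V)
    (h₁ : LipschitzHypothesis j μ V A F₁) (h₂ : StructuralHypothesis j μ V F₂)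
    {x₀ : InterpSpace j μ} (hx₀ : x₀ ∈ V) :
    ∃ τ > 0, ∃ ε > 0, ∃ K > 0, Metric.closedBall x₀ ε ⊆ V ∧
      ∃ S : InterpSpace j μ → ℝ → E₁,
        (∀ x ∈ Metric.closedBall x₀ ε, IsMildSolution hμ V A F₁ F₂ τ x (S x)) ∧
        ∀ x ∈ Metric.closedBall x₀ ε, ∀ y ∈ Metric.closedBall x₀ ε, ∀ t ∈ Ioc 0 τ,
          t ^ (1 - μ) * ‖S x t - S y t‖
            + t ^ (1 - μ) * ‖vectorField hμ A F₁ F₂ (S x t) - vectorField hμ A F₁ F₂ (S y t)‖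
            + ‖emb j hμ (S x t - S y t)‖ ≤ K * ‖x - y‖ := by
  obtain ⟨T, hT, M, hM, hex, hest⟩ := (h₁.maxReg x₀ hx₀).exists_estimate hj hμ
  choose! L hL using hex
  set B := A x₀
  have hM0 : 0 < M := by linarith
  obtain ⟨r, ⟨hr, hballV⟩, hr0⟩ := ((eventually_vectorField_sub_le hμ hV h₁ h₂ hx₀
    (show 0 < 1 / (4 * M) by positivity)).and
      (eventually_closedBall_subset (hV.mem_nhds hx₀))).and self_mem_nhdsWithin |>.exists
  have hr0' : 0 < r := hr0
  set G : E₁ → E₀ := fun a => B a + vectorField hμ A F₁ F₂ a with hG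
  -- Data within ρ of the reference data move the linear solution by at most M(ρ + ρ) = r/2; the
  -- other r/2 is reserved for the reference solution.
  set ρ := r / (4 * M) with hρdef
  have hρ : 0 < ρ := by positivity
  have hρr : ρ ≤ r := by
    rw [hρdef, div_le_iff₀ (by positivity)]
    nlinarith
  have hMρ : M * (ρ + ρ) = r / 2 := by rw [hρdef]; field_simp; norm_num
  have hun : ∀ φ : C(Icc 0 T, E₀), φ ⟨0, left_mem_Icc.mpr hT.le⟩ = 0 →
      MemBC μ T (unweight μ hT.le φ) := fun φ h0 => memBC_unweight hμ.2 hT hT φ.continuous h0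
  -- The unknown of the fixed point problem is the weighted right-hand side φ, not the solution. The
  -- ball of admissible φ is then independent of the initial value x, which enters only through the
  -- linear solution.
  set v : C(Icc 0 T, E₀) → InterpSpace j μ → ℝ → E₁ := fun φ x => L (unweight μ hT.le φ) x with hv
  have hvsol : ∀ φ : C(Icc 0 T, E₀), φ ⟨0, left_mem_Icc.mpr hT.le⟩ = 0 → ∀ x,
      IsLinearSolution j μ B T (unweight μ hT.le φ) x (v φ x) := fun φ h0 x => hL _ (hun φ h0) x
  have hvdiff : ∀ φ ψ : C(Icc 0 T, E₀), φ ⟨0, left_mem_Icc.mpr hT.le⟩ = 0 →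
      ψ ⟨0, left_mem_Icc.mpr hT.le⟩ = 0 → ∀ x y, ∀ t ∈ Ioc 0 T,
      t ^ (1 - μ) * ‖v φ x t - v ψ y t‖
        + t ^ (1 - μ) * ‖(unweight μ hT.le φ t - unweight μ hT.le ψ t) - B (v φ x t - v ψ y t)‖
        + ‖emb j hμ (v φ x t - v ψ y t)‖ ≤ M * (‖φ - ψ‖ + ‖x - y‖) := by
    intro φ ψ hφ hψ x y
    refine hest T ⟨hT, le_rfl⟩ _ (x - y) _ ‖φ - ψ‖ ((hun φ hφ).sub hμ.2 hT (hun ψ hψ))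
      ((hvsol φ hφ x).sub hμ hT (hun φ hφ) (hun ψ hψ) (hvsol ψ hψ y)) fun t ht => ?_
    have h := weight_norm_unweight_le (μ := μ) hT.le (φ - ψ) ht.1
    simpa only [unweight, ContinuousMap.coe_sub, Pi.sub_apply, smul_sub] using h
  have hvemb : ∀ φ : C(Icc 0 T, E₀), φ ⟨0, left_mem_Icc.mpr hT.le⟩ = 0 → ∀ x,
      Tendsto (fun t => emb j hμ (v φ x t)) (𝓝[>] 0) (𝓝 x) := fun φ h0 x =>
    tendsto_emb hμ hT (hvsol φ h0 x).memBC
      ((hun φ h0).sub hμ.2 hT ((hvsol φ h0 x).memBC.clm hμ.2 hT B)) (hvsol φ h0 x).eqn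
  -- Reference solution with zero right-hand side: the times δ and τ are fixed by it alone, hence
  -- are common to all nearby initial values.
  set u := v 0 x₀ with hu
  have husol := hvsol 0 rfl x₀
  obtain ⟨δ, hδ0, hδ⟩ : ∃ δ > 0, ∀ t ∈ Ioc 0 δ, emb j hμ (u t) ∈ Metric.closedBall x₀ (r / 2) ∧
      t ^ (1 - μ) * ‖u t‖ ≤ r / 2 ∧ t ∈ Ioc 0 r ∧ t ∈ Ioc 0 T := by
    have hev : ∀ᶠ t in 𝓝[>] (0 : ℝ), emb j hμ (u t) ∈ Metric.closedBall x₀ (r / 2) ∧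
        t ^ (1 - μ) * ‖u t‖ ≤ r / 2 ∧ t ∈ Ioc 0 r ∧ t ∈ Ioc 0 T :=
      ((hvemb 0 rfl x₀).eventually (Metric.closedBall_mem_nhds x₀ (half_pos hr0'))).and <|
      (husol.memBC.tendsto_weight_mul_norm.eventually (Iic_mem_nhds (half_pos hr0'))).and <|
      inter_mem (Ioc_mem_nhdsGT hr0') (Ioc_mem_nhdsGT hT)
    obtain ⟨δ, hδ0, hδ⟩ := mem_nhdsGT_iff_exists_Ioc_subset.mp hev
    exact ⟨δ, hδ0, hδ⟩
  have hmemG : ∀ {S : ℝ}, 0 < S → S ≤ T → ∀ {x : InterpSpace j μ} {φ : C(Icc 0 T, E₀)}, x ∈ V →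
      φ ⟨0, left_mem_Icc.mpr hT.le⟩ = 0 → (∀ t ∈ Ioc 0 S, emb j hμ (v φ x t) ∈ V) →
      MemBC μ S (fun t => vectorField hμ A F₁ F₂ (v φ x t)) ∧ MemBC μ S fun t => G (v φ x t) := by
    intro S hS0 hST x φ hx h0 hmem
    have hvS := (hvsol φ h0 x).memBC.mono hST
    have h := memBC_vectorField hμ hV h₁ h₂ hS0 hx hvS hmem (hvemb φ h0 x)
    exact ⟨h, (hvS.clm hμ.2 hS0 B).add hμ.2 hS0 h⟩
  -- The share ρ/2, with (ρ + ρ)/4 from the Lipschitz bound, makes the ball of radius ρ invariant.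
  obtain ⟨τ, hτ0, hτ⟩ : ∃ τ > 0, ∀ t ∈ Ioc 0 τ, t ^ (1 - μ) * ‖G (u t)‖ ≤ ρ / 2 ∧ t ∈ Ioc 0 δ := by
    have hGu := (hmemG hδ0 (hδ δ (right_mem_Ioc.mpr hδ0)).2.2.2.2 hx₀ (φ := 0) rfl
      fun t ht => hballV (Metric.closedBall_subset_closedBall (by linarith) (hδ t ht).1)).2
    have hev : ∀ᶠ t in 𝓝[>] (0 : ℝ), t ^ (1 - μ) * ‖G (u t)‖ ≤ ρ / 2 ∧ t ∈ Ioc 0 δ :=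
      (hGu.tendsto_weight_mul_norm.eventually (Iic_mem_nhds (half_pos hρ))).and
        (Ioc_mem_nhdsGT hδ0)
    obtain ⟨τ, hτ0, hτ⟩ := mem_nhdsGT_iff_exists_Ioc_subset.mp hev
    exact ⟨τ, hτ0, hτ⟩
  have hτT : ∀ t ∈ Ioc 0 τ, t ∈ Ioc 0 T := fun t ht => (hδ t (hτ t ht).2).2.2.2
  have hτT' : τ ≤ T := (hτT τ (right_mem_Ioc.mpr hτ0)).2
  have hball : ∀ x ∈ Metric.closedBall x₀ ρ, ∀ φ : C(Icc 0 T, E₀),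
      φ ⟨0, left_mem_Icc.mpr hT.le⟩ = 0 → ‖φ‖ ≤ ρ → ∀ t ∈ Ioc 0 τ,
      emb j hμ (v φ x t) ∈ Metric.closedBall x₀ r ∧ t ^ (1 - μ) * ‖v φ x t‖ ≤ r := by
    intro x hx φ h0 hφ t ht
    have ht0 := ht.1
    have h3 := hvdiff φ 0 h0 rfl x x₀ t (hτT t ht)
    rw [sub_zero] at h3
    rw [mem_closedBall_iff_norm] at hx
    have h4 : M * (‖φ‖ + ‖x - x₀‖) ≤ M * (ρ + ρ) := by gcongr
    have h5 : 0 ≤ t ^ (1 - μ) * ‖v φ x t - u t‖ := by positivity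
    have h6 : 0 ≤ t ^ (1 - μ) * ‖(unweight μ hT.le φ t - unweight μ hT.le
      (0 : C(Icc 0 T, E₀)) t) - B (v φ x t - u t)‖ := by positivity
    have h7 := norm_nonneg (emb j hμ (v φ x t - u t))
    obtain ⟨h8, h9, -, -⟩ := hδ t (hτ t ht).2
    rw [mem_closedBall_iff_norm] at h8 ⊢
    constructor
    · have h10 : emb j hμ (v φ x t) - x₀ = emb j hμ (v φ x t - u t) + (emb j hμ (u t) - x₀) := by
        rw [map_sub]; abel
      rw [h10]
      exact (norm_add_le _ _).trans (by linarith)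
    · have h10 : t ^ (1 - μ) * ‖v φ x t‖
          ≤ t ^ (1 - μ) * ‖u t‖ + t ^ (1 - μ) * ‖v φ x t - u t‖ := by
        rw [← mul_add]
        gcongr
        exact norm_le_norm_add_norm_sub' _ _
      linarith
  have hGdiff : ∀ x ∈ Metric.closedBall x₀ ρ, ∀ y ∈ Metric.closedBall x₀ ρ,
      ∀ φ ψ : C(Icc 0 T, E₀), φ ⟨0, left_mem_Icc.mpr hT.le⟩ = 0 →
      ψ ⟨0, left_mem_Icc.mpr hT.le⟩ = 0 → ‖φ‖ ≤ ρ → ‖ψ‖ ≤ ρ → ∀ t ∈ Ioc 0 τ,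
      t ^ (1 - μ) * ‖G (v φ x t) - G (v ψ y t)‖ ≤ 1 / 4 * (‖φ - ψ‖ + ‖x - y‖) := by
    intro x hx y hy φ ψ hφ0 hψ0 hφ hψ t ht
    have ht0 := ht.1
    obtain ⟨h3, h4⟩ := hball x hx φ hφ0 hφ t ht
    obtain ⟨h5, h6⟩ := hball y hy ψ hψ0 hψ t ht
    have h7 := hvdiff φ ψ hφ0 hψ0 x y t (hτT t ht)
    have h8 : 0 ≤ t ^ (1 - μ) * ‖(unweight μ hT.le φ t - unweight μ hT.le ψ t)
      - B (v φ x t - v ψ y t)‖ := by positivity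
    refine (hr t (hδ t (hτ t ht).2).2.2.1 _ _ h3 h5 h4 h6).trans ?_
    calc 1 / (4 * M) * (t ^ (1 - μ) * ‖v φ x t - v ψ y t‖ + ‖emb j hμ (v φ x t - v ψ y t)‖)
        ≤ 1 / (4 * M) * (M * (‖φ - ψ‖ + ‖x - y‖)) := by
          gcongr
          linarith
      _ = 1 / 4 * (‖φ - ψ‖ + ‖x - y‖) := by field_simp
  have hGnorm : ∀ x ∈ Metric.closedBall x₀ ρ, ∀ φ : C(Icc 0 T, E₀),
      φ ⟨0, left_mem_Icc.mpr hT.le⟩ = 0 → ‖φ‖ ≤ ρ → ∀ t ∈ Ioc 0 τ,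
      t ^ (1 - μ) * ‖G (v φ x t)‖ ≤ ρ := by
    intro x hx φ h0 hφ t ht
    have ht0 := ht.1
    have h3 := hGdiff x hx x₀ (Metric.mem_closedBall_self hρ.le) φ 0 h0 rfl hφ
      (by rw [norm_zero]; exact hρ.le) t ht
    rw [sub_zero] at h3
    rw [mem_closedBall_iff_norm] at hx
    have h4 := (hτ t ht).1
    have h5 : t ^ (1 - μ) * ‖G (v φ x t)‖
        ≤ t ^ (1 - μ) * ‖G (u t)‖ + t ^ (1 - μ) * ‖G (v φ x t) - G (u t)‖ := by
      rw [← mul_add]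
      gcongr
      exact norm_le_norm_add_norm_sub' _ _
    have h6 : t ^ (1 - μ) * ‖G (v φ x t) - G (u t)‖ ≤ 1 / 4 * (‖φ‖ + ‖x - x₀‖) := h3
    linarith
  have hmemV : ∀ x ∈ Metric.closedBall x₀ ρ, ∀ φ : C(Icc 0 T, E₀),
      φ ⟨0, left_mem_Icc.mpr hT.le⟩ = 0 → ‖φ‖ ≤ ρ →
      MemBC μ τ (fun t => vectorField hμ A F₁ F₂ (v φ x t)) ∧ MemBC μ τ fun t => G (v φ x t) :=
    fun x hx φ h0 hφ => hmemG hτ0 hτT' (hballV (Metric.closedBall_subset_closedBall hρr hx)) h0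
      fun t ht => hballV (hball x hx φ h0 hφ t ht).1
  have hmin : ∀ s ∈ Icc 0 T, min s τ ∈ Icc 0 τ := fun s hs =>
    ⟨le_min hs.1 hτ0.le, min_le_right _ _⟩
  -- The estimates hold only up to τ, while the linear solver lives on [0,T]. Freezing the weighted
  -- value at min s τ keeps the map inside functions on [0,T] with the same bounds.
  have hΦex : ∀ (x : InterpSpace j μ) (φ : C(Icc 0 T, E₀)), ∃ ξ : C(Icc 0 T, E₀),
      x ∈ Metric.closedBall x₀ ρ → φ ⟨0, left_mem_Icc.mpr hT.le⟩ = 0 → ‖φ‖ ≤ ρ →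
      ∀ s : Icc 0 T, ξ s = (min (s : ℝ) τ) ^ (1 - μ) • G (v φ x (min s τ)) := by
    intro x φ
    by_cases h : x ∈ Metric.closedBall x₀ ρ ∧ φ ⟨0, left_mem_Icc.mpr hT.le⟩ = 0 ∧ ‖φ‖ ≤ ρ
    · have hc := (memBC_iff hμ.2 hτ0).mp (hmemV x h.1 φ h.2.1 h.2.2).2
      exact ⟨⟨_, hc.comp_continuous (continuous_subtype_val.min continuous_const)
        fun s => hmin s s.2⟩, fun _ _ _ _ => rfl⟩
    · exact ⟨0, fun h3 h4 h5 => absurd ⟨h3, h4, h5⟩ h⟩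
  choose Φ hΦ using hΦex
  have hmin0 : min (0 : ℝ) τ = 0 := min_eq_left hτ0.le
  have hw0 : (0 : ℝ) ^ (1 - μ) = 0 := Real.zero_rpow (by linarith [hμ.2])
  obtain ⟨Ψ, hΨ, hΨlip⟩ := exists_fixedPoint_lipschitz (s := Metric.closedBall x₀ ρ) hT.le hρ.le Φ
    (fun x hx φ h0 hφ => by
      refine ⟨?_, (ContinuousMap.norm_le _ hρ.le).mpr fun s => ?_⟩
      · rw [hΦ x φ hx h0 hφ]
        simp only [hmin0, hw0, zero_smul]
      · rw [hΦ x φ hx h0 hφ, norm_weight_smul (hmin s s.2).1]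
        rcases (hmin s s.2).1.eq_or_lt with h | h
        · rw [← h, hw0, zero_mul]
          exact hρ.le
        · exact hGnorm x hx φ h0 hφ _ ⟨h, min_le_right _ _⟩)
    (fun x hx y hy φ ψ hφ0 hψ0 hφ hψ => by
      have hnn : 0 ≤ ‖φ - ψ‖ + ‖x - y‖ := by positivity
      refine (ContinuousMap.norm_le _ (by positivity)).mpr fun s => ?_
      rw [ContinuousMap.sub_apply, hΦ x φ hx hφ0 hφ, hΦ y ψ hy hψ0 hψ, ← smul_sub,
        norm_weight_smul (hmin s s.2).1]
      rcases (hmin s s.2).1.eq_or_lt with h | h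
      · rw [← h, hw0, zero_mul]
        positivity
      · refine (hGdiff x hx y hy φ ψ hφ0 hψ0 hφ hψ _ ⟨h, min_le_right _ _⟩).trans ?_
        linarith)
  have hΨG : ∀ x ∈ Metric.closedBall x₀ ρ, ∀ t ∈ Ioc 0 τ,
      unweight μ hT.le (Ψ x) t = G (v (Ψ x) x t) := by
    intro x hx t ht
    obtain ⟨h3, h4, h5⟩ := hΨ x hx
    have htT := Ioc_subset_Icc_self (hτT t ht)
    have h6 : Ψ x ⟨t, htT⟩ = t ^ (1 - μ) • G (v (Ψ x) x t) := by
      conv_lhs => rw [← h5]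
      rw [hΦ x (Ψ x) hx h3 h4]
      simp only [min_eq_left ht.2]
    rw [unweight, projIcc_of_mem hT.le htT, h6, smul_smul, mul_comm, rpow_weight_mul_inv ht.1,
      one_smul]
  have hΨN : ∀ x ∈ Metric.closedBall x₀ ρ, ∀ t ∈ Ioc 0 τ,
      unweight μ hT.le (Ψ x) t - B (v (Ψ x) x t) = vectorField hμ A F₁ F₂ (v (Ψ x) x t) := by
    intro x hx t ht
    rw [hΨG x hx t ht, hG, add_sub_cancel_left]
  -- The factor 2 arises because the fixed points satisfy ‖Ψ x − Ψ y‖ ≤ ‖x − y‖, so the data differ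
  -- by at most 2‖x − y‖ in total.
  refine ⟨τ, hτ0, ρ, hρ, 2 * M, by positivity,
    (Metric.closedBall_subset_closedBall hρr).trans hballV, fun x => v (Ψ x) x, fun x hx => ?_,
    fun x hx y hy t ht => ?_⟩
  · obtain ⟨h3, h4, -⟩ := hΨ x hx
    refine ⟨(hvsol _ h3 x).memBC.mono hτT', (hmemV x hx _ h3 h4).1,
      fun t ht => hballV (hball x hx _ h3 h4 t ht).1, fun t ht => ?_⟩
    rw [(hvsol _ h3 x).eqn t (hτT t ht)]
    congr 1
    exact integral_congr_Ioc ht.1.le fun s hs => hΨN x hx s ⟨hs.1, hs.2.trans ht.2⟩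
  · have h3 := hvdiff _ _ (hΨ x hx).1 (hΨ y hy).1 x y t (hτT t ht)
    have h4 : (unweight μ hT.le (Ψ x) t - unweight μ hT.le (Ψ y) t)
        - B (v (Ψ x) x t - v (Ψ y) y t)
        = vectorField hμ A F₁ F₂ (v (Ψ x) x t) - vectorField hμ A F₁ F₂ (v (Ψ y) y t) := by
      rw [← hΨN x hx t ht, ← hΨN y hy t ht, map_sub]
      abel
    rw [h4] at h3
    refine h3.trans ?_
    have h5 := hΨlip x hx y hy
    nlinarith

end LocalExistence

/-! ### Maximal solutions and the semiflow. -/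

section GlobalTheory

open MeasureTheory

variable {E₀ E₁ : Type*} [NormedAddCommGroup E₀] [NormedSpace ℝ E₀]
  [NormedAddCommGroup E₁] [NormedSpace ℝ E₁] {j : E₁ →L[ℝ] E₀} {μ : ℝ}
  {V : Set (InterpSpace j μ)} {A : InterpSpace j μ → E₁ →L[ℝ] E₀}
  {F₁ F₂ : InterpSpace j μ → E₀} {hμ : μ ∈ Ioo (0 : ℝ) 1}

/-- The standing assumptions on the quasilinear problem. -/
structure IsAdmissible (j : E₁ →L[ℝ] E₀) (μ : ℝ) (V : Set (InterpSpace j μ))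
    (A : InterpSpace j μ → E₁ →L[ℝ] E₀) (F₁ F₂ : InterpSpace j μ → E₀) : Prop where
  injective : Function.Injective j
  isOpen : IsOpen V
  lipschitz : LipschitzHypothesis j μ V A F₁
  structural : StructuralHypothesis j μ V F₂

/-- The lifespan of the maximal solution with initial value `x`. -/
def lifespan (hμ : μ ∈ Ioo (0 : ℝ) 1) (V : Set (InterpSpace j μ))
    (A : InterpSpace j μ → E₁ →L[ℝ] E₀) (F₁ F₂ : InterpSpace j μ → E₀)
    (x : InterpSpace j μ) : EReal :=
  sSup ((fun T : ℝ => (T : EReal)) '' {T | 0 < T ∧ ∃ v, IsMildSolution hμ V A F₁ F₂ T x v})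

open Classical in
/-- The maximal solution with initial value `x`, at time `t`. -/
def flow (hμ : μ ∈ Ioo (0 : ℝ) 1) (V : Set (InterpSpace j μ))
    (A : InterpSpace j μ → E₁ →L[ℝ] E₀) (F₁ F₂ : InterpSpace j μ → E₀)
    (t : ℝ) (x : InterpSpace j μ) : InterpSpace j μ :=
  -- The chosen solution depends on t; uniqueness makes this immaterial for x in V. The default x
  -- gives the correct value at t = 0.
  if h : 0 < t ∧ ∃ v, IsMildSolution hμ V A F₁ F₂ t x v then emb j hμ (h.2.choose t) else x

theorem flow_zero (x : InterpSpace j μ) : flow hμ V A F₁ F₂ 0 x = x :=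
  dif_neg fun h => lt_irrefl _ h.1

variable [CompleteSpace E₀]

theorem IsSolutionOn.exists_mild (hμ : μ ∈ Ioo (0 : ℝ) 1) {T : ℝ} (hT : 0 < T)
    {x : InterpSpace j μ} {u : ℝ → InterpSpace j μ} (hu : IsSolutionOn j μ V A F₁ F₂ T x u) :
    ∃ v, IsMildSolution hμ V A F₁ F₂ T x v ∧ ∀ t ∈ Ioc 0 T, u t = emb j hμ (v t) := by
  set v : ℝ → E₁ := fun t => toE₁ j (InterpSpace.incl (u t)) with hv
  have huv : ∀ t ∈ Ioc 0 T, u t = emb j hμ (v t) := fun t ht =>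
    InterpSpace.incl_injective (apply_toE₁ (hu.memMaxReg.mem_range t ht)).symm
  have hN : ∀ t ∈ Ioc 0 T, vectorField hμ A F₁ F₂ (v t)
      = derivWithin (fun s => InterpSpace.incl (u s)) (Ioc 0 T) t := fun t ht => by
    rw [vectorField, ← huv t ht, ← hu.eqn t ht, add_sub_cancel_right]
  refine ⟨v, ⟨hu.memMaxReg.memBC, hu.memMaxReg.memBC1.memBC_deriv.congr hμ.2 hT hN,
    fun t ht => ?_, fun t ht => ?_⟩, huv⟩
  · rw [← huv t ht]
    exact hu.mem t (Ioc_subset_Icc_self ht)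
  · rw [integral_congr_Ioc ht.1.le fun s hs => hN s ⟨hs.1, hs.2.trans ht.2⟩, ← hu.init,
      ← hu.memMaxReg.eq_add_integral hμ.1 ht, huv t ht, incl_emb]

theorem IsMildSolution.memMaxReg (hj : Function.Injective j) {T : ℝ} (hT : 0 < T)
    {x : InterpSpace j μ} {v : ℝ → E₁} (hv : IsMildSolution hμ V A F₁ F₂ T x v)
    {u : ℝ → InterpSpace j μ} (h0 : u 0 = x) (huv : ∀ t ∈ Ioc 0 T, u t = emb j hμ (v t)) :
    MemMaxReg j μ T (fun t => InterpSpace.incl (u t)) ∧ ∀ t ∈ Ioc 0 T,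
      derivWithin (fun s => InterpSpace.incl (u s)) (Ioc 0 T) t = vectorField hμ A F₁ F₂ (v t) ∧
      toE₁ j (InterpSpace.incl (u t)) = v t :=
  memMaxReg_of_eq_add_integral hj hμ hT hv.memBC hv.memBC_vectorField
    (fun t ht => by rw [huv t ht, incl_emb])
    fun t ht => by rw [huv t ht, incl_emb, hv.eqn t ht, h0]

theorem IsMildSolution.isSolutionOn (hj : Function.Injective j) {T : ℝ} (hT : 0 < T)
    {x : InterpSpace j μ} (hx : x ∈ V) {v : ℝ → E₁} (hv : IsMildSolution hμ V A F₁ F₂ T x v)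
    {u : ℝ → InterpSpace j μ} (h0 : u 0 = x) (huv : ∀ t ∈ Ioc 0 T, u t = emb j hμ (v t)) :
    IsSolutionOn j μ V A F₁ F₂ T x u := by
  obtain ⟨h1, h2⟩ := hv.memMaxReg hj hT h0 huv
  refine ⟨h0, fun t ht => ?_, h1, fun t ht => ?_⟩
  · rcases ht.1.eq_or_lt with rfl | h
    · rwa [h0]
    · rw [huv t ⟨h, ht.2⟩]
      exact hv.mem t ⟨h, ht.2⟩
  · rw [(h2 t ht).1, (h2 t ht).2, huv t ht, vectorField, sub_add_cancel]

variable [CompleteSpace E₁]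

/-- Continuous induction: the coincidence set is closed in [δ, T], and at each of its points before
T the shifted solutions share an initial value, so local uniqueness moves further right. -/
theorem IsAdmissible.eqOn (hP : IsAdmissible j μ V A F₁ F₂) {T : ℝ} {x : InterpSpace j μ}
    (hx : x ∈ V) {v w : ℝ → E₁} (hv : IsMildSolution hμ V A F₁ F₂ T x v)
    (hw : IsMildSolution hμ V A F₁ F₂ T x w) : EqOn v w (Ioc 0 T) := by
  rcases le_or_gt T 0 with hT | hT
  · exact fun t ht => absurd (ht.1.trans_le ht.2) hT.not_gt
  obtain ⟨δ, hδ, hvw⟩ :=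
    hv.exists_eqOn hP.injective hP.isOpen hP.lipschitz hP.structural hx hT hw
  have hsub : Icc δ T ⊆ Ioc 0 T := fun t ht => ⟨hδ.1.trans_le ht.1, ht.2⟩
  have hmain : Icc δ T ⊆ {t | v t = w t} := by
    refine IsClosed.Icc_subset_of_forall_exists_gt ?_ (hvw (right_mem_Ioc.mpr hδ.1)) ?_
    · have h := ((hv.memBC.continuousOn.mono hsub).sub
        (hw.memBC.continuousOn.mono hsub)).preimage_isClosed_of_isClosed isClosed_Icc
          (isClosed_singleton (x := 0))
      convert h using 1
      ext t
      simp only [mem_inter_iff, mem_ofPred_eq, mem_preimage, mem_singleton_iff, Pi.sub_apply,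
        sub_eq_zero]
      exact and_comm
    · rintro t ⟨ht, htT⟩ y hy
      have ht' : t ∈ Ioo 0 T := ⟨hδ.1.trans_le htT.1, htT.2⟩
      have hwt := hw.shift ht'
      rw [← show v t = w t from ht] at hwt
      obtain ⟨δ', hδ', hvw'⟩ := (hv.shift ht').exists_eqOn hP.injective hP.isOpen hP.lipschitz
        hP.structural (hv.mem t (hsub ⟨htT.1, htT.2.le⟩)) (sub_pos.mpr htT.2) hwt
      have hy' : 0 < y - t := sub_pos.mpr hy
      refine ⟨t + min δ' (y - t), hvw' ⟨lt_min hδ'.1 hy', min_le_left _ _⟩, ?_, ?_⟩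
      · linarith [lt_min hδ'.1 hy']
      · linarith [min_le_right δ' (y - t)]
  intro t ht
  rcases le_total t δ with h | h
  · exact hvw ⟨ht.1, h⟩
  · exact hmain ⟨h, ht.2⟩

theorem IsAdmissible.flow_eq (hP : IsAdmissible j μ V A F₁ F₂) {T : ℝ} {x : InterpSpace j μ}
    (hx : x ∈ V) {v : ℝ → E₁} (hv : IsMildSolution hμ V A F₁ F₂ T x v) {t : ℝ}
    (ht : t ∈ Ioc 0 T) : flow hμ V A F₁ F₂ t x = emb j hμ (v t) := by
  have hvt := hv.mono ht.2
  have hex : 0 < t ∧ ∃ v, IsMildSolution hμ V A F₁ F₂ t x v := ⟨ht.1, v, hvt⟩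
  rw [flow, dif_pos hex, hP.eqOn hx hex.2.choose_spec hvt (right_mem_Ioc.mpr ht.1)]

theorem IsAdmissible.exists_glue (hP : IsAdmissible j μ V A F₁ F₂) {a b d : ℝ}
    {x : InterpSpace j μ} {v w : ℝ → E₁} (ha : 0 < a) (hab : a < b) (hbd : b ≤ a + d)
    (hv : IsMildSolution hμ V A F₁ F₂ b x v)
    (hw : IsMildSolution hμ V A F₁ F₂ d (emb j hμ (v a)) w) :
    ∃ y, IsMildSolution hμ V A F₁ F₂ (a + d) x y :=
  ⟨_, hv.glue ha hab hbd hw (hP.eqOn (hv.mem a ⟨ha, hab.le⟩) (hw.mono (by linarith))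
    (hv.shift ⟨ha, hab⟩))⟩

/-- Local existence has a common time τ on an E_μ-ball around v(T). Restarting at some a in (T − τ,
T) with v(a) in that ball passes T and leaves the overlap (a, T] needed for gluing. -/
theorem IsAdmissible.exists_extension (hP : IsAdmissible j μ V A F₁ F₂) {T : ℝ} (hT : 0 < T)
    {x : InterpSpace j μ} {v : ℝ → E₁} (hv : IsMildSolution hμ V A F₁ F₂ T x v) :
    ∃ T' > T, ∃ w, IsMildSolution hμ V A F₁ F₂ T' x w := by
  obtain ⟨τ, hτ, ε, hε, K, -, -, S, hS, -⟩ := exists_local_solution (hμ := hμ) hP.injective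
    hP.isOpen hP.lipschitz hP.structural (hv.mem T (right_mem_Ioc.mpr hT))
  have hc : Tendsto (fun t => emb j hμ (v t)) (𝓝[<] T) (𝓝 (emb j hμ (v T))) := by
    have h : ContinuousWithinAt v (Ioo 0 T) T :=
      (hv.memBC.continuousOn T (right_mem_Ioc.mpr hT)).mono Ioo_subset_Ioc_self
    rw [ContinuousWithinAt, nhdsWithin_Ioo_eq_nhdsLT hT] at h
    exact (emb j hμ).continuous.continuousAt.tendsto.comp h
  obtain ⟨a, ha1, ha2⟩ := ((hc.eventually (Metric.closedBall_mem_nhds _ hε)).and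
    (Ioo_mem_nhdsLT (max_lt hT (sub_lt_self T hτ)))).exists
  have ha0 : 0 < a := (le_max_left _ _).trans_lt ha2.1
  have haτ : T - τ < a := (le_max_right _ _).trans_lt ha2.1
  exact ⟨a + τ, by linarith, hP.exists_glue ha0 ha2.2 (by linarith) hv (hS _ ha1)⟩

/-- Every solution extends strictly past its endpoint, so no existence time attains the supremum and
the inequality is strict. -/
theorem IsAdmissible.lt_lifespan_iff (hP : IsAdmissible j μ V A F₁ F₂) {T : ℝ} (hT : 0 < T)
    {x : InterpSpace j μ} :
    (T : EReal) < lifespan hμ V A F₁ F₂ x ↔ ∃ v, IsMildSolution hμ V A F₁ F₂ T x v := by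
  rw [lifespan, lt_sSup_iff]
  constructor
  · rintro ⟨_, ⟨T', ⟨-, v, hv⟩, rfl⟩, hTT'⟩
    exact ⟨v, hv.mono (EReal.coe_lt_coe_iff.mp hTT').le⟩
  · rintro ⟨v, hv⟩
    obtain ⟨T', hT', w, hw⟩ := hP.exists_extension hT hv
    exact ⟨_, ⟨T', ⟨hT.trans hT', w, hw⟩, rfl⟩, EReal.coe_lt_coe_iff.mpr hT'⟩

theorem IsAdmissible.lifespan_pos (hP : IsAdmissible j μ V A F₁ F₂) {x : InterpSpace j μ}
    (hx : x ∈ V) : 0 < lifespan hμ V A F₁ F₂ x := by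
  obtain ⟨τ, hτ, ε, hε, -, -, -, S, hS, -⟩ := exists_local_solution (hμ := hμ) hP.injective
    hP.isOpen hP.lipschitz hP.structural hx
  exact (EReal.coe_pos.mpr hτ).trans
    ((hP.lt_lifespan_iff hτ).mpr ⟨_, hS x (Metric.mem_closedBall_self hε.le)⟩)

theorem IsAdmissible.isMaximalSolutionMap (hP : IsAdmissible j μ V A F₁ F₂) :
    IsMaximalSolutionMap j μ V A F₁ F₂ (lifespan hμ V A F₁ F₂) (flow hμ V A F₁ F₂) := by
  refine fun x hx => ⟨hP.lifespan_pos hx, fun T hT hTx => ?_, fun T hT w hw => ?_⟩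
  · obtain ⟨v, hv⟩ := (hP.lt_lifespan_iff hT).mp hTx
    exact hv.isSolutionOn hP.injective hT hx (flow_zero x) fun t ht => hP.flow_eq hx hv ht
  · obtain ⟨v, hv, hwv⟩ := hw.exists_mild hμ hT
    refine ⟨(hP.lt_lifespan_iff hT).mpr ⟨v, hv⟩, fun t ht => ?_⟩
    rcases ht.1.eq_or_lt with rfl | h
    · exact hw.init.trans (flow_zero x).symm
    · exact (hwv t ⟨h, ht.2⟩).trans (hP.flow_eq hx hv ⟨h, ht.2⟩).symm

theorem IsAdmissible.flow_mem (hP : IsAdmissible j μ V A F₁ F₂) {x : InterpSpace j μ}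
    (hx : x ∈ V) {t : ℝ} (ht : 0 ≤ t) (htx : (t : EReal) < lifespan hμ V A F₁ F₂ x) :
    flow hμ V A F₁ F₂ t x ∈ V := by
  rcases ht.eq_or_lt with rfl | h
  · rwa [flow_zero]
  · obtain ⟨v, hv⟩ := (hP.lt_lifespan_iff h).mp htx
    rw [hP.flow_eq hx hv (right_mem_Ioc.mpr h)]
    exact hv.mem t (right_mem_Ioc.mpr h)

theorem IsAdmissible.continuousOn_flow_left (hP : IsAdmissible j μ V A F₁ F₂)
    {x : InterpSpace j μ} (hx : x ∈ V) {T : ℝ} (hTx : (T : EReal) < lifespan hμ V A F₁ F₂ x) :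
    ContinuousOn (fun t => flow hμ V A F₁ F₂ t x) (Icc 0 T) := by
  rcases le_or_gt T 0 with hT | hT
  · exact (subsingleton_Icc_of_ge hT).continuousOn _
  obtain ⟨v, hv⟩ := (hP.lt_lifespan_iff hT).mp hTx
  intro t ht
  rcases ht.1.eq_or_lt with rfl | h
  · rw [← continuousWithinAt_sdiff_self, Icc_sdiff_left, ContinuousWithinAt, flow_zero,
      nhdsWithin_Ioc_eq_nhdsGT hT]
    refine (hv.tendsto_emb hT).congr' ?_
    filter_upwards [Ioc_mem_nhdsGT hT] with s hs using (hP.flow_eq hx hv hs).symm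
  · have h1 : ContinuousWithinAt (fun t => flow hμ V A F₁ F₂ t x) (Ioc 0 T) t :=
      ((emb j hμ).continuous.comp_continuousOn hv.memBC.continuousOn).congr
        (fun s hs => hP.flow_eq hx hv hs) t ⟨h, ht.2⟩
    refine h1.mono_of_mem_nhdsWithin ?_
    filter_upwards [self_mem_nhdsWithin, mem_nhdsWithin_of_mem_nhds (Ioi_mem_nhds h)]
      with s hs hs' using ⟨hs', hs.2⟩

theorem IsAdmissible.lt_lifespan_flow_iff (hP : IsAdmissible j μ V A F₁ F₂)
    {x : InterpSpace j μ} (hx : x ∈ V) {s t : ℝ} (hs : 0 ≤ s)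
    (hsx : (s : EReal) < lifespan hμ V A F₁ F₂ x) (ht : 0 ≤ t) :
    (t : EReal) < lifespan hμ V A F₁ F₂ (flow hμ V A F₁ F₂ s x) ↔
      ((s + t : ℝ) : EReal) < lifespan hμ V A F₁ F₂ x := by
  rcases hs.eq_or_lt with rfl | hs
  · rw [flow_zero, zero_add]
  rcases ht.eq_or_lt with rfl | ht
  · rw [add_zero]
    exact iff_of_true (hP.lifespan_pos (hP.flow_mem hx hs.le hsx)) hsx
  rw [hP.lt_lifespan_iff ht, hP.lt_lifespan_iff (add_pos hs ht)]
  obtain ⟨v₀, hv₀⟩ := (hP.lt_lifespan_iff hs).mp hsx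
  -- Going slightly beyond s supplies the overlap for gluing with the solution that restarts at s.
  obtain ⟨b, hb, v, hv⟩ := hP.exists_extension hs hv₀
  constructor
  · rintro ⟨w, hw⟩
    rw [hP.flow_eq hx hv ⟨hs, hb.le⟩] at hw
    rcases le_total (s + t) b with h | h
    · exact ⟨v, hv.mono h⟩
    · exact hP.exists_glue hs hb h hv hw
  · rintro ⟨w, hw⟩
    have h := hw.shift ⟨hs, lt_add_of_pos_right s ht⟩
    rw [add_sub_cancel_left, ← hP.flow_eq hx hw ⟨hs, (lt_add_of_pos_right s ht).le⟩] at h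
    exact ⟨_, h⟩

theorem IsAdmissible.flow_add (hP : IsAdmissible j μ V A F₁ F₂)
    {x : InterpSpace j μ} (hx : x ∈ V) {s t : ℝ} (hs : 0 ≤ s) (ht : 0 ≤ t)
    (hst : ((s + t : ℝ) : EReal) < lifespan hμ V A F₁ F₂ x) :
    flow hμ V A F₁ F₂ (s + t) x = flow hμ V A F₁ F₂ t (flow hμ V A F₁ F₂ s x) := by
  rcases hs.eq_or_lt with rfl | hs
  · rw [flow_zero, zero_add]
  rcases ht.eq_or_lt with rfl | ht
  · rw [flow_zero, add_zero]
  obtain ⟨w, hw⟩ := (hP.lt_lifespan_iff (add_pos hs ht)).mp hst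
  have hs' : s ∈ Ioo 0 (s + t) := ⟨hs, lt_add_of_pos_right s ht⟩
  have h := hw.shift hs'
  rw [add_sub_cancel_left] at h
  rw [hP.flow_eq hx hw (right_mem_Ioc.mpr (add_pos hs ht)),
    hP.flow_eq hx hw (Ioo_subset_Ioc_self hs'),
    hP.flow_eq (hw.mem s (Ioo_subset_Ioc_self hs')) h (right_mem_Ioc.mpr ht)]

/-- The local existence theorem in terms of the maximal solutions. -/
theorem IsAdmissible.exists_local_flow (hP : IsAdmissible j μ V A F₁ F₂) {x₀ : InterpSpace j μ}
    (hx₀ : x₀ ∈ V) :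
    ∃ τ > (0 : ℝ), ∃ ε > (0 : ℝ), ∃ σ > (0 : ℝ), ∃ c > (0 : ℝ),
      (∀ x ∈ Metric.closedBall x₀ ε, x ∈ V ∧ (τ : EReal) < lifespan hμ V A F₁ F₂ x ∧
        ContinuousOn (fun t => flow hμ V A F₁ F₂ t x) (Icc 0 τ)) ∧
      ∀ x₁ ∈ Metric.closedBall x₀ ε, ∀ x₂ ∈ Metric.closedBall x₀ ε,
        (∀ t ∈ Ioc 0 τ, t ^ (1 - μ) *
          (‖derivWithin (fun s => InterpSpace.incl (flow hμ V A F₁ F₂ s x₁)) (Ioc 0 τ) t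
              - derivWithin (fun s => InterpSpace.incl (flow hμ V A F₁ F₂ s x₂)) (Ioc 0 τ) t‖
            + ‖toE₁ j (InterpSpace.incl (flow hμ V A F₁ F₂ t x₁))
              - toE₁ j (InterpSpace.incl (flow hμ V A F₁ F₂ t x₂))‖) ≤ σ * ‖x₁ - x₂‖) ∧
        ∀ t ∈ Icc 0 τ,
          ‖flow hμ V A F₁ F₂ t x₁ - flow hμ V A F₁ F₂ t x₂‖ ≤ c * ‖x₁ - x₂‖ := by
  obtain ⟨τ, hτ, ε, hε, K, hK, hball, S, hS, hSK⟩ := exists_local_solution (hμ := hμ) hP.injective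
    hP.isOpen hP.lipschitz hP.structural hx₀
  have hlt : ∀ x ∈ Metric.closedBall x₀ ε, (τ : EReal) < lifespan hμ V A F₁ F₂ x := fun x hx =>
    (hP.lt_lifespan_iff hτ).mpr ⟨_, hS x hx⟩
  -- The estimate with K covers only t > 0; at t = 0 the difference is x₁ − x₂ itself, which the
  -- additional 1 accommodates.
  refine ⟨τ, hτ, ε, hε, K, hK, K + 1, by positivity, fun x hx => ⟨hball hx, hlt x hx,
    hP.continuousOn_flow_left (hball hx) (hlt x hx)⟩, fun x₁ hx₁ x₂ hx₂ => ⟨fun t ht => ?_,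
    fun t ht => ?_⟩⟩
  · have h := fun x (hx : x ∈ Metric.closedBall x₀ ε) =>
      ((hS x hx).memMaxReg hP.injective hτ (u := fun s => flow hμ V A F₁ F₂ s x) (flow_zero x)
        fun s hs => hP.flow_eq (hball hx) (hS x hx) hs).2 t ht
    rw [(h x₁ hx₁).1, (h x₁ hx₁).2, (h x₂ hx₂).1, (h x₂ hx₂).2, mul_add]
    linarith [hSK x₁ hx₁ x₂ hx₂ t ht, norm_nonneg (emb j hμ (S x₁ t - S x₂ t))]
  · rcases ht.1.eq_or_lt with rfl | h
    · rw [flow_zero, flow_zero]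
      nlinarith [norm_nonneg (x₁ - x₂)]
    · have ht' : t ∈ Ioc 0 τ := ⟨h, ht.2⟩
      rw [hP.flow_eq (hball hx₁) (hS x₁ hx₁) ht', hP.flow_eq (hball hx₂) (hS x₂ hx₂) ht', ← map_sub]
      have h1 := hSK x₁ hx₁ x₂ hx₂ t ht'
      have h2 : 0 ≤ t ^ (1 - μ) * ‖S x₁ t - S x₂ t‖ := by positivity
      have h3 : 0 ≤ t ^ (1 - μ)
        * ‖vectorField hμ A F₁ F₂ (S x₁ t) - vectorField hμ A F₁ F₂ (S x₂ t)‖ := by positivity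
      linarith [norm_nonneg (x₁ - x₂)]

/-- On compact time intervals the solutions depend on the initial value in a locally Lipschitz
way. -/
theorem IsAdmissible.exists_nhds_lipschitz (hP : IsAdmissible j μ V A F₁ F₂)
    {x₀ : InterpSpace j μ} (hx₀ : x₀ ∈ V) {t₀ : ℝ} (ht₀ : 0 ≤ t₀)
    (htx₀ : (t₀ : EReal) < lifespan hμ V A F₁ F₂ x₀) :
    ∃ W ∈ 𝓝 x₀, ∃ c > 0, (∀ x ∈ W, x ∈ V ∧ (t₀ : EReal) < lifespan hμ V A F₁ F₂ x) ∧
      ∀ x ∈ W, ∀ y ∈ W, ∀ s ∈ Icc 0 t₀,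
        ‖flow hμ V A F₁ F₂ s x - flow hμ V A F₁ F₂ s y‖ ≤ c * ‖x - y‖ := by
  set P : ℝ → Prop := fun t => ∃ W ∈ 𝓝 x₀, ∃ c > 0,
    (∀ x ∈ W, x ∈ V ∧ (t : EReal) < lifespan hμ V A F₁ F₂ x) ∧
      ∀ x ∈ W, ∀ y ∈ W, ∀ s ∈ Icc 0 t,
        ‖flow hμ V A F₁ F₂ s x - flow hμ V A F₁ F₂ s y‖ ≤ c * ‖x - y‖ with hPdef
  have hmono : ∀ {s t : ℝ}, s ≤ t → P t → P s := by
    rintro s t hst ⟨W, hW, c, hc, h1, h2⟩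
    exact ⟨W, hW, c, hc, fun x hx => ⟨(h1 x hx).1,
      (EReal.coe_le_coe_iff.mpr hst).trans_lt (h1 x hx).2⟩,
      fun x hx y hy r hr => h2 x hx y hy r ⟨hr.1, hr.2.trans hst⟩⟩
  have hzero : P 0 := by
    refine ⟨V, hP.isOpen.mem_nhds hx₀, 1, one_pos, fun x hx => ⟨hx, hP.lifespan_pos hx⟩,
      fun x _ y _ s hs => ?_⟩
    obtain rfl : s = 0 := le_antisymm hs.2 hs.1
    rw [flow_zero, flow_zero, one_mul]
  -- The local theorem is applied once, at the point reached at time t₁. Its ball contains the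
  -- states at every s slightly before t₁ for initial values near x₀, so the gain τ is the same for
  -- all such s.
  have hstep : ∀ t₁ ∈ Icc 0 t₀, ∃ τ > 0, ∃ δ ∈ Ioc 0 τ, ∀ s ∈ Icc 0 t₁, t₁ - s < δ → P s →
      P (s + τ) := by
    intro t₁ ht₁
    have ht₁x : (t₁ : EReal) < lifespan hμ V A F₁ F₂ x₀ :=
      (EReal.coe_le_coe_iff.mpr ht₁.2).trans_lt htx₀
    obtain ⟨τ, hτ, ε, hε, σ, -, c, hc, h1, h2⟩ :=
      hP.exists_local_flow (hμ := hμ) (hP.flow_mem hx₀ ht₁.1 ht₁x)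
    have hcont := hP.continuousOn_flow_left hx₀ htx₀ t₁ ht₁
    obtain ⟨δ, hδ, hδ'⟩ := Metric.continuousWithinAt_iff.mp hcont (ε / 2) (half_pos hε)
    refine ⟨τ, hτ, min δ τ, ⟨lt_min hδ hτ, min_le_right _ _⟩, ?_⟩
    rintro s hs hst ⟨W, hW, c', hc', h3, h4⟩
    have hsx₀ : dist (flow hμ V A F₁ F₂ s x₀) (flow hμ V A F₁ F₂ t₁ x₀) < ε / 2 := by
      refine hδ' ⟨hs.1, hs.2.trans ht₁.2⟩ ?_
      rw [Real.dist_eq, abs_sub_comm, abs_of_nonneg (sub_nonneg.mpr hs.2)]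
      exact hst.trans_le (min_le_left _ _)
    have hε' : 0 < ε / 2 / c' := by positivity
    have hmem : ∀ x ∈ W ∩ Metric.ball x₀ (ε / 2 / c'),
        flow hμ V A F₁ F₂ s x ∈ Metric.closedBall (flow hμ V A F₁ F₂ t₁ x₀) ε := by
      intro x hx
      have h5 := h4 x hx.1 x₀ (mem_of_mem_nhds hW) s ⟨hs.1, le_rfl⟩
      have h6 := hx.2
      rw [Metric.mem_ball, dist_eq_norm, lt_div_iff₀ hc'] at h6
      have h7 := dist_triangle (flow hμ V A F₁ F₂ s x) (flow hμ V A F₁ F₂ s x₀)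
        (flow hμ V A F₁ F₂ t₁ x₀)
      rw [dist_eq_norm (flow hμ V A F₁ F₂ s x) (flow hμ V A F₁ F₂ s x₀)] at h7
      rw [Metric.mem_closedBall]
      linarith
    have hlt : ∀ x ∈ W ∩ Metric.ball x₀ (ε / 2 / c'),
        ((s + τ : ℝ) : EReal) < lifespan hμ V A F₁ F₂ x := fun x hx =>
      (hP.lt_lifespan_flow_iff (h3 x hx.1).1 hs.1 (h3 x hx.1).2 hτ.le).mp (h1 _ (hmem x hx)).2.1
    -- The term c' serves times up to s; c c' is the composed Lipschitz constant after s.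
    refine ⟨W ∩ Metric.ball x₀ (ε / 2 / c'), inter_mem hW (Metric.ball_mem_nhds _ hε'),
      c' + c * c', by positivity, fun x hx => ⟨(h3 x hx.1).1, hlt x hx⟩,
      fun x hx y hy r hr => ?_⟩
    rcases le_total r s with hrs | hrs
    · refine (h4 x hx.1 y hy.1 r ⟨hr.1, hrs⟩).trans ?_
      gcongr
      exact le_add_of_nonneg_right (by positivity)
    · have hrτ : r - s ∈ Icc 0 τ := ⟨sub_nonneg.mpr hrs, by linarith [hr.2]⟩
      have hsplit : ∀ z ∈ W ∩ Metric.ball x₀ (ε / 2 / c'), flow hμ V A F₁ F₂ r z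
          = flow hμ V A F₁ F₂ (r - s) (flow hμ V A F₁ F₂ s z) := fun z hz => by
        rw [← hP.flow_add (h3 z hz.1).1 hs.1 hrτ.1, add_sub_cancel]
        rw [add_sub_cancel]
        exact (EReal.coe_le_coe_iff.mpr hr.2).trans_lt (hlt z hz)
      rw [hsplit x hx, hsplit y hy]
      calc _ ≤ c * ‖flow hμ V A F₁ F₂ s x - flow hμ V A F₁ F₂ s y‖ :=
            (h2 _ (hmem x hx) _ (hmem y hy)).2 _ hrτ
        _ ≤ c * (c' * ‖x - y‖) := by
          gcongr
          exact h4 x hx.1 y hy.1 s ⟨hs.1, le_rfl⟩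
        _ ≤ (c' + c * c') * ‖x - y‖ := by
          rw [← mul_assoc]
          gcongr
          exact le_add_of_nonneg_left hc'.le
  -- The supremum need not be known to lie in Q: some s in Q is within δ of it, and since δ ≤ τ the
  -- step to s + τ overshoots the supremum unless it passes t₀.
  set Q : Set ℝ := {t | t ∈ Icc 0 t₀ ∧ P t} with hQ
  have hQ0 : (0 : ℝ) ∈ Q := ⟨left_mem_Icc.mpr ht₀, hzero⟩
  have hQb : BddAbove Q := ⟨t₀, fun t ht => ht.1.2⟩
  have hsup : sSup Q ∈ Icc 0 t₀ :=
    ⟨le_csSup hQb hQ0, csSup_le ⟨0, hQ0⟩ fun t ht => ht.1.2⟩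
  obtain ⟨τ, hτ, δ, hδ, h⟩ := hstep _ hsup
  obtain ⟨s, hs, hsδ⟩ := exists_lt_of_lt_csSup ⟨0, hQ0⟩ (sub_lt_self (sSup Q) hδ.1)
  have hsτ := h s ⟨hs.1.1, le_csSup hQb hs⟩ (by linarith) hs.2
  rcases le_total t₀ (s + τ) with h1 | h1
  · exact hmono h1 hsτ
  · have := le_csSup hQb (show s + τ ∈ Q from ⟨⟨by linarith [hs.1.1], h1⟩, hsτ⟩)
    linarith [hδ.2]

/-- Uniform Lipschitz dependence is taken up to some t₁ > t₀ still below the lifespan of x₀, giving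
room in time around t₀. Joint continuity combines it with continuity in t of the single trajectory
of x₀. -/
theorem IsAdmissible.isLocallyLipschitzSemiflow (hP : IsAdmissible j μ V A F₁ F₂) :
    IsLocallyLipschitzSemiflow V (lifespan hμ V A F₁ F₂) (flow hμ V A F₁ F₂) := by
  have hnhds : ∀ (t₀ : ℝ) (x₀ : InterpSpace j μ),
      (t₀, x₀) ∈ flowDomain V (lifespan hμ V A F₁ F₂) → ∃ t₁ > t₀,
      (t₁ : EReal) < lifespan hμ V A F₁ F₂ x₀ ∧ ∃ W ∈ 𝓝 x₀, ∃ c > 0,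
      (∀ x ∈ W, x ∈ V ∧ (t₁ : EReal) < lifespan hμ V A F₁ F₂ x) ∧
      ∀ x ∈ W, ∀ y ∈ W, ∀ s ∈ Icc 0 t₁,
        ‖flow hμ V A F₁ F₂ s x - flow hμ V A F₁ F₂ s y‖ ≤ c * ‖x - y‖ := by
    rintro t₀ x₀ ⟨hx₀, ht₀, htx₀⟩
    obtain ⟨t₁, ht₁, ht₁x⟩ := EReal.lt_iff_exists_real_btwn.mp htx₀
    have ht₁' : t₀ < t₁ := EReal.coe_lt_coe_iff.mp ht₁
    exact ⟨t₁, ht₁', ht₁x, hP.exists_nhds_lipschitz hx₀ (ht₀.trans ht₁'.le) ht₁x⟩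
  refine ⟨fun x hx => hP.lifespan_pos hx, ?_, fun t x h => hP.flow_mem h.1 h.2.1 h.2.2, ?_,
    fun x _ => flow_zero x, fun s t x h ht => hP.lt_lifespan_flow_iff h.1 h.2.1 h.2.2 ht,
    fun s t x h h' => hP.flow_add h.1 h.2.1 h'.2.1
      ((hP.lt_lifespan_flow_iff h.1 h.2.1 h.2.2 h'.2.1).mp h'.2.2), ?_⟩
  -- The implication admits all points outside ℝ₊ × V, so its interior is an ambient open set that
  -- cuts out exactly the domain.
  · refine ⟨interior {p | p ∈ Ici (0 : ℝ) ×ˢ V → p ∈ flowDomain V (lifespan hμ V A F₁ F₂)},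
      isOpen_interior, Subset.antisymm ?_ fun p hp => interior_subset hp.1 hp.2⟩
    rintro ⟨t₀, x₀⟩ h
    obtain ⟨t₁, ht₁, -, W, hW, -, -, h1, -⟩ := hnhds t₀ x₀ h
    refine ⟨mem_interior_iff_mem_nhds.mpr ?_, h.2.1, h.1⟩
    filter_upwards [prod_mem_nhds (Iio_mem_nhds ht₁) hW] with p hp hp'
    exact ⟨hp'.2, hp'.1, (EReal.coe_lt_coe_iff.mpr hp.1).trans (h1 _ hp.2).2⟩
  · rintro ⟨t₀, x₀⟩ h
    obtain ⟨t₁, ht₁, ht₁x, W, hW, c, hc, h1, h2⟩ := hnhds t₀ x₀ h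
    have hflow : Tendsto (fun p : ℝ × InterpSpace j μ => flow hμ V A F₁ F₂ p.1 x₀)
        (𝓝[flowDomain V (lifespan hμ V A F₁ F₂)] (t₀, x₀)) (𝓝 (flow hμ V A F₁ F₂ t₀ x₀)) := by
      refine (hP.continuousOn_flow_left h.1 ht₁x t₀ ⟨h.2.1, ht₁.le⟩).tendsto.comp ?_
      refine tendsto_nhdsWithin_iff.mpr
        ⟨(continuous_fst.tendsto (t₀, x₀)).mono_left nhdsWithin_le_nhds, ?_⟩
      filter_upwards [self_mem_nhdsWithin, mem_nhdsWithin_of_mem_nhds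
        (prod_mem_nhds (Iio_mem_nhds ht₁) univ_mem)] with p hp hp' using ⟨hp.2.1, le_of_lt hp'.1⟩
    have hlim : Tendsto (fun p : ℝ × InterpSpace j μ => c * ‖p.2 - x₀‖
        + ‖flow hμ V A F₁ F₂ p.1 x₀ - flow hμ V A F₁ F₂ t₀ x₀‖)
        (𝓝[flowDomain V (lifespan hμ V A F₁ F₂)] (t₀, x₀)) (𝓝 0) := by
      have h3 : Tendsto (fun p : ℝ × InterpSpace j μ => c * ‖p.2 - x₀‖)
          (𝓝[flowDomain V (lifespan hμ V A F₁ F₂)] (t₀, x₀)) (𝓝 (c * ‖x₀ - x₀‖)) :=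
        ((continuous_const.mul (continuous_snd.sub continuous_const).norm).tendsto
          (t₀, x₀)).mono_left nhdsWithin_le_nhds
      have h4 := h3.add (hflow.sub_const (flow hμ V A F₁ F₂ t₀ x₀)).norm
      simpa using h4
    rw [ContinuousWithinAt, tendsto_iff_norm_sub_tendsto_zero]
    refine squeeze_zero' (Eventually.of_forall fun _ => norm_nonneg _) ?_ hlim
    filter_upwards [self_mem_nhdsWithin, mem_nhdsWithin_of_mem_nhds
      (prod_mem_nhds (Iio_mem_nhds ht₁) hW)] with p hp hp'
    refine (norm_sub_le_norm_sub_add_norm_sub _ (flow hμ V A F₁ F₂ p.1 x₀) _).trans ?_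
    gcongr
    exact h2 _ hp'.2 _ (mem_of_mem_nhds hW) _ ⟨hp.2.1, le_of_lt hp'.1⟩
  · intro t₀ x₀ h
    obtain ⟨t₁, ht₁, -, W, hW, c, hc, h1, h2⟩ := hnhds t₀ x₀ h
    refine ⟨Icc 0 t₁, ?_, W, mem_nhdsWithin_of_mem_nhds hW, ?_, c, hc,
      fun t ht x hx y hy => h2 x hx y hy t ht⟩
    · filter_upwards [self_mem_nhdsWithin, mem_nhdsWithin_of_mem_nhds (Iio_mem_nhds ht₁)]
        with t ht ht' using ⟨ht, le_of_lt ht'⟩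
    · rintro ⟨t, x⟩ ⟨ht, hx⟩
      exact ⟨(h1 x hx).1, ht.1, (EReal.coe_le_coe_iff.mpr ht.2).trans_lt (h1 x hx).2⟩

end GlobalTheory

end QuasilinearSemiflow

end

theorem corollary2p3 {E₀ E₁ : Type*}
    [NormedAddCommGroup E₀] [NormedSpace ℝ E₀] [CompleteSpace E₀]
    [NormedAddCommGroup E₁] [NormedSpace ℝ E₁] [CompleteSpace E₁]
    (j : E₁ →L[ℝ] E₀) (hj : Function.Injective j) (hdense : DenseRange j)
    (μ : ℝ) (hμ : μ ∈ Set.Ioo (0 : ℝ) 1)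
    (V : Set (InterpSpace j μ)) (hV : IsOpen V)
    (A : InterpSpace j μ → E₁ →L[ℝ] E₀)
    (F₁ F₂ : InterpSpace j μ → E₀)
    (h₁ : LipschitzHypothesis j μ V A F₁)
    (h₂ : StructuralHypothesis j μ V F₂) :
    ∃ (tp : InterpSpace j μ → EReal)
      (u : ℝ → InterpSpace j μ → InterpSpace j μ),
      IsMaximalSolutionMap j μ V A F₁ F₂ tp u ∧
      (∀ x₀ ∈ V, ∃ τ > (0 : ℝ), ∃ ε > (0 : ℝ), ∃ σ > (0 : ℝ), ∃ c > (0 : ℝ),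
        (∀ x ∈ Metric.closedBall x₀ ε, x ∈ V ∧ (τ : EReal) < tp x ∧
          ContinuousOn (fun t => u t x) (Icc 0 τ)) ∧
        ∀ x₁ ∈ Metric.closedBall x₀ ε, ∀ x₂ ∈ Metric.closedBall x₀ ε,
          (∀ t ∈ Ioc 0 τ,
            t ^ (1 - μ) *
              (‖derivWithin (fun s => InterpSpace.incl (u s x₁))
                    (Ioc 0 τ) t
                  - derivWithin (fun s => InterpSpace.incl (u s x₂))
                    (Ioc 0 τ) t‖
                + ‖toE₁ j (InterpSpace.incl (u t x₁))
                  - toE₁ j (InterpSpace.incl (u t x₂))‖)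
              ≤ σ * ‖x₁ - x₂‖) ∧
          ∀ t ∈ Icc 0 τ, ‖u t x₁ - u t x₂‖ ≤ c * ‖x₁ - x₂‖) ∧
      IsLocallyLipschitzSemiflow V tp u := by
  have hP : IsAdmissible j μ V A F₁ F₂ := ⟨hj, hV, h₁, h₂⟩
  exact ⟨lifespan hμ V A F₁ F₂, flow hμ V A F₁ F₂, hP.isMaximalSolutionMap,
    fun x₀ hx₀ => hP.exists_local_flow hx₀, hP.isLocallyLipschitzSemiflow⟩
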